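/- Let $\bar{\mathbb N}^\ast=\{1,2,\dots\}\cup\{\infty\}$ be the one-point compactification of $\mathbb N^\ast=\{1,2,\dots\}$. Let $\gamma:\mathbb N^\ast\to(0,\infty)$ satisfy $\sum_{x}\gamma(x)<\infty$, put $\gamma(\infty)=0$, and let $c\ge 0$. On a probability space let $(N^{(x)}_t)_{t\ge0}$, $x\in\mathbb N^\ast$, be i.i.d. Poisson processes of rate 1, with $\sigma^{(x)}_j$ the $j$-th event time of $N^{(x)}$, and let $T_0$ and $T^{(x)}_i$ ($i\ge1$, $x\in\mathbb N^\ast$) be i.i.d. exponential random variables of rate 1, independent of the family of Poisson processes. For $y\in\bar{\mathbb N}^\ast$ and $t\ge 0$ let $$\Gamma^{c,y}(t)=\gamma(y)T_0+\sum_{x=1}^\infty\gamma(x)\sum_{i=1}^{N^{(x)}_t}T^{(x)}_i+ct,$$ and define the K$(\gamma,c)$-process started at $y$ by $$\tilde X^{c,y}(t)=\begin{cases}y,&0\le t<\gamma(y)T_0,\\ x,&\Gamma^{c,y}(\sigma^{(x)}_j-)\le t<\Gamma^{c,y}(\sigma^{(x)}_j)\text{ for some }j\ge1,\\ \infty,&\text{otherwise.}\end{cases}$$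 Then: (1) for every $y\in\bar{\mathbb N}^\ast$, almost surely, the path $t\mapsto\tilde X^{c,y}(t)$ is càdlàg (right-continuous with left limits in $\bar{\mathbb N}^\ast$); (2) $(\tilde X^{c,y})_{y\in\bar{\mathbb N}^\ast}$ is a time-homogeneous Markov family: for every $y$, $\tilde X^{c,y}(0)=y$ almost surely, and for all $s,t\ge0$ and every Borel set $A\subset\bar{\mathbb N}^\ast$, almost surely, $$\mathbb P\big(\tilde X^{c,y}(s+t)\in A\,\big|\,\tilde X^{c,y}(r),\,r\le s\big)=\Psi_t\big(\tilde X^{c,y}(s),A\big),\qquad \Psi_t(z,A)=\mathbb P\big(\tilde X^{c,z}(t)\in A\big).$$ -/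

import Mathlib

open MeasureTheory ProbabilityTheory Filter Topology Set
open scoped NNReal ENNReal

noncomputable section

/-- The state space: the one-point compactification of `{1, 2, …}`. Its topology is the
one of any metric making it compact, for instance `|1/x - 1/y|` with `1/∞ = 0`. -/
abbrev KState : Type := OnePoint ℕ+

/-- The Borel σ-algebra on the state space. -/
instance KState.instMeasurableSpace : MeasurableSpace KState := borel KState

instance KState.instBorelSpace : BorelSpace KState := ⟨rfl⟩

/-- A path indexed by `[0, ∞)` is càdlàg if it is right-continuous and has left limits.
(At `t = 0` the filter `𝓝[<] t` is `⊥`, so nothing is asked there.) -/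
def IsCadlag {E : Type*} [TopologicalSpace E] (f : ℝ≥0 → E) : Prop :=
  ∀ t : ℝ≥0, ContinuousWithinAt f (Ici t) t ∧ ∃ l : E, Tendsto f (𝓝[<] t) (𝓝 l)

/-- `N` is a Poisson (counting) process of rate `r`: its paths start at `0`, are nondecreasing,
right-continuous and integer valued, its increments are independent, and the increment over
`(s, t]` has the Poisson law of mean `r * (t - s)`. (The subtractions do not truncate, since
`s ≤ t` and the paths are monotone.) -/
structure IsPoissonProcess {Ω : Type*} [MeasurableSpace Ω]
    (N : ℝ≥0 → Ω → ℕ) (r : ℝ≥0) (P : Measure Ω) : Prop where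
  measurable : ∀ t, Measurable (N t)
  zero : ∀ ω, N 0 ω = 0
  mono : ∀ ω, Monotone (fun t => N t ω)
  rightCont : ∀ ω t, ContinuousWithinAt (fun t => N t ω) (Ici t) t
  indepIncrements : HasIndepIncrements N P
  law : ∀ s t : ℝ≥0, s ≤ t →
    HasLaw (fun ω => N t ω - N s ω) (poissonMeasure (r * (t - s))) P

/-- The random data of the construction. `N x`, `x = 1, 2, …`, are i.i.d. rate one Poisson
processes; `T none` (the variable `T₀`) and `T (some (x, i))` (the variable `T^{(x)}_{i+1}`,
so that `i = 0` is the first one) are i.i.d. exponential variables of rate one; and the two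
families are independent of each other. -/
structure IsKData {Ω : Type*} [MeasurableSpace Ω] (P : Measure Ω)
    (N : ℕ+ → ℝ≥0 → Ω → ℕ) (T : Option (ℕ+ × ℕ) → Ω → ℝ) : Prop where
  poisson : ∀ x, IsPoissonProcess (N x) 1 P
  indep_poisson : iIndepFun (fun (x : ℕ+) (ω : Ω) (t : ℝ≥0) => N x t ω) P
  measurable_exp : ∀ a, Measurable (T a)
  exp : ∀ a, HasLaw (T a) (expMeasure 1) P
  indep_exp : iIndepFun T P
  indep : IndepFun (fun (ω : Ω) (x : ℕ+) (t : ℝ≥0) => N x t ω)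
    (fun (ω : Ω) (a : Option (ℕ+ × ℕ)) => T a ω) P

section Construction

variable {Ω : Type*}

/-- `γ` extended to the state space by `γ(∞) = 0`. -/
def gammaExt (γ : ℕ+ → ℝ) (y : KState) : ℝ := y.elim 0 γ

/-- The `j`-th event time (`j ≥ 1`) of a counting process, `inf {t : N_t ≥ j}`. -/
def eventTime (N : ℝ≥0 → Ω → ℕ) (j : ℕ) (ω : Ω) : ℝ≥0 := sInf {t : ℝ≥0 | j ≤ N t ω}

/-- The clock
`Γ(t) = γ(y) T₀ + ∑ₓ γ(x) ∑_{i=1}^{N^{(x)}_t} T^{(x)}_i + c t`,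
with values in `[0, ∞]` so that the series always has a sum. -/
def kClock (γ : ℕ+ → ℝ) (c : ℝ≥0) (N : ℕ+ → ℝ≥0 → Ω → ℕ) (T : Option (ℕ+ × ℕ) → Ω → ℝ)
    (y : KState) (ω : Ω) (t : ℝ≥0) : ℝ≥0∞ :=
  ENNReal.ofReal (gammaExt γ y * T none ω)
    + ∑' x : ℕ+, ENNReal.ofReal (γ x)
        * ∑ i ∈ Finset.range (N x t ω), ENNReal.ofReal (T (some (x, i)) ω)
    + (c : ℝ≥0∞) * (t : ℝ≥0∞)

/-- `Γ(σ^{(x)}_j-) ≤ t < Γ(σ^{(x)}_j)` for some `j ≥ 1`. -/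
def SitsAt (γ : ℕ+ → ℝ) (c : ℝ≥0) (N : ℕ+ → ℝ≥0 → Ω → ℕ) (T : Option (ℕ+ × ℕ) → Ω → ℝ)
    (y : KState) (t : ℝ≥0) (ω : Ω) (x : ℕ+) : Prop :=
  ∃ j : ℕ, 1 ≤ j ∧
    Function.leftLim (kClock γ c N T y ω) (eventTime (N x) j ω) ≤ (t : ℝ≥0∞) ∧
    (t : ℝ≥0∞) < kClock γ c N T y ω (eventTime (N x) j ω)

open Classical in
/-- The K-process with parameters `γ` and `c`, started at `y`: at time `t` it is at `y` if
`t < γ(y) T₀`, at `x` if `Γ(σ^{(x)}_j-) ≤ t < Γ(σ^{(x)}_j)` for some `j ≥ 1`, and at `∞`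
otherwise. (Two sites `x` can qualify only on the null event that two of the Poisson processes
jump simultaneously or a clock value is infinite; the least such `x` is taken there.) -/
def kProc (γ : ℕ+ → ℝ) (c : ℝ≥0) (N : ℕ+ → ℝ≥0 → Ω → ℕ) (T : Option (ℕ+ × ℕ) → Ω → ℝ)
    (y : KState) (t : ℝ≥0) (ω : Ω) : KState :=
  if (t : ℝ) < gammaExt γ y * T none ω then y
  else if h : ∃ x : ℕ+, SitsAt γ c N T y t ω x then ((PNat.find h : ℕ+) : KState)
  else OnePoint.infty

end Construction

/-- The σ-algebra generated by a process up to time `s`. -/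
abbrev pastSigma {Ω : Type*} (X : ℝ≥0 → Ω → KState) (s : ℝ≥0) : MeasurableSpace Ω :=
  ⨆ r ∈ Iic s, MeasurableSpace.comap (X r) KState.instMeasurableSpace

/-- `X y`, `y` in the state space, is a time-homogeneous Markov family on `(Ω, P)`: each `X y` is
a measurable process started at `y`, and given its own past up to time `s`, the law of
`X y (s + t)` is `Ψ_t (X y s, ·)`, where `Ψ_t (z, A) = P (X z t ∈ A)`. In particular every
`X y` is a Markov process, with one and the same transition function `Ψ`. (The state space is
countable with measurable points, so `z ↦ Ψ_t (z, A)` is measurable.) -/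
structure IsMarkovFamily {Ω : Type*} [MeasurableSpace Ω] (P : Measure Ω)
    (X : KState → ℝ≥0 → Ω → KState) : Prop where
  measurable : ∀ y t, Measurable (X y t)
  start : ∀ y, ∀ᵐ ω ∂P, X y 0 ω = y
  markov : ∀ (y : KState) (s t : ℝ≥0) (A : Set KState), MeasurableSet A →
    P[(X y (s + t) ⁻¹' A).indicator (fun _ => (1 : ℝ)) | pastSigma (X y) s]
      =ᵐ[P] fun ω => P.real (X (X y s ω) t ⁻¹' A)

end

/-! The process is a deterministic functional of the Poisson paths and the exponential variables, so
both claims come from pathwise facts about the clock combined with independence properties of the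
data.

Càdlàg paths. Almost surely the clock is unbounded, so the process on a bounded time window only
involves the data up to a finite clock index, before which each site has finitely many events.
Hence, for each `x`, the set of times at which `SitsAt` holds is locally a finite union of intervals
`[a, b)`. The state is found from these predicates by a least-element search, and neighbourhoods of
`∞` omit only finitely many sites, so one-sided limits pass from the predicates to the state
(`tendsto_selectState`).

Markov property. Fix `s` and distinguish the situation at time `s`: the initial sojourn, the state
`∞`, or the sojourn opened by a given event `p` (countably many cases, almost surely disjoint since
jumps are simple). In each case there are a clock index `τ` and a variable `R` for which the clock
at `τ` equals `s + γ(z) R`, where `z` is the present state. After time `s` the process is then built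
by the same recipe from `R` and the data not used up to `τ` (`CountingPaths.kProc_shift`). In the
initial sojourn `τ = 0` and `R = T₀ - s / γ(y)`. At `∞`, `τ` is the index at which the clock passes
`s`; it takes the value `s` there, since an overshoot would be a sojourn, and `R` is immaterial
because `γ(∞) = 0`. In the sojourn of `p`, `τ` is the event time and `R` is the residual life of `T
(some p)`.

It remains to see that, on any event of the past of the process, `R` is exponential and independent
of the future data, and that these have the law of the original data. For the future data this is a
strong Markov property (`IsKData.measure_inter_futureData`), derived from fixed indices by
approximation from above. For `R` it is the absence of memory of the exponential law: to free the
past from `T (some p)`, this variable is replaced by a large constant, which on the sojourn changes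
neither the path up to `s` nor the data after `τ`. Laws are compared through a canonical measurable
version of the process (`IsKData.measure_inter_of_restart`). -/

noncomputable section

/-- All paths at `ω` are nondecreasing and right-continuous. -/
structure CountingPaths {Ω : Type*} (N : ℕ+ → ℝ≥0 → Ω → ℕ) (ω : Ω) : Prop where
  mono : ∀ x, Monotone (fun t => N x t ω)
  rightCont : ∀ x t, ContinuousWithinAt (fun t => N x t ω) (Ici t) t

/-! ### The clock, event times and sojourns -/

section Paths

variable {Ω Ω' : Type*} {γ : ℕ+ → ℝ} {c : ℝ≥0} {N : ℕ+ → ℝ≥0 → Ω → ℕ}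
  {T : Option (ℕ+ × ℕ) → Ω → ℝ} {N' : ℕ+ → ℝ≥0 → Ω' → ℕ}
  {T' : Option (ℕ+ × ℕ) → Ω' → ℝ} {y z : KState} {ω : Ω} {ω' : Ω'}

/-- The contribution of the site `x` to the clock. -/
def siteClock (γ : ℕ+ → ℝ) (N : ℕ+ → ℝ≥0 → Ω → ℕ) (T : Option (ℕ+ × ℕ) → Ω → ℝ)
    (x : ℕ+) (ω : Ω) (t : ℝ≥0) : ℝ≥0∞ :=
  ENNReal.ofReal (γ x) * ∑ i ∈ Finset.range (N x t ω), ENNReal.ofReal (T (some (x, i)) ω)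

lemma kClock_eq (t : ℝ≥0) : kClock γ c N T y ω t =
    ENNReal.ofReal (gammaExt γ y * T none ω) + ∑' x, siteClock γ N T x ω t + (c : ℝ≥0∞) * t := rfl

lemma siteClock_le_of_le (x : ℕ+) {s t : ℝ≥0} (h : N x s ω ≤ N x t ω) :
    siteClock γ N T x ω s ≤ siteClock γ N T x ω t := by
  unfold siteClock
  gcongr

lemma kClock_mono (hN : ∀ x, Monotone (fun t => N x t ω)) : Monotone (kClock γ c N T y ω) := by
  intro s t hst
  simp only [kClock_eq]
  gcongr with x
  exact siteClock_le_of_le x (hN x hst)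

lemma ofReal_le_kClock (t : ℝ≥0) :
    ENNReal.ofReal (gammaExt γ y * T none ω) ≤ kClock γ c N T y ω t := by
  rw [kClock_eq, add_assoc]
  exact le_self_add

lemma siteClock_le_kClock (x : ℕ+) (t : ℝ≥0) :
    siteClock γ N T x ω t ≤ kClock γ c N T y ω t := by
  rw [kClock_eq]
  exact (ENNReal.le_tsum x).trans (le_add_self.trans le_self_add)

lemma coe_lt_ofReal_iff {s : ℝ≥0} {r : ℝ} : (s : ℝ≥0∞) < ENNReal.ofReal r ↔ (s : ℝ) < r := by
  rw [← ENNReal.ofReal_coe_nnreal, ENNReal.ofReal_lt_ofReal_iff']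
  exact ⟨fun h => h.1, fun h => ⟨h, s.2.trans_lt h⟩⟩

/-- The left limit of a monotone function is the supremum of its earlier values. Positivity of `u`
matters: at `0` there are no earlier values and the left limit is `f 0` by convention. -/
lemma leftLim_le_iff {f : ℝ≥0 → ℝ≥0∞} (hf : Monotone f) {u : ℝ≥0} (hu : 0 < u) {a : ℝ≥0∞} :
    Function.leftLim f u ≤ a ↔ ∀ v < u, f v ≤ a := by
  have : (𝓝[<] u).NeBot := nhdsLT_neBot_of_exists_lt ⟨0, hu⟩
  rw [hf.leftLim_eq_sSup, sSup_le_iff]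
  simp

lemma leftLim_zero (f : ℝ≥0 → ℝ≥0∞) : Function.leftLim f 0 = f 0 :=
  leftLim_eq_of_isBot fun _ => zero_le

lemma eventTime_le {n : ℝ≥0 → Ω → ℕ} {j : ℕ} {t : ℝ≥0} (h : j ≤ n t ω) :
    eventTime n j ω ≤ t := csInf_le (OrderBot.bddBelow _) h

lemma exists_eq_on_Ico {n : ℝ≥0 → ℕ} {t : ℝ≥0} (h : ContinuousWithinAt n (Ici t) t) :
    ∃ u, t < u ∧ ∀ v ∈ Ico t u, n v = n t := by
  have h1 : ∀ᶠ v in 𝓝[≥] t, n v = n t := by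
    have := h.eventually (f := n) (p := fun k => k = n t) (by simp)
    exact this
  obtain ⟨u, hu, hs⟩ := mem_nhdsGE_iff_exists_Ico_subset.1 h1
  exact ⟨u, hu, fun v hv => hs hv⟩

/-- An integer-valued right-continuous path is constant just after the infimum, so the level reached
arbitrarily soon after it is already reached at it. -/
lemma le_apply_eventTime {n : ℝ≥0 → Ω → ℕ}
    (hr : ∀ t, ContinuousWithinAt (fun t => n t ω) (Ici t) t) {j : ℕ} (hj : ∃ t, j ≤ n t ω) :
    j ≤ n (eventTime n j ω) ω := by
  obtain ⟨u, hu, hs⟩ := exists_eq_on_Ico (hr (eventTime n j ω))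
  obtain ⟨t, ht, htu⟩ := exists_lt_of_csInf_lt (s := {t : ℝ≥0 | j ≤ n t ω}) hj hu
  exact (show j ≤ n t ω from ht).trans_eq (hs t ⟨csInf_le (OrderBot.bddBelow _) ht, htu⟩)

lemma lt_of_lt_eventTime {n : ℝ≥0 → Ω → ℕ} {j : ℕ} {t : ℝ≥0} (h : t < eventTime n j ω) :
    n t ω < j := by
  by_contra! h'
  exact (eventTime_le h').not_gt h

/-- A nontrivial sojourn interval comes from a positive, attained event time. -/
lemma CountingPaths.eventTime_pos_and_le (hN : CountingPaths N ω) {x : ℕ+} {j : ℕ} {t : ℝ≥0∞}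
    (h1 : Function.leftLim (kClock γ c N T y ω) (eventTime (N x) j ω) ≤ t)
    (h2 : t < kClock γ c N T y ω (eventTime (N x) j ω)) :
    0 < eventTime (N x) j ω ∧ j ≤ N x (eventTime (N x) j ω) ω := by
  have hpos : 0 < eventTime (N x) j ω := by
    by_contra! h0
    have h0 : eventTime (N x) j ω = 0 := le_antisymm h0 zero_le
    rw [h0] at h1 h2
    rw [leftLim_zero] at h1
    exact (h1.trans_lt h2).false
  refine ⟨hpos, le_apply_eventTime (hN.rightCont x) ?_⟩
  by_contra! h
  -- The infimum of the empty set is `0` in `ℝ≥0`, so an event that never happens would have event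
  -- time `0`.
  have h' : {t : ℝ≥0 | j ≤ N x t ω} = ∅ := by
    ext t; simpa using h t
  simp [eventTime, h'] at hpos

/-- `u` is the time of a jump of the path of `N x` whose sojourn interval contains `t`. -/
def SojournAt (γ : ℕ+ → ℝ) (c : ℝ≥0) (N : ℕ+ → ℝ≥0 → Ω → ℕ) (T : Option (ℕ+ × ℕ) → Ω → ℝ)
    (y : KState) (t : ℝ≥0) (ω : Ω) (x : ℕ+) (u : ℝ≥0) : Prop :=
  0 < u ∧ (∀ v < u, N x v ω < N x u ω) ∧ (∀ v < u, kClock γ c N T y ω v ≤ t) ∧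
    (t : ℝ≥0∞) < kClock γ c N T y ω u

/-- Speaking of the jump time instead of the event number makes the condition easy to transport to
stopped and shifted data. Conversely, the number of an event happening at the jump time `u` is
recovered as `N x u ω`. -/
lemma CountingPaths.sitsAt_iff (hN : CountingPaths N ω) {t : ℝ≥0} {x : ℕ+} :
    SitsAt γ c N T y t ω x ↔ ∃ u, SojournAt γ c N T y t ω x u := by
  have hmono : Monotone (kClock γ c N T y ω) := kClock_mono hN.mono
  constructor
  · rintro ⟨j, -, h1, h2⟩
    obtain ⟨hpos, hle⟩ := hN.eventTime_pos_and_le h1 h2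
    exact ⟨_, hpos, fun v hv => (lt_of_lt_eventTime hv).trans_le hle,
      (leftLim_le_iff hmono hpos).1 h1, h2⟩
  · rintro ⟨u, hu, hj, h1, h2⟩
    have : eventTime (N x) (N x u ω) ω = u := by
      refine le_antisymm (eventTime_le le_rfl) (le_csInf ⟨u, le_refl (N x u ω)⟩ fun v hv => ?_)
      by_contra! hvu
      exact (hj v hvu).not_ge hv
    refine ⟨N x u ω, (Nat.zero_le _).trans_lt (hj 0 hu), ?_, ?_⟩
    · rw [this]; exact (leftLim_le_iff hmono hu).2 h1
    · rwa [this]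

/-- Two instances of the process agree as soon as their ingredients do. -/
lemma kProc_congr {s t : ℝ≥0} (h0 : (s : ℝ) < gammaExt γ y * T none ω ↔
      (t : ℝ) < gammaExt γ z * T' none ω')
    (h0' : (s : ℝ) < gammaExt γ y * T none ω → y = z)
    (h1 : ¬ (s : ℝ) < gammaExt γ y * T none ω →
      ∀ x, SitsAt γ c N T y s ω x ↔ SitsAt γ c N' T' z t ω' x) :
    kProc γ c N T y s ω = kProc γ c N' T' z t ω' := by
  unfold kProc
  by_cases h : (s : ℝ) < gammaExt γ y * T none ω
  · rw [if_pos h, if_pos (h0.1 h), h0' h]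
  · rw [if_neg h, if_neg (fun h' => h (h0.2 h'))]
    have : SitsAt γ c N T y s ω = SitsAt γ c N' T' z t ω' := funext fun x => propext (h1 h x)
    rw [this]

lemma kProc_eq_self {t : ℝ≥0} (h : (t : ℝ) < gammaExt γ y * T none ω) :
    kProc γ c N T y t ω = y := if_pos h

lemma kProc_eq_infty {t : ℝ≥0} (h : kProc γ c N T y t ω = OnePoint.infty) :
    ¬ (t : ℝ) < gammaExt γ y * T none ω ∧ ∀ x, ¬ SitsAt γ c N T y t ω x := by
  unfold kProc at h
  split_ifs at h with h1 h2
  · subst h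
    simp only [gammaExt, OnePoint.elim_infty, zero_mul, NNReal.coe_nonneg,
      not_lt_of_ge] at h1
  · exact absurd h (OnePoint.coe_ne_infty _)
  · exact ⟨h1, not_exists.1 h2⟩

lemma kProc_eq_coe_of_unique {t : ℝ≥0} {x : ℕ+} (h : ¬ (t : ℝ) < gammaExt γ y * T none ω)
    (hx : SitsAt γ c N T y t ω x) (hu : ∀ x', SitsAt γ c N T y t ω x' → x' = x) :
    kProc γ c N T y t ω = x := by
  classical
  unfold kProc
  rw [if_neg h, dif_pos ⟨x, hx⟩]
  congr 1
  exact hu _ (PNat.find_spec (p := SitsAt γ c N T y t ω) ⟨x, hx⟩)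

lemma exists_sitsAt_of_kProc {t : ℝ≥0} {x : ℕ+} (h : kProc γ c N T y t ω = x) :
    ((t : ℝ) < gammaExt γ y * T none ω ∧ y = x) ∨
    (¬ (t : ℝ) < gammaExt γ y * T none ω ∧ SitsAt γ c N T y t ω x) := by
  classical
  unfold kProc at h
  split_ifs at h with h1 h2
  · exact Or.inl ⟨h1, h⟩
  · have := PNat.find_spec h2
    rw [OnePoint.coe_injective h] at this
    exact Or.inr ⟨h1, this⟩
  · exact absurd h.symm (OnePoint.coe_ne_infty _)

/-! ### Stopped data -/

/-- The Poisson paths stopped at time `u`. -/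
def stopN (N : ℕ+ → ℝ≥0 → Ω → ℕ) (u : ℝ≥0) (x : ℕ+) (v : ℝ≥0) (ω : Ω) : ℕ := N x (min v u) ω

/-- Keep `t none`, and `t (some (x, i))` for `i < k x`. -/
def truncT (k : ℕ+ → ℕ) (t : Option (ℕ+ × ℕ) → ℝ) : Option (ℕ+ × ℕ) → ℝ
  | none => t none
  | some p => if p.2 < k p.1 then t (some p) else 0

/-- The exponential variables used by the clock up to time `u`. -/
def stopT (N : ℕ+ → ℝ≥0 → Ω → ℕ) (T : Option (ℕ+ × ℕ) → Ω → ℝ) (u : ℝ≥0)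
    (a : Option (ℕ+ × ℕ)) (ω : Ω) : ℝ := truncT (fun x => N x u ω) (fun a => T a ω) a

lemma stopN_apply {u v : ℝ≥0} (h : v ≤ u) (x : ℕ+) : stopN N u x v ω = N x v ω := by
  simp [stopN, h]

lemma CountingPaths.stopped (hN : CountingPaths N ω) (u : ℝ≥0) : CountingPaths (stopN N u) ω := by
  refine ⟨fun x s t hst => hN.mono x (min_le_min_right u hst), fun x t => ?_⟩
  refine (hN.rightCont x (min t u)).comp (t := Ici (min t u)) (f := fun v => min v u) ?_ ?_
  · fun_prop
  · intro v hv; exact min_le_min_right u hv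

lemma kClock_stop (hN : ∀ x, Monotone (fun t => N x t ω)) {u v : ℝ≥0} (h : v ≤ u) :
    kClock γ c (stopN N u) (stopT N T u) y ω v = kClock γ c N T y ω v := by
  simp only [kClock_eq, siteClock, stopN_apply h]
  congr 4
  ext x
  congr 1
  refine Finset.sum_congr rfl fun i hi => ?_
  have : i < N x u ω := (Finset.mem_range.1 hi).trans_le (hN x h)
  simp [stopT, truncT, this]

/-- A sojourn containing `r` is opened at the first index where the clock exceeds `r`, hence not
after `u`. So the process up to a time below the clock value at `u` only uses the data up to `u`;
this is what ties events of the past of the process to `dataSigma`. -/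
lemma CountingPaths.kProc_stop (hN : CountingPaths N ω) {u r : ℝ≥0}
    (h : (r : ℝ≥0∞) < kClock γ c N T y ω u) :
    kProc γ c (stopN N u) (stopT N T u) y r ω = kProc γ c N T y r ω := by
  refine kProc_congr (by simp [stopT, truncT]) (fun _ => rfl) fun _ x => ?_
  rw [(hN.stopped u).sitsAt_iff, hN.sitsAt_iff]
  constructor
  · rintro ⟨w, hw, hj, h1, h2⟩
    have hwu : w ≤ u := by
      by_contra! hlt
      have := hj u hlt
      simp [stopN, hlt.le] at this
    refine ⟨w, hw, fun v hv => ?_, fun v hv => ?_, ?_⟩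
    · simpa [stopN_apply hwu, stopN_apply (hv.le.trans hwu)] using hj v hv
    · simpa [kClock_stop hN.mono (hv.le.trans hwu)] using h1 v hv
    · rwa [kClock_stop hN.mono hwu] at h2
  · rintro ⟨w, hw, hj, h1, h2⟩
    have hwu : w ≤ u := by
      by_contra! hlt
      exact (h1 u hlt).not_gt h
    refine ⟨w, hw, fun v hv => ?_, fun v hv => ?_, ?_⟩
    · simpa [stopN_apply hwu, stopN_apply (hv.le.trans hwu)] using hj v hv
    · simpa [kClock_stop hN.mono (hv.le.trans hwu)] using h1 v hv
    · rwa [kClock_stop hN.mono hwu]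

/-! ### Shifted data -/

/-- The Poisson paths after the random time `τ`. -/
def shiftN (N : ℕ+ → ℝ≥0 → Ω → ℕ) (τ : Ω → ℝ≥0) (x : ℕ+) (v : ℝ≥0) (ω : Ω) : ℕ :=
  N x (τ ω + v) ω - N x (τ ω) ω

/-- The exponential variables not used up to time `τ`, with a new initial one. -/
def shiftT (N : ℕ+ → ℝ≥0 → Ω → ℕ) (T : Option (ℕ+ × ℕ) → Ω → ℝ) (τ : Ω → ℝ≥0) (R : Ω → ℝ) :
    Option (ℕ+ × ℕ) → Ω → ℝ
  | none, ω => R ω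
  | some p, ω => T (some (p.1, N p.1 (τ ω) ω + p.2)) ω

variable {τ : Ω → ℝ≥0} {R : Ω → ℝ}

lemma CountingPaths.shift (hN : CountingPaths N ω) (τ : Ω → ℝ≥0) :
    CountingPaths (shiftN N τ) ω := by
  refine ⟨fun x s t hst => Nat.sub_le_sub_right (hN.mono x (by gcongr)) _, fun x t => ?_⟩
  have h1 : ContinuousWithinAt (fun v => N x (τ ω + v) ω) (Ici t) t := by
    refine (hN.rightCont x (τ ω + t)).comp (t := Ici (τ ω + t)) (f := fun v => τ ω + v) ?_ ?_
    · fun_prop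
    · intro v hv; exact add_le_add_right (mem_Ici.1 hv) (τ ω)
  exact (continuous_of_discreteTopology (f := fun n : ℕ => n - N x (τ ω) ω)).continuousAt.comp_continuousWithinAt h1

lemma siteClock_add (hN : ∀ x, Monotone (fun t => N x t ω)) (x : ℕ+) (v : ℝ≥0) :
    siteClock γ N T x ω (τ ω + v) =
      siteClock γ N T x ω (τ ω) + siteClock γ (shiftN N τ) (shiftT N T τ R) x ω v := by
  have h : N x (τ ω + v) ω = N x (τ ω) ω + shiftN N τ x v ω := by
    have : N x (τ ω) ω ≤ N x (τ ω + v) ω := hN x (by simp)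
    simp only [shiftN]; omega
  simp only [siteClock, h, Finset.sum_range_add, mul_add, shiftT]

/-- The residual `γ(z) R` that the clock shows at `τ` beyond `s` is exactly the initial term of the
restarted clock, and the rest of both sides are increments after `τ`. -/
lemma kClock_shift (hN : ∀ x, Monotone (fun t => N x t ω)) {s : ℝ≥0}
    (hs : kClock γ c N T y ω (τ ω) = s + ENNReal.ofReal (gammaExt γ z * R ω)) (v : ℝ≥0) :
    kClock γ c N T y ω (τ ω + v) =
      s + kClock γ c (shiftN N τ) (shiftT N T τ R) z ω v := by
  have : kClock γ c N T y ω (τ ω + v) = kClock γ c N T y ω (τ ω) +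
      (∑' x, siteClock γ (shiftN N τ) (shiftT N T τ R) x ω v + c * v) := by
    simp only [kClock_eq]
    rw [tsum_congr (fun x => siteClock_add (R := R) hN x v), ENNReal.tsum_add]
    push_cast
    ring
  rw [this, hs, kClock_eq (y := z)]
  simp only [shiftT]
  ring

/-- Once the residual sojourn is over, the clock at `τ` has not passed `s + t`. A sojourn containing
`s + t` is therefore opened strictly after `τ`, where the two clocks differ by the constant `s` and
the jumps are the same. -/
lemma CountingPaths.kProc_shift (hN : CountingPaths N ω) {s t : ℝ≥0}
    (hs : kClock γ c N T y ω (τ ω) = s + ENNReal.ofReal (gammaExt γ z * R ω))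
    (ht : ¬ (t : ℝ) < gammaExt γ z * R ω) :
    kProc γ c N T y (s + t) ω = kProc γ c (shiftN N τ) (shiftT N T τ R) z t ω := by
  have hτ : kClock γ c N T y ω (τ ω) ≤ (s + t : ℝ≥0) := by
    rw [hs, ENNReal.coe_add]
    gcongr
    rw [← coe_lt_ofReal_iff, not_lt] at ht
    exact ht
  have h0 : ¬ ((s + t : ℝ≥0) : ℝ) < gammaExt γ y * T none ω := by
    rw [← coe_lt_ofReal_iff, not_lt]
    exact (ofReal_le_kClock _).trans hτ
  refine kProc_congr ⟨fun h => absurd h h0, fun h => absurd h ht⟩ (fun h => absurd h h0)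
    fun _ x => ?_
  have hle : ∀ v (t : ℝ≥0), kClock γ c N T y ω (τ ω + v) ≤ (s + t : ℝ≥0) ↔
      kClock γ c (shiftN N τ) (shiftT N T τ R) z ω v ≤ t := by
    intro v t
    rw [kClock_shift hN.mono hs, ENNReal.coe_add]
    exact ENNReal.add_le_add_iff_left ENNReal.coe_ne_top
  have hjump : ∀ v w, N x (τ ω + v) ω < N x (τ ω + w) ω ↔
      shiftN N τ x v ω < shiftN N τ x w ω := by
    intro v w
    have h1 : N x (τ ω) ω ≤ N x (τ ω + v) ω := hN.mono x (by simp)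
    have h2 : N x (τ ω) ω ≤ N x (τ ω + w) ω := hN.mono x (by simp)
    simp only [shiftN]; omega
  rw [hN.sitsAt_iff, (hN.shift τ).sitsAt_iff]
  constructor
  · rintro ⟨u, hu, hj, h1, h2⟩
    have hlt : τ ω < u := by
      by_contra! hle'
      exact ((kClock_mono hN.mono hle').trans hτ).not_gt h2
    obtain ⟨w, rfl⟩ := exists_add_of_le hlt.le
    refine ⟨w, by simpa using hlt, fun v hv => (hjump v w).1 (hj _ (by gcongr)),
      fun v hv => (hle v t).1 (h1 _ (by gcongr)), ?_⟩
    rw [← not_le, ← hle]; exact not_le.2 h2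
  · rintro ⟨w, hw, hj, h1, h2⟩
    have key : ∀ v < τ ω + w, τ ω ≤ v → ∃ v', v = τ ω + v' ∧ v' < w := by
      intro v hv hle'
      obtain ⟨v', rfl⟩ := exists_add_of_le hle'
      exact ⟨v', rfl, by simpa using hv⟩
    refine ⟨τ ω + w, by positivity, fun v hv => ?_, fun v hv => ?_, ?_⟩
    · rcases le_total (τ ω) v with h | h
      · obtain ⟨v', rfl, hv'⟩ := key v hv h
        exact (hjump v' w).2 (hj v' hv')
      · refine (hN.mono x h).trans_lt ?_
        simpa using (hjump 0 w).2 (hj 0 hw)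
    · rcases le_total (τ ω) v with h | h
      · obtain ⟨v', rfl, hv'⟩ := key v hv h
        exact (hle v' t).2 (h1 v' hv')
      · exact (kClock_mono hN.mono h).trans hτ
    · rw [← not_le, hle]; exact not_le.2 h2

end Paths

/-! ### One-sided continuity of the clock -/

section PathContinuity

variable {Ω : Type*} {γ : ℕ+ → ℝ} {c : ℝ≥0} {N : ℕ+ → ℝ≥0 → Ω → ℕ}
  {T : Option (ℕ+ × ℕ) → Ω → ℝ} {y : KState} {ω : Ω}

/-- At a time where no site contribution jumps, the clock is left-continuous. -/
lemma kClock_le_of_no_jump (hN : ∀ x, Monotone (fun t => N x t ω)) {u : ℝ≥0} (hu : 0 < u)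
    (hz : ∀ x, ∃ v < u, siteClock γ N T x ω u ≤ siteClock γ N T x ω v) {a : ℝ≥0∞}
    (h : ∀ v < u, kClock γ c N T y ω v ≤ a) : kClock γ c N T y ω u ≤ a := by
  choose v hv hzv using hz
  -- It suffices to bound the finite partial sums: for finitely many sites one time before `u`
  -- serves them all, and only the continuous drift still varies from there to `u`.
  rw [kClock_eq, ENNReal.tsum_eq_iSup_sum, ENNReal.add_iSup, ENNReal.iSup_add]
  refine iSup_le fun J => ?_
  have hw0 : J.sup v < u := (Finset.sup_lt_iff (by simpa using hu)).2 fun x _ => hv x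
  have : (𝓝[<] u).NeBot := nhdsLT_neBot_of_exists_lt ⟨0, hu⟩
  have hlim : Tendsto (fun w : ℝ≥0 => ENNReal.ofReal (gammaExt γ y * T none ω)
      + ∑ x ∈ J, siteClock γ N T x ω u + (c : ℝ≥0∞) * (w : ℝ≥0∞)) (𝓝[<] u)
      (𝓝 (ENNReal.ofReal (gammaExt γ y * T none ω)
      + ∑ x ∈ J, siteClock γ N T x ω u + (c : ℝ≥0∞) * (u : ℝ≥0∞))) := by
    refine Tendsto.mono_left ?_ nhdsWithin_le_nhds
    refine tendsto_const_nhds.add ?_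
    simp_rw [← ENNReal.coe_mul]
    exact ENNReal.tendsto_coe.2 ((continuous_const_mul c).tendsto u)
  refine le_of_tendsto hlim ?_
  filter_upwards [Ioo_mem_nhdsLT hw0] with w hw
  refine le_trans ?_ (h w hw.2)
  rw [kClock_eq]
  gcongr
  refine le_trans (Finset.sum_le_sum fun x hx => ?_) (ENNReal.sum_le_tsum J)
  exact (hzv x).trans (siteClock_le_of_le x (hN x ((Finset.le_sup hx).trans hw.1.le)))

/-- Right-continuity of a finite clock. -/
lemma CountingPaths.le_kClock_of_forall_gt (hN : CountingPaths N ω) {u : ℝ≥0}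
    (hfin : kClock γ c N T y ω (u + 1) ≠ ∞) {a : ℝ≥0∞}
    (h : ∀ v, u < v → a ≤ kClock γ c N T y ω v) : a ≤ kClock γ c N T y ω u := by
  have hlim : Tendsto (fun v => kClock γ c N T y ω v) (𝓝[>] u) (𝓝 (kClock γ c N T y ω u)) := by
    simp only [kClock_eq]
    refine (tendsto_const_nhds.add ?_).add ?_
    -- Dominated convergence for the counting measure on the sites: each contribution is constant
    -- just after `u`, and all are dominated by those at `u + 1`, which are summable as the clock is
    -- finite there.
    · let _ : MeasurableSpace ℕ+ := ⊤
      have : DiscreteMeasurableSpace ℕ+ := ⟨fun _ => trivial⟩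
      have hc : ∀ v, ∑' x, siteClock γ N T x ω v = ∫⁻ x, siteClock γ N T x ω v ∂Measure.count :=
        fun v => (lintegral_count _).symm
      simp_rw [hc]
      refine tendsto_lintegral_filter_of_dominated_convergence
        (fun x => siteClock γ N T x ω (u + 1)) ?_ ?_ ?_ ?_
      · exact Eventually.of_forall fun v => measurable_of_countable _
      · filter_upwards [Ioo_mem_nhdsGT (show u < u + 1 by simp)] with v hv
        exact Eventually.of_forall fun x => siteClock_le_of_le x (hN.mono x hv.2.le)
      · rw [lintegral_count]
        intro h'
        simp [kClock_eq, h'] at hfin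
      · refine Eventually.of_forall fun x => ?_
        obtain ⟨w, hw, hs⟩ := exists_eq_on_Ico (hN.rightCont x u)
        refine tendsto_const_nhds.congr' ?_
        filter_upwards [Ioo_mem_nhdsGT hw] with v hv
        simp only [siteClock]
        rw [hs v ⟨hv.1.le, hv.2⟩]
    · simp_rw [← ENNReal.coe_mul]
      exact (ENNReal.tendsto_coe.2 ((continuous_const_mul c).tendsto u)).mono_left
        nhdsWithin_le_nhds
  refine ge_of_tendsto hlim ?_
  filter_upwards [self_mem_nhdsWithin] with v hv using h v hv

/-- If the process is at `∞` at time `s`, the clock takes the value `s` when it passes it. -/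
lemma CountingPaths.kClock_sInf_of_infty (hN : CountingPaths N ω) {s : ℝ≥0}
    (h0 : ∀ x, N x 0 ω = 0) (hs : kProc γ c N T y s ω = OnePoint.infty) (hfin : ∀ u, kClock γ c N T y ω u ≠ ∞)
    (hne : ∃ u, (s : ℝ≥0∞) < kClock γ c N T y ω u) :
    kClock γ c N T y ω (sInf {u | (s : ℝ≥0∞) < kClock γ c N T y ω u}) = s := by
  set τ := sInf {u | (s : ℝ≥0∞) < kClock γ c N T y ω u} with hτ
  obtain ⟨hs0, hx⟩ := kProc_eq_infty hs
  have hlt : ∀ v < τ, kClock γ c N T y ω v ≤ s := by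
    intro v hv
    by_contra! h
    have hmem : v ∈ {u | (s : ℝ≥0∞) < kClock γ c N T y ω u} := h
    exact (csInf_le (OrderBot.bddBelow _) hmem).not_gt hv
  refine le_antisymm ?_ (hN.le_kClock_of_forall_gt (hfin _) fun v hv => ?_)
  · rcases (zero_le (a := τ)).eq_or_lt with h | hpos
    · rw [← coe_lt_ofReal_iff, not_lt] at hs0
      simpa [← h, kClock_eq, siteClock, h0] using hs0
    -- If the clock overshot `s` at `τ > 0`, then either some site contributes a jump, which opens a
    -- sojourn containing `s`, or none does and the clock is left-continuous at `τ`; both are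
    -- impossible.
    · by_contra! hcon
      refine hcon.not_ge (kClock_le_of_no_jump hN.mono hpos (fun x => ?_) hlt)
      by_contra! hj
      refine hx x (hN.sitsAt_iff.2 ⟨τ, hpos, fun v hv => ?_, hlt, hcon⟩)
      by_contra! hle
      exact (hj v hv).not_ge (siteClock_le_of_le x hle)
  · obtain ⟨w, hw, hwv⟩ := exists_lt_of_csInf_lt hne hv
    have hw : (s : ℝ≥0∞) < kClock γ c N T y ω w := hw
    exact hw.le.trans (kClock_mono hN.mono hwv.le)

/-! ### Simple jumps -/

/-- At `ω`, each path jumps by one unit at a time, and no two paths jump simultaneously. -/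
structure SimpleJumps {Ω : Type*} (N : ℕ+ → ℝ≥0 → Ω → ℕ) (ω : Ω) : Prop where
  unit : ∀ x u, 0 < u → ∃ v < u, N x u ω ≤ N x v ω + 1
  disjoint : ∀ x x', x ≠ x' → ∀ u, 0 < u → ∃ v < u, N x v ω = N x u ω ∨ N x' v ω = N x' u ω

/-- The opening index is determined by `t` alone: it is the first one at which the clock exceeds
`t`. -/
lemma SojournAt.time_eq {t : ℝ≥0} {x x' : ℕ+} {u u' : ℝ≥0}
    (h : SojournAt γ c N T y t ω x u) (h' : SojournAt γ c N T y t ω x' u') : u = u' := by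
  rcases lt_trichotomy u u' with hlt | heq | hlt
  · exact absurd h.2.2.2 (h'.2.2.1 u hlt).not_gt
  · exact heq
  · exact absurd h'.2.2.2 (h.2.2.1 u' hlt).not_gt

lemma SojournAt.site_eq (hS : SimpleJumps N ω) {t : ℝ≥0} {x x' : ℕ+}
    {u u' : ℝ≥0} (h : SojournAt γ c N T y t ω x u) (h' : SojournAt γ c N T y t ω x' u') :
    x = x' := by
  obtain rfl := h.time_eq h'
  by_contra hne
  obtain ⟨v, hv, hv'⟩ := hS.disjoint x x' hne u h.1
  rcases hv' with hv' | hv'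
  · exact (h.2.1 v hv).ne hv'
  · exact (h'.2.1 v hv).ne hv'

/-- The time `s` lies in the sojourn interval at `x` opened by the event number `i + 1`. -/
def InSojourn (γ : ℕ+ → ℝ) (c : ℝ≥0) (N : ℕ+ → ℝ≥0 → Ω → ℕ) (T : Option (ℕ+ × ℕ) → Ω → ℝ)
    (y : KState) (s : ℝ≥0) (ω : Ω) (p : ℕ+ × ℕ) : Prop :=
  Function.leftLim (kClock γ c N T y ω) (eventTime (N p.1) (p.2 + 1) ω) ≤ s ∧
    (s : ℝ≥0∞) < kClock γ c N T y ω (eventTime (N p.1) (p.2 + 1) ω)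

lemma sitsAt_iff_inSojourn {s : ℝ≥0} {x : ℕ+} :
    SitsAt γ c N T y s ω x ↔ ∃ i, InSojourn γ c N T y s ω (x, i) := by
  constructor
  · rintro ⟨j, hj, h⟩
    obtain ⟨i, rfl⟩ := Nat.exists_eq_add_of_le' hj
    exact ⟨i, h⟩
  · rintro ⟨i, h⟩
    exact ⟨i + 1, by simp, h⟩

lemma InSojourn.sojournAt (hN : CountingPaths N ω) {s : ℝ≥0} {p : ℕ+ × ℕ}
    (h : InSojourn γ c N T y s ω p) :
    SojournAt γ c N T y s ω p.1 (eventTime (N p.1) (p.2 + 1) ω) := by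
  obtain ⟨hpos, hle⟩ := hN.eventTime_pos_and_le h.1 h.2
  exact ⟨hpos, fun v hv => (lt_of_lt_eventTime hv).trans_le hle,
    (leftLim_le_iff (kClock_mono hN.mono) hpos).1 h.1, h.2⟩

lemma apply_eventTime (hS : SimpleJumps N ω) {x : ℕ+} {i : ℕ}
    (hpos : 0 < eventTime (N x) (i + 1) ω) (hle : i + 1 ≤ N x (eventTime (N x) (i + 1) ω) ω) :
    N x (eventTime (N x) (i + 1) ω) ω = i + 1 := by
  obtain ⟨v, hv, h⟩ := hS.unit x _ hpos
  have := lt_of_lt_eventTime hv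
  omega

lemma InSojourn.apply_eventTime (hN : CountingPaths N ω) (hS : SimpleJumps N ω) {s : ℝ≥0}
    {p : ℕ+ × ℕ} (h : InSojourn γ c N T y s ω p) :
    N p.1 (eventTime (N p.1) (p.2 + 1) ω) ω = p.2 + 1 := by
  obtain ⟨hpos, hle⟩ := hN.eventTime_pos_and_le h.1 h.2
  exact _root_.apply_eventTime hS hpos hle

/-- Both sojourns open at the same index, so simple jumps force the same site; as jumps are of unit
size, the event number is then the value of the path at that index. -/
lemma InSojourn.unique (hN : CountingPaths N ω) (hS : SimpleJumps N ω) {s : ℝ≥0}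
    {p q : ℕ+ × ℕ} (hp : InSojourn γ c N T y s ω p) (hq : InSojourn γ c N T y s ω q) : p = q := by
  have h1 := (hp.sojournAt hN).site_eq hS (hq.sojournAt hN)
  have h2 := (hp.sojournAt hN).time_eq (hq.sojournAt hN)
  have h3 := hp.apply_eventTime hN hS
  have h4 := hq.apply_eventTime hN hS
  rw [h2, h1] at h3
  exact Prod.ext h1 (by omega)

lemma InSojourn.not_lt_initial (hN : CountingPaths N ω) {s : ℝ≥0} {p : ℕ+ × ℕ}
    (h : InSojourn γ c N T y s ω p) : ¬ (s : ℝ) < gammaExt γ y * T none ω := by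
  rw [← coe_lt_ofReal_iff, not_lt]
  have hS := h.sojournAt hN
  exact (ofReal_le_kClock 0).trans (hS.2.2.1 0 hS.1)

lemma InSojourn.kProc_eq (hN : CountingPaths N ω) (hS : SimpleJumps N ω) {s : ℝ≥0}
    {p : ℕ+ × ℕ} (h : InSojourn γ c N T y s ω p) : kProc γ c N T y s ω = p.1 := by
  refine kProc_eq_coe_of_unique (h.not_lt_initial hN) (sitsAt_iff_inSojourn.2 ⟨p.2, h⟩) ?_
  intro x' hx'
  obtain ⟨i, hi⟩ := sitsAt_iff_inSojourn.1 hx'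
  exact congrArg Prod.fst (hi.unique hN hS h)

/-! ### Replacing one exponential variable -/

/-- The family `T` with the variable of index `p` replaced by the constant `K`. -/
def replaceT (T : Option (ℕ+ × ℕ) → Ω → ℝ) (p : ℕ+ × ℕ) (K : ℝ) (a : Option (ℕ+ × ℕ)) (ω : Ω) : ℝ :=
  if a = some p then K else T a ω

variable {p : ℕ+ × ℕ} {K : ℝ}

lemma apply_le_of_lt_eventTime {u : ℝ≥0} (hu : u < eventTime (N p.1) (p.2 + 1) ω) :
    N p.1 u ω ≤ p.2 := Nat.lt_succ_iff.1 (lt_of_lt_eventTime hu)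

/-- Before its event the path is at most `p.2`, so the clock only sums variables of that site with
smaller index. -/
lemma kClock_replaceT {u : ℝ≥0} (hu : u < eventTime (N p.1) (p.2 + 1) ω) :
    kClock γ c N (replaceT T p K) y ω u = kClock γ c N T y ω u := by
  simp only [kClock_eq, siteClock]
  congr 2
  refine tsum_congr fun x => ?_
  · congr 1
    refine Finset.sum_congr rfl fun i hi => ?_
    have : some (x, i) ≠ some p := by
      rintro h
      obtain rfl := Option.some_injective _ h
      have := apply_le_of_lt_eventTime hu
      simp only [Finset.mem_range] at hi this
      omega
    simp [replaceT, this]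

lemma siteClock_replaceT_of_ne {x : ℕ+} (hx : x ≠ p.1) (u : ℝ≥0) :
    siteClock γ N (replaceT T p K) x ω u = siteClock γ N T x ω u := by
  unfold siteClock replaceT
  congr 1
  refine Finset.sum_congr rfl fun i _ => ?_
  rw [if_neg]
  rintro h
  obtain rfl := Option.some_injective _ h
  exact hx rfl

/-- The jump of the clock at an event time, in terms of a clock that does not involve the
exponential variable of that event. -/
lemma kClock_eventTime (hN : CountingPaths N ω) (hS : SimpleJumps N ω)
    (hpos : 0 < eventTime (N p.1) (p.2 + 1) ω)
    (hle : p.2 + 1 ≤ N p.1 (eventTime (N p.1) (p.2 + 1) ω) ω) :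
    kClock γ c N T y ω (eventTime (N p.1) (p.2 + 1) ω) =
      Function.leftLim (kClock γ c N (replaceT T p K) y ω) (eventTime (N p.1) (p.2 + 1) ω) +
        ENNReal.ofReal (γ p.1) * ENNReal.ofReal (T (some p) ω) := by
  set σ := eventTime (N p.1) (p.2 + 1) ω with hσ
  have hval : N p.1 σ ω = p.2 + 1 := apply_eventTime hS hpos hle
  have hsite : ∀ T : Option (ℕ+ × ℕ) → Ω → ℝ, siteClock γ N T p.1 ω σ =
      ENNReal.ofReal (γ p.1) * ∑ i ∈ Finset.range p.2, ENNReal.ofReal (T (some (p.1, i)) ω) +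
        ENNReal.ofReal (γ p.1) * ENNReal.ofReal (T (some p) ω) := by
    intro T
    rw [siteClock, hval, Finset.sum_range_succ, mul_add]
  have hrange : ∑ i ∈ Finset.range p.2, ENNReal.ofReal (replaceT T p 0 (some (p.1, i)) ω) =
      ∑ i ∈ Finset.range p.2, ENNReal.ofReal (T (some (p.1, i)) ω) := by
    refine Finset.sum_congr rfl fun i hi => ?_
    rw [replaceT, if_neg]
    intro h
    have := congrArg Prod.snd (Option.some_injective _ h)
    simp only [Finset.mem_range] at hi
    simp at this
    omega
  -- Setting the variable of the event to `0` removes exactly the jump of the clock at `σ`.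
  have h1 : kClock γ c N T y ω σ = kClock γ c N (replaceT T p 0) y ω σ +
      ENNReal.ofReal (γ p.1) * ENNReal.ofReal (T (some p) ω) := by
    have hs : ∀ x, siteClock γ N T x ω σ = siteClock γ N (replaceT T p 0) x ω σ +
        if x = p.1 then ENNReal.ofReal (γ p.1) * ENNReal.ofReal (T (some p) ω) else 0 := by
      intro x
      split_ifs with h
      · subst h
        rw [hsite, hsite, hrange]
        simp [replaceT]
      · rw [siteClock_replaceT_of_ne h, add_zero]
    rw [kClock_eq, kClock_eq, tsum_congr hs, ENNReal.tsum_add, tsum_ite_eq]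
    simp only [replaceT, reduceCtorEq, if_false]
    ring
  -- With the value `0` no site contributes a jump at `σ`: at `p.1` the only new term vanishes, and
  -- the other paths do not jump. Before `σ` the replacing value is irrelevant, so the left limits
  -- for `0` and `K` agree.
  have h2 : kClock γ c N (replaceT T p 0) y ω σ =
      Function.leftLim (kClock γ c N (replaceT T p K) y ω) σ := by
    have hiff : ∀ a, kClock γ c N (replaceT T p 0) y ω σ ≤ a ↔
        Function.leftLim (kClock γ c N (replaceT T p K) y ω) σ ≤ a := by
      intro a
      rw [leftLim_le_iff (kClock_mono hN.mono) hpos]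
      have hrep : ∀ v < σ, kClock γ c N (replaceT T p K) y ω v =
          kClock γ c N (replaceT T p 0) y ω v := fun v hv => by
        rw [kClock_replaceT hv,
          kClock_replaceT hv]
      constructor
      · intro h v hv
        rw [hrep v hv]
        exact (kClock_mono hN.mono hv.le).trans h
      · intro h
        refine kClock_le_of_no_jump hN.mono hpos (fun x => ?_) fun v hv => (hrep v hv) ▸ h v hv
        by_cases hx : x = p.1
        · subst hx
          obtain ⟨v, hv, hv'⟩ := hS.unit p.1 σ hpos
          have hv'' : N p.1 v ω = p.2 := by
            have := apply_le_of_lt_eventTime hv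
            omega
          refine ⟨v, hv, ?_⟩
          rw [hsite, siteClock, hv'']
          simp [replaceT]
        · obtain ⟨v, hv, hv'⟩ := hS.disjoint x p.1 hx σ hpos
          refine ⟨v, hv, ?_⟩
          rcases hv' with hv' | hv'
          · rw [siteClock, siteClock, hv']
          · have := apply_le_of_lt_eventTime hv
            omega
    exact le_antisymm ((hiff _).2 le_rfl) ((hiff _).1 le_rfl)
  rw [h1, h2]

/-- The past of the process on a sojourn does not depend on the length of this sojourn. -/
lemma InSojourn.kProc_replaceT (hN : CountingPaths N ω) {s r : ℝ≥0}
    (h : InSojourn γ c N T y s ω p)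
    (hK : (s : ℝ≥0∞) < ENNReal.ofReal (γ p.1) * ENNReal.ofReal K) (hr : r ≤ s) :
    kProc γ c N (replaceT T p K) y r ω = kProc γ c N T y r ω := by
  obtain ⟨hpos, hle⟩ := hN.eventTime_pos_and_le h.1 h.2
  obtain ⟨-, hj, h1, h2⟩ := h.sojournAt hN
  set σ := eventTime (N p.1) (p.2 + 1) ω with hσ
  have hrs : (r : ℝ≥0∞) ≤ s := by exact_mod_cast hr
  have hlt : ∀ v < σ, kClock γ c N (replaceT T p K) y ω v = kClock γ c N T y ω v :=
    fun v hv => kClock_replaceT hv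
  -- By `hK` the replacing value alone pushes the clock beyond `s` at `σ`, so both clocks exceed `r`
  -- there.
  have hbig : (r : ℝ≥0∞) < kClock γ c N (replaceT T p K) y ω σ := by
    refine (hrs.trans_lt hK).trans_le (le_trans ?_ (siteClock_le_kClock p.1 σ))
    rw [siteClock]
    gcongr
    have : ENNReal.ofReal K = ENNReal.ofReal (replaceT T p K (some (p.1, p.2)) ω) := by
      simp [replaceT]
    rw [this]
    exact Finset.single_le_sum (f := fun i => ENNReal.ofReal (replaceT T p K (some (p.1, i)) ω))
      (fun _ _ => zero_le) (Finset.mem_range.2 hle)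
  have hbig' : (r : ℝ≥0∞) < kClock γ c N T y ω σ := hrs.trans_lt h2
  refine kProc_congr (by simp [replaceT]) (fun _ => rfl) fun _ x => ?_
  rw [hN.sitsAt_iff, hN.sitsAt_iff]
  have key : ∀ u, SojournAt γ c N (replaceT T p K) y r ω x u ↔ SojournAt γ c N T y r ω x u := by
    intro u
    -- After `σ` neither version can open a sojourn containing `r`; before `σ` the clocks coincide,
    -- and at `σ` only the fact that they exceed `r` matters.
    rcases lt_or_ge σ u with hu | hu
    · constructor
      · rintro ⟨-, -, h, -⟩; exact absurd hbig (h σ hu).not_gt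
      · rintro ⟨-, -, h, -⟩; exact absurd hbig' (h σ hu).not_gt
    · unfold SojournAt
      have e1 : (∀ v < u, kClock γ c N (replaceT T p K) y ω v ≤ r) ↔
          ∀ v < u, kClock γ c N T y ω v ≤ r :=
        forall₂_congr fun v hv => by rw [hlt v (hv.trans_le hu)]
      have e2 : (r : ℝ≥0∞) < kClock γ c N (replaceT T p K) y ω u ↔
          (r : ℝ≥0∞) < kClock γ c N T y ω u := by
        rcases hu.lt_or_eq with hu | rfl
        · rw [hlt u hu]
        · exact ⟨fun _ => hbig', fun _ => hbig⟩
      rw [e1, e2]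
  exact exists_congr key

end PathContinuity

/-! ### Càdlàg paths -/

/-- Near `t`, the predicate is constant on either side of `t`, with its value at `t` on the
right. -/
def LocallySimpleAt (p : ℝ≥0 → Prop) (t : ℝ≥0) : Prop :=
  (∀ᶠ r in 𝓝[≥] t, (p r ↔ p t)) ∧ ∃ b : Prop, ∀ᶠ r in 𝓝[<] t, (p r ↔ b)

namespace LocallySimpleAt

variable {p q : ℝ≥0 → Prop} {t : ℝ≥0}

lemma const (b : Prop) : LocallySimpleAt (fun _ => b) t :=
  ⟨Eventually.of_forall fun _ => Iff.rfl, b, Eventually.of_forall fun _ => Iff.rfl⟩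

lemma not (h : LocallySimpleAt p t) : LocallySimpleAt (fun r => ¬ p r) t :=
  ⟨h.1.mono fun _ hr => not_congr hr, by
    obtain ⟨b, hb⟩ := h.2
    exact ⟨¬ b, hb.mono fun _ hr => not_congr hr⟩⟩

lemma and (hp : LocallySimpleAt p t) (hq : LocallySimpleAt q t) :
    LocallySimpleAt (fun r => p r ∧ q r) t := by
  obtain ⟨b, hb⟩ := hp.2
  obtain ⟨b', hb'⟩ := hq.2
  exact ⟨by filter_upwards [hp.1, hq.1] with r h1 h2 using and_congr h1 h2, b ∧ b', by
    filter_upwards [hb, hb'] with r h1 h2 using and_congr h1 h2⟩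

lemma congr (hp : LocallySimpleAt p t) (h : ∀ᶠ r in 𝓝 t, (q r ↔ p r)) : LocallySimpleAt q t := by
  obtain ⟨b, hb⟩ := hp.2
  refine ⟨?_, b, ?_⟩
  · filter_upwards [hp.1, nhdsWithin_le_nhds h] with r h1 h2
    rw [h2, h1, h.self_of_nhds]
  · filter_upwards [hb, nhdsWithin_le_nhds h] with r h1 h2
    rw [h2, h1]

lemma or (hp : LocallySimpleAt p t) (hq : LocallySimpleAt q t) :
    LocallySimpleAt (fun r => p r ∨ q r) t :=
  (hp.not.and hq.not).not.congr (Eventually.of_forall fun r => by tauto)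

lemma exists_finset {ι : Type*} {p : ι → ℝ≥0 → Prop} (hp : ∀ i, LocallySimpleAt (p i) t)
    (s : Finset ι) : LocallySimpleAt (fun r => ∃ i ∈ s, p i r) t := by
  classical
  induction s using Finset.induction_on with
  | empty => simpa using const False
  | insert a s _ ih => simpa using (hp a).or ih

/-- The truth value changes at most once, from true to false, and it is already false at the time of
the change; this is where the half-open form of the sojourn intervals enters. -/
lemma lt (a : ℝ≥0∞) : LocallySimpleAt (fun r : ℝ≥0 => (r : ℝ≥0∞) < a) t := by
  constructor
  · by_cases h : (t : ℝ≥0∞) < a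
    · have : ∀ᶠ r : ℝ≥0 in 𝓝 t, (r : ℝ≥0∞) < a :=
        (ENNReal.continuous_coe.tendsto t).eventually (Iio_mem_nhds h)
      filter_upwards [nhdsWithin_le_nhds this] with r hr using iff_of_true hr h
    · filter_upwards [self_mem_nhdsWithin] with r hr
      exact iff_of_false (fun h' => h (lt_of_le_of_lt (by exact_mod_cast mem_Ici.1 hr) h')) h
  · by_cases h : ∃ r < t, a ≤ (r : ℝ≥0∞)
    · obtain ⟨r, hr, ha⟩ := h
      refine ⟨False, ?_⟩
      filter_upwards [Ioo_mem_nhdsLT hr] with v hv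
      exact iff_false_intro (not_lt.2 (ha.trans (by exact_mod_cast hv.1.le)))
    · push Not at h
      refine ⟨True, ?_⟩
      filter_upwards [self_mem_nhdsWithin] with v hv using iff_true_intro (h v hv)

end LocallySimpleAt

open Classical in
/-- The state selected by the predicates that enter the definition of the process. -/
def selectState (y : KState) (q : Prop) (p : ℕ+ → Prop) : KState :=
  if q then y else if h : ∃ x, p x then ((PNat.find h : ℕ+) : KState) else OnePoint.infty

/-- Only finitely many sites matter at a time, so no uniformity in `x` is needed. When a site is
selected in the limit, the least-element search inspects finitely many sites; when `∞` is, it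
suffices to avoid each finite set of sites eventually. -/
lemma tendsto_selectState {α : Type*} {F : Filter α} {y : KState} {q : α → Prop}
    {p : ℕ+ → α → Prop} {q' : Prop} {p' : ℕ+ → Prop} (hq : ∀ᶠ r in F, (q r ↔ q'))
    (hp : ∀ x, ∀ᶠ r in F, (p x r ↔ p' x)) :
    Tendsto (fun r => selectState y (q r) (fun x => p x r)) F (𝓝 (selectState y q' p')) := by
  classical
  by_cases h0 : q'
  · refine tendsto_const_nhds.congr' ?_
    filter_upwards [hq] with r hr
    simp only [selectState, if_pos h0, if_pos (hr.2 h0)]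
  by_cases h1 : ∃ x, p' x
  · refine tendsto_const_nhds.congr' ?_
    have hfin : ∀ᶠ r in F, ∀ x ∈ Iic (PNat.find h1), (p x r ↔ p' x) :=
      (eventually_all_finite (finite_Iic _)).2 fun x _ => hp x
    filter_upwards [hq, hfin] with r hr hf
    have hex : ∃ x, p x r := ⟨_, (hf _ ((mem_Iic.2 le_rfl))).2 (PNat.find_spec h1)⟩
    simp only [selectState, if_neg h0, if_neg (fun h => h0 (hr.1 h)), dif_pos h1, dif_pos hex]
    congr 1
    refine le_antisymm ?_ ?_
    · rw [PNat.le_find_iff]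
      intro m hm hpm
      exact (PNat.find_min h1 hm) ((hf m (mem_Iic.2 hm.le)).1 hpm)
    · exact PNat.find_min' hex ((hf _ (mem_Iic.2 le_rfl)).2 (PNat.find_spec h1))
  · have hl : selectState y q' p' = OnePoint.infty := by
      simp only [selectState, if_neg h0, dif_neg h1]
    -- Basic neighbourhoods of `∞` are complements of compact, hence finite, sets of sites.
    rw [hl, OnePoint.hasBasis_nhds_infty.tendsto_right_iff]
    rintro s ⟨-, hs⟩
    have hfin : ∀ᶠ r in F, ∀ x ∈ s, (p x r ↔ p' x) :=
      (eventually_all_finite (isCompact_iff_finite.1 hs)).2 fun x _ => hp x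
    filter_upwards [hq, hfin] with r hr hf
    simp only [selectState, if_neg (fun h => h0 (hr.1 h))]
    split_ifs with h
    · refine Or.inl ⟨_, fun hmem => ?_, rfl⟩
      exact h1 ⟨_, (hf _ hmem).1 (PNat.find_spec h)⟩
    · exact Or.inr rfl

section

variable {Ω : Type*} {γ : ℕ+ → ℝ} {c : ℝ≥0} {N : ℕ+ → ℝ≥0 → Ω → ℕ}
  {T : Option (ℕ+ × ℕ) → Ω → ℝ} {y : KState} {ω : Ω}

lemma kProc_eq_selectState (t : ℝ≥0) : kProc γ c N T y t ω =
    selectState y ((t : ℝ) < gammaExt γ y * T none ω) (SitsAt γ c N T y t ω) := rfl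

/-- Times below `t + 1` lie in sojourns opened at or before an index `U` at which the clock exceeds
`t + 1`. Up to `U` the path of `x` has finitely many jump times, since it takes distinct values at
them, all at most its value at `U`. Near `t` the predicate is thus a finite disjunction of
membership in intervals `[a, b)`. -/
lemma CountingPaths.locallySimpleAt_sitsAt (hN : CountingPaths N ω)
    (hΓ : ∀ M : ℝ≥0, ∃ u, (M : ℝ≥0∞) < kClock γ c N T y ω u) (x : ℕ+) (t : ℝ≥0) :
    LocallySimpleAt (fun r => SitsAt γ c N T y r ω x) t := by
  obtain ⟨U, hU⟩ := hΓ (t + 1)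
  have hfin : {u : ℝ≥0 | u ≤ U ∧ ∀ v < u, N x v ω < N x u ω}.Finite := by
    refine Finite.of_finite_image (f := fun u => N x u ω) ?_ ?_
    · refine (finite_Iic (N x U ω)).subset ?_
      rintro _ ⟨u, hu, rfl⟩
      exact hN.mono x hu.1
    · intro u hu v hv huv
      rcases lt_trichotomy u v with h | h | h
      · exact absurd huv (hv.2 u h).ne
      · exact h
      · exact absurd huv (hu.2 v h).ne'
  have hS := LocallySimpleAt.exists_finset (t := t)
    (p := fun (u : ℝ≥0) r => ¬ (r : ℝ≥0∞) < Function.leftLim (kClock γ c N T y ω) u ∧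
      (r : ℝ≥0∞) < kClock γ c N T y ω u)
    (fun u => (LocallySimpleAt.lt _).not.and (LocallySimpleAt.lt _)) hfin.toFinset
  refine hS.congr ?_
  filter_upwards [Iio_mem_nhds (show t < t + 1 by simp)] with r hr
  have hr' : (r : ℝ≥0∞) < kClock γ c N T y ω U :=
    lt_trans (by exact_mod_cast mem_Iio.1 hr) hU
  rw [hN.sitsAt_iff]
  simp only [Finite.mem_toFinset, mem_ofPred_eq, not_lt]
  constructor
  · rintro ⟨u, h0, hj, h1, h2⟩
    refine ⟨u, ⟨?_, hj⟩, (leftLim_le_iff (kClock_mono hN.mono) h0).2 h1, h2⟩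
    by_contra! hlt
    exact (h1 U hlt).not_gt hr'
  · rintro ⟨u, ⟨-, hj⟩, h1, h2⟩
    rcases (zero_le (a := u)).eq_or_lt with rfl | h0
    · rw [leftLim_zero] at h1
      exact absurd h2 h1.not_gt
    · exact ⟨u, h0, hj, (leftLim_le_iff (kClock_mono hN.mono) h0).1 h1, h2⟩

lemma CountingPaths.isCadlag_kProc (hN : CountingPaths N ω)
    (hΓ : ∀ M : ℝ≥0, ∃ u, (M : ℝ≥0∞) < kClock γ c N T y ω u) :
    IsCadlag (fun t => kProc γ c N T y t ω) := by
  intro t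
  have h0 : LocallySimpleAt (fun r : ℝ≥0 => (r : ℝ) < gammaExt γ y * T none ω) t := by
    simpa only [coe_lt_ofReal_iff] using
      LocallySimpleAt.lt (t := t) (ENNReal.ofReal (gammaExt γ y * T none ω))
  have hx := fun x => hN.locallySimpleAt_sitsAt hΓ x t
  constructor
  · exact tendsto_selectState h0.1 fun x => (hx x).1
  · obtain ⟨b, hb⟩ := h0.2
    choose b' hb' using fun x => (hx x).2
    exact ⟨_, tendsto_selectState hb hb'⟩

end

/-! ### Measurability -/

section Measurability

variable {Ω : Type*} [mΩ : MeasurableSpace Ω] {γ : ℕ+ → ℝ} {c : ℝ≥0} {N : ℕ+ → ℝ≥0 → Ω → ℕ}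
  {T : Option (ℕ+ × ℕ) → Ω → ℝ} {y : KState}

lemma exists_le_iff_exists_nat {n : ℝ≥0 → ℕ} (hn : Monotone n) {j : ℕ} :
    (∃ t, j ≤ n t) ↔ ∃ k : ℕ, j ≤ n k := by
  constructor
  · rintro ⟨t, ht⟩
    obtain ⟨k, hk⟩ := exists_nat_ge t
    exact ⟨k, ht.trans (hn hk)⟩
  · rintro ⟨k, hk⟩
    exact ⟨k, hk⟩

lemma measurable_eventTime (hN : ∀ ω, CountingPaths N ω) (hm : ∀ x t, Measurable (N x t))
    (x : ℕ+) (j : ℕ) : Measurable (eventTime (N x) j) := by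
  refine measurable_of_Iic fun t => ?_
  -- The second set accounts for the paths that never reach `j`, whose event time is `0` by
  -- convention.
  have : eventTime (N x) j ⁻¹' Iic t =
      {ω | j ≤ N x t ω} ∪ {ω | ∀ k : ℕ, ¬ j ≤ N x k ω} := by
    ext ω
    simp only [mem_preimage, mem_Iic, mem_union, mem_ofPred_eq]
    by_cases h : ∃ t, j ≤ N x t ω
    · have h' := (exists_le_iff_exists_nat ((hN ω).mono x)).1 h
      have h1 := le_apply_eventTime ((hN ω).rightCont x) h
      constructor
      · intro hle
        exact Or.inl (h1.trans ((hN ω).mono x hle))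
      · rintro (hle | hle)
        · exact eventTime_le hle
        · exact absurd h' (not_exists.2 hle)
    · have h0 : {t : ℝ≥0 | j ≤ N x t ω} = ∅ := by
        ext t; simpa using not_exists.1 h t
      have h1 : eventTime (N x) j ω = 0 := by
        rw [eventTime, h0]
        exact NNReal.sInf_empty
      rw [h1]
      exact iff_of_true zero_le (Or.inr fun k hk => h ⟨k, hk⟩)
  rw [this]
  refine (measurableSet_le measurable_const (hm x t)).union ?_
  simp only [ofPred_forall]
  exact MeasurableSet.iInter fun k => (measurableSet_le measurable_const (hm x k)).compl

/-- The value at a random time reaches `j` exactly when the event number `j` does occur and its time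
is at most `τ`, so the measurability of event times is enough. -/
lemma measurable_apply_time (hN : ∀ ω, CountingPaths N ω) (hm : ∀ x t, Measurable (N x t))
    {τ : Ω → ℝ≥0} (hτ : Measurable τ) (x : ℕ+) : Measurable (fun ω => N x (τ ω) ω) := by
  refine measurable_of_Ici fun j => ?_
  have : (fun ω => N x (τ ω) ω) ⁻¹' Ici j =
      {ω | eventTime (N x) j ω ≤ τ ω} ∩ {ω | ∃ k : ℕ, j ≤ N x k ω} := by
    ext ω
    simp only [mem_preimage, mem_Ici, mem_inter_iff, mem_ofPred_eq]
    rw [← exists_le_iff_exists_nat ((hN ω).mono x)]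
    exact ⟨fun h => ⟨eventTime_le h, _, h⟩, fun h =>
      (le_apply_eventTime ((hN ω).rightCont x) h.2).trans ((hN ω).mono x h.1)⟩
  rw [this]
  refine (measurableSet_le (measurable_eventTime hN hm x j) hτ).inter ?_
  simp only [ofPred_exists]
  exact MeasurableSet.iUnion fun k => measurableSet_le measurable_const (hm x k)

lemma Measurable.apply_nat {β : Type*} [MeasurableSpace β] {f : ℕ → Ω → β}
    (hf : ∀ n, Measurable (f n)) {k : Ω → ℕ} (hk : Measurable k) :
    Measurable (fun ω => f (k ω) ω) :=
  (measurable_from_prod_countable_right (f := fun p : ℕ × Ω => f p.1 p.2) hf).comp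
    (hk.prodMk measurable_id)

lemma measurable_kClock (hN : ∀ ω, CountingPaths N ω) (hm : ∀ x t, Measurable (N x t))
    (hT : ∀ a, Measurable (T a)) {τ : Ω → ℝ≥0} (hτ : Measurable τ) :
    Measurable (fun ω => kClock γ c N T y ω (τ ω)) := by
  simp only [kClock_eq, siteClock]
  refine (Measurable.add (measurable_const.mul (hT none)).ennreal_ofReal ?_).add
    (measurable_const.mul hτ.coe_nnreal_ennreal)
  refine Measurable.tsum fun x => measurable_const.mul (Measurable.apply_nat
    (f := fun k ω => ∑ i ∈ Finset.range k, ENNReal.ofReal (T (some (x, i)) ω)) (fun k => ?_)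
    (measurable_apply_time hN hm hτ x))
  exact Finset.measurable_sum _ fun i _ => (hT _).ennreal_ofReal

/-- The factors `(n + 1) / (n + 2)` tend to `1` from below. A supremum over a fixed countable set of
factors keeps measurability when `u` is random, and it is also correct at `u = 0`. -/
lemma leftLim_eq_iSup {f : ℝ≥0 → ℝ≥0∞} (hf : Monotone f) (u : ℝ≥0) :
    Function.leftLim f u = ⨆ n : ℕ, f (u * ((n + 1) / (n + 2))) := by
  rcases (zero_le (a := u)).eq_or_lt with rfl | hu
  · simp [leftLim_zero]
  refine le_antisymm ?_ (iSup_le fun n => hf.le_leftLim ?_)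
  · rw [leftLim_le_iff hf hu]
    intro v hv
    have hlim : Tendsto (fun n : ℕ => u * (((n : ℝ≥0) + 1) / (n + 2))) atTop (𝓝 (u * 1)) := by
      refine Tendsto.const_mul u ?_
      rw [← NNReal.tendsto_coe]
      have := tendsto_natCast_div_add_atTop (𝕜 := ℝ) 1
      have := (tendsto_add_atTop_iff_nat 1).2 this
      refine this.congr fun n => ?_
      push_cast
      ring
    rw [mul_one] at hlim
    obtain ⟨n, hn⟩ := (hlim.eventually (lt_mem_nhds hv)).exists
    exact (hf hn.le).trans (le_iSup (fun n : ℕ => f (u * (((n : ℝ≥0) + 1) / (n + 2)))) n)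
  · refine mul_lt_of_lt_one_right hu ?_
    rw [div_lt_one (by positivity)]
    gcongr
    norm_num

lemma measurable_leftLim_kClock (hN : ∀ ω, CountingPaths N ω) (hm : ∀ x t, Measurable (N x t))
    (hT : ∀ a, Measurable (T a)) {τ : Ω → ℝ≥0} (hτ : Measurable τ) :
    Measurable (fun ω => Function.leftLim (kClock γ c N T y ω) (τ ω)) := by
  simp_rw [fun ω => leftLim_eq_iSup (kClock_mono (γ := γ) (c := c) (T := T) (y := y) (hN ω).mono)]
  exact Measurable.iSup fun n => measurable_kClock hN hm hT (hτ.mul measurable_const)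

lemma measurableSet_inSojourn (hN : ∀ ω, CountingPaths N ω) (hm : ∀ x t, Measurable (N x t))
    (hT : ∀ a, Measurable (T a)) (s : ℝ≥0) (p : ℕ+ × ℕ) :
    MeasurableSet {ω | InSojourn γ c N T y s ω p} :=
  (measurableSet_le (measurable_leftLim_kClock hN hm hT (measurable_eventTime hN hm _ _))
    measurable_const).inter
  (measurableSet_lt measurable_const (measurable_kClock hN hm hT (measurable_eventTime hN hm _ _)))

lemma measurableSet_sitsAt (hN : ∀ ω, CountingPaths N ω) (hm : ∀ x t, Measurable (N x t))
    (hT : ∀ a, Measurable (T a)) (s : ℝ≥0) (x : ℕ+) :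
    MeasurableSet {ω | SitsAt γ c N T y s ω x} := by
  simp only [sitsAt_iff_inSojourn, ofPred_exists]
  exact MeasurableSet.iUnion fun i => measurableSet_inSojourn hN hm hT s _

instance KState.instCountable : Countable KState := inferInstanceAs (Countable (Option ℕ+))

lemma selectState_eq_iff {q : Prop} {p : ℕ+ → Prop} {z : KState} :
    selectState y q p = z ↔ (q ∧ y = z) ∨ (¬ q ∧
      ((∃ x : ℕ+, z = x ∧ p x ∧ ∀ x' < x, ¬ p x') ∨ (z = OnePoint.infty ∧ ∀ x, ¬ p x))) := by
  classical
  unfold selectState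
  split_ifs with h1 h2
  · simp [h1]
  · constructor
    · rintro rfl
      exact Or.inr ⟨h1, Or.inl ⟨_, rfl, PNat.find_spec h2, fun x' hx' => PNat.find_min h2 hx'⟩⟩
    · rintro (⟨h, -⟩ | ⟨-, ⟨x, rfl, hx, hx'⟩ | ⟨-, h⟩⟩)
      · exact absurd h h1
      · congr 1
        exact (PNat.find_eq_iff h2).2 ⟨hx, hx'⟩
      · exact absurd h2 (not_exists.2 h)
  · push Not at h2
    simp [h1, h2, eq_comm]

lemma measurable_kProc (hN : ∀ ω, CountingPaths N ω) (hm : ∀ x t, Measurable (N x t))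
    (hT : ∀ a, Measurable (T a)) (t : ℝ≥0) : Measurable (kProc γ c N T y t) := by
  refine measurable_to_countable' fun z => ?_
  have h0 : MeasurableSet {ω | (t : ℝ) < gammaExt γ y * T none ω} :=
    measurableSet_lt measurable_const (measurable_const.mul (hT none))
  have h1 := fun x => measurableSet_sitsAt (γ := γ) (c := c) (y := y) hN hm hT t x
  have : kProc γ c N T y t ⁻¹' {z} =
      ({ω | (t : ℝ) < gammaExt γ y * T none ω} ∩ {_ω | y = z}) ∪
      ({ω | (t : ℝ) < gammaExt γ y * T none ω}ᶜ ∩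
        ((⋃ x : ℕ+, {_ω | z = x} ∩ ({ω | SitsAt γ c N T y t ω x} ∩
          ⋂ x' : ℕ+, {ω | x' < x → ¬ SitsAt γ c N T y t ω x'})) ∪
        ({_ω | z = OnePoint.infty} ∩ ⋂ x, {ω | SitsAt γ c N T y t ω x}ᶜ))) := by
    ext ω
    simp only [mem_preimage, mem_singleton_iff, kProc_eq_selectState, selectState_eq_iff]
    simp
  rw [this]
  refine (h0.inter (.const _)).union (h0.compl.inter (.union (.iUnion fun x =>
    (MeasurableSet.const _).inter ((h1 x).inter (.iInter fun x' => ?_)))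
    ((MeasurableSet.const _).inter (.iInter fun x => (h1 x).compl))))
  by_cases h : x' < x
  · have : {ω | x' < x → ¬ SitsAt γ c N T y t ω x'} = {ω | SitsAt γ c N T y t ω x'}ᶜ := by
      ext ω; simp [h]
    rw [this]
    exact (h1 x').compl
  · simp [h]

end Measurability

/-! ### The canonical version of the process -/

/-- The nondecreasing right-continuous regularisation of a function along the rationals. -/
def regularize (n : ℝ≥0 → ℕ) (t : ℝ≥0) : ℕ :=
  sInf {k | ∃ q : ℚ, t < Real.toNNReal q ∧ n (Real.toNNReal q) = k}

lemma exists_rat_toNNReal_btwn {s t : ℝ≥0} (h : s < t) :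
    ∃ q : ℚ, s < Real.toNNReal q ∧ Real.toNNReal q < t := by
  obtain ⟨q, -, h1, h2⟩ := (NNReal.lt_iff_exists_rat_btwn s t).1 h
  exact ⟨q, h1, h2⟩

lemma regularize_nonempty (n : ℝ≥0 → ℕ) (t : ℝ≥0) :
    {k | ∃ q : ℚ, t < Real.toNNReal q ∧ n (Real.toNNReal q) = k}.Nonempty := by
  obtain ⟨q, hq, -⟩ := exists_rat_toNNReal_btwn (show t < t + 1 by simp)
  exact ⟨_, q, hq, rfl⟩

lemma le_regularize_iff {n : ℝ≥0 → ℕ} {t : ℝ≥0} {k : ℕ} :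
    k ≤ regularize n t ↔ ∀ q : ℚ, t < Real.toNNReal q → k ≤ n (Real.toNNReal q) := by
  rw [regularize, le_csInf_iff (OrderBot.bddBelow _) (regularize_nonempty n t)]
  simp

lemma regularize_mono (n : ℝ≥0 → ℕ) : Monotone (regularize n) := by
  intro s t hst
  rw [le_regularize_iff]
  intro q hq
  exact le_regularize_iff.1 le_rfl q (hst.trans_lt hq)

lemma continuousWithinAt_of_eq_on_Ico {n : ℝ≥0 → ℕ} {t u : ℝ≥0} (htu : t < u)
    (h : ∀ v ∈ Ico t u, n v = n t) : ContinuousWithinAt n (Ici t) t := by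
  refine tendsto_const_nhds.congr' ?_
  filter_upwards [Ico_mem_nhdsGE htu] with v hv using (h v hv).symm

lemma regularize_rightCont (n : ℝ≥0 → ℕ) (t : ℝ≥0) :
    ContinuousWithinAt (regularize n) (Ici t) t := by
  obtain ⟨q, hq, hq'⟩ := Nat.sInf_mem (regularize_nonempty n t)
  refine continuousWithinAt_of_eq_on_Ico hq fun v hv => le_antisymm ?_ (regularize_mono n hv.1)
  exact (le_regularize_iff.1 le_rfl q hv.2).trans_eq hq'

lemma regularize_eq {n : ℝ≥0 → ℕ} (hm : Monotone n)
    (hr : ∀ t, ContinuousWithinAt n (Ici t) t) : regularize n = n := by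
  ext t
  refine le_antisymm ?_ (le_regularize_iff.2 fun q hq => hm hq.le)
  obtain ⟨u, hu, h⟩ := exists_eq_on_Ico (hr t)
  obtain ⟨q, hq, hqu⟩ := exists_rat_toNNReal_btwn hu
  exact (le_regularize_iff.1 le_rfl q hq).trans_eq (h _ ⟨hq.le, hqu⟩)

/-- Coordinates of the random data other than `T none`. -/
abbrev DataIndex : Type := (ℕ+ × ℝ≥0) ⊕ (ℕ+ × ℕ)

/-- The canonical Poisson paths. -/
def canonN (x : ℕ+) (v : ℝ≥0) (p : ℝ × (DataIndex → ℝ)) : ℕ :=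
  regularize (fun u => ⌊p.2 (Sum.inl (x, u))⌋₊) v

/-- The canonical exponential variables. -/
def canonT (a : Option (ℕ+ × ℕ)) (p : ℝ × (DataIndex → ℝ)) : ℝ :=
  a.elim p.1 fun i => p.2 (Sum.inr i)

/-- The data as a point of the canonical space. -/
def flatData (n : ℕ+ → ℝ≥0 → ℕ) (t : ℕ+ × ℕ → ℝ) : DataIndex → ℝ :=
  Sum.elim (fun i => (n i.1 i.2 : ℝ)) t

/-- This is the purpose of the regularisation: the measurability lemmas ask for counting paths at
every point, and arbitrary points of the product space would not have them. -/
lemma canon_countingPaths (p : ℝ × (DataIndex → ℝ)) : CountingPaths canonN p :=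
  ⟨fun _ => regularize_mono _, fun _ t => regularize_rightCont _ t⟩

lemma measurable_canonN (x : ℕ+) (v : ℝ≥0) : Measurable (canonN x v) := by
  refine measurable_of_Ici fun k => ?_
  have : canonN x v ⁻¹' Ici k = ⋂ q : ℚ, {p | v < Real.toNNReal q →
      k ≤ ⌊p.2 (Sum.inl (x, Real.toNNReal q))⌋₊} := by
    ext p
    simp [canonN, le_regularize_iff]
  rw [this]
  refine MeasurableSet.iInter fun q => ?_
  by_cases h : v < Real.toNNReal q
  · simp only [h, true_imp_iff]
    exact measurableSet_le measurable_const
      (Nat.measurable_floor.comp ((measurable_pi_apply _).comp measurable_snd))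
  · simp [h]

lemma measurable_canonT (a : Option (ℕ+ × ℕ)) : Measurable (canonT a) := by
  cases a with
  | none => exact measurable_fst
  | some i =>
    change Measurable fun p : ℝ × (DataIndex → ℝ) => p.2 (Sum.inr i)
    fun_prop

lemma measurable_canonProc {γ : ℕ+ → ℝ} {c : ℝ≥0} {y : KState} (t : ℝ≥0) :
    Measurable (kProc γ c canonN canonT y t) :=
  measurable_kProc canon_countingPaths measurable_canonN measurable_canonT t

lemma measurable_flatData :
    Measurable (fun p : (ℕ+ → ℝ≥0 → ℕ) × (ℕ+ × ℕ → ℝ) => flatData p.1 p.2) := by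
  refine measurable_pi_lambda _ fun i => ?_
  cases i with
  | inl i =>
    exact (measurable_of_countable (fun n : ℕ => (n : ℝ))).comp
      ((measurable_pi_apply i.2).comp ((measurable_pi_apply i.1).comp measurable_fst))
  | inr i => exact (measurable_pi_apply i).comp measurable_snd

/-- Regularising does not change a genuine counting path. The law of the process thus depends only
on the joint law of the data; the initial variable is kept as a separate coordinate because a
restart replaces it by a residual life. -/
lemma CountingPaths.kProc_eq_canon {Ω : Type*} {γ : ℕ+ → ℝ} {c : ℝ≥0} {N : ℕ+ → ℝ≥0 → Ω → ℕ}
    {T : Option (ℕ+ × ℕ) → Ω → ℝ} {y : KState} {ω : Ω} (hN : CountingPaths N ω) (t : ℝ≥0) :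
    kProc γ c N T y t ω = kProc γ c canonN canonT y t
      (T none ω, flatData (fun x v => N x v ω) (fun i => T (some i) ω)) := by
  have h1 : ∀ x v, canonN x v
      (T none ω, flatData (fun x v => N x v ω) (fun i => T (some i) ω)) = N x v ω := by
    intro x v
    simp [canonN, flatData, regularize_eq (hN.mono x) (hN.rightCont x)]
  have h2 : ∀ a, canonT a
      (T none ω, flatData (fun x v => N x v ω) (fun i => T (some i) ω)) = T a ω := by
    intro a
    cases a <;> simp [canonT, flatData]
  refine kProc_congr (by rw [h2]) (fun _ => rfl) fun _ x => ?_
  have h3 : kClock γ c canonN canonT y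
      (T none ω, flatData (fun x v => N x v ω) (fun i => T (some i) ω)) = kClock γ c N T y ω := by
    ext u
    simp only [kClock, h1, h2]
  have h4 : ∀ j, eventTime (canonN x) j
      (T none ω, flatData (fun x v => N x v ω) (fun i => T (some i) ω)) = eventTime (N x) j ω := by
    intro j
    simp only [eventTime, h1]
  simp only [SitsAt, h3, h4]

/-! ### Independence by freezing a variable -/

section Independence

variable {Ω : Type*} [mΩ : MeasurableSpace Ω] {P : Measure Ω}

lemma iIndepFun.indepFun_subtype {ι : Type*} {β : ι → Type*} [∀ i, MeasurableSpace (β i)]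
    {f : ∀ i, Ω → β i} (h : iIndepFun f P) (hm : ∀ i, Measurable (f i)) {S T : Set ι}
    (hST : Disjoint S T) : IndepFun (fun ω (i : S) => f i ω) (fun ω (i : T) => f i ω) P := by
  have key := indep_iSup_of_disjoint (fun i => (hm i).comap_le) h.iIndep hST
  have hle : ∀ U : Set ι, MeasurableSpace.comap (fun ω (i : U) => f i ω) inferInstance ≤
      ⨆ i ∈ U, MeasurableSpace.comap (f i) inferInstance := by
    intro U
    rw [← measurable_iff_comap_le]
    refine @measurable_pi_lambda _ _ _ (_) _ _ fun i => ?_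
    rw [measurable_iff_comap_le]
    exact le_iSup₂ (f := fun i (_ : i ∈ U) => MeasurableSpace.comap (f i) inferInstance) i.1 i.2
  exact indep_of_indep_of_le_left (indep_of_indep_of_le_right key (hle T)) (hle S)

/-- If `p` and `q` are independent and, for each frozen value of `p`, the variables `g p q` and
`h p q` are independent with a law of `h p q` that does not depend on `p`, then `h p q` is
independent of `(p, g p q)`. -/
lemma indepFun_of_frozen {α β δ ε : Type*} [MeasurableSpace α] [MeasurableSpace β]
    [MeasurableSpace δ] [MeasurableSpace ε] [IsProbabilityMeasure P] {p : Ω → α} {q : Ω → β}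
    (hp : Measurable p) (hq : Measurable q) (hpq : IndepFun p q P) {g : α × β → δ} {h : α × β → ε}
    (hg : Measurable g) (hh : Measurable h) {ν : Measure ε}
    (hind : ∀ a, IndepFun (fun ω => g (a, q ω)) (fun ω => h (a, q ω)) P)
    (hlaw : ∀ a, P.map (fun ω => h (a, q ω)) = ν) :
    IndepFun (fun ω => (p ω, g (p ω, q ω))) (fun ω => h (p ω, q ω)) P ∧
      P.map (fun ω => h (p ω, q ω)) = ν := by
  have hpm : IsProbabilityMeasure (P.map p) := Measure.isProbabilityMeasure_map hp.aemeasurable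
  have hqm : IsProbabilityMeasure (P.map q) := Measure.isProbabilityMeasure_map hq.aemeasurable
  have hprod := (indepFun_iff_map_prod_eq_prod_map_map hp.aemeasurable hq.aemeasurable).1 hpq
  -- By Fubini for the product law of `(p, q)`, the identity is integrated from its version with `p`
  -- frozen.
  have key : ∀ (A : Set (α × δ)) (B : Set ε), MeasurableSet A → MeasurableSet B →
      P ((fun ω => (p ω, g (p ω, q ω))) ⁻¹' A ∩ (fun ω => h (p ω, q ω)) ⁻¹' B) =
        P ((fun ω => (p ω, g (p ω, q ω))) ⁻¹' A) * ν B := by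
    intro A B hA hB
    have hga : ∀ a, Measurable fun b => g (a, b) := fun a => hg.comp measurable_prodMk_left
    have hha : ∀ a, Measurable fun b => h (a, b) := fun a => hh.comp measurable_prodMk_left
    have hAset : MeasurableSet {r : α × β | (r.1, g r) ∈ A} := (measurable_fst.prodMk hg) hA
    have hBset : MeasurableSet {r : α × β | h r ∈ B} := hh hB
    have e1 : P ((fun ω => (p ω, g (p ω, q ω))) ⁻¹' A) =
        ∫⁻ a, P.map q {b | (a, g (a, b)) ∈ A} ∂P.map p := by
      have : P ((fun ω => (p ω, g (p ω, q ω))) ⁻¹' A) =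
          P.map (fun ω => (p ω, q ω)) {r | (r.1, g r) ∈ A} := by
        rw [Measure.map_apply (hp.prodMk hq) hAset]; rfl
      rw [this, hprod, Measure.prod_apply hAset]
      rfl
    have e2 : P ((fun ω => (p ω, g (p ω, q ω))) ⁻¹' A ∩ (fun ω => h (p ω, q ω)) ⁻¹' B) =
        ∫⁻ a, P.map q ({b | (a, g (a, b)) ∈ A} ∩ {b | h (a, b) ∈ B}) ∂P.map p := by
      have : P ((fun ω => (p ω, g (p ω, q ω))) ⁻¹' A ∩ (fun ω => h (p ω, q ω)) ⁻¹' B) =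
          P.map (fun ω => (p ω, q ω)) ({r | (r.1, g r) ∈ A} ∩ {r | h r ∈ B}) := by
        rw [Measure.map_apply (hp.prodMk hq) (hAset.inter hBset)]; rfl
      rw [this, hprod, Measure.prod_apply (hAset.inter hBset)]
      rfl
    have hme : Measurable fun a => P.map q {b | (a, g (a, b)) ∈ A} :=
      measurable_measure_prodMk_left hAset
    rw [e1, e2, ← lintegral_mul_const _ hme]
    refine lintegral_congr fun a => ?_
    have hAa : MeasurableSet {d | (a, d) ∈ A} := measurable_prodMk_left hA
    have h1 := (hind a).measure_inter_preimage_eq_mul _ _ hAa hB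
    have e3 : P.map q ({b | (a, g (a, b)) ∈ A} ∩ {b | h (a, b) ∈ B}) = _ :=
      Measure.map_apply hq ((hga a hAa).inter (hha a hB))
    have e4 : P.map q {b | (a, g (a, b)) ∈ A} = _ := Measure.map_apply hq (hga a hAa)
    have e5 : P.map (fun ω => h (a, q ω)) B = _ := Measure.map_apply ((hha a).comp hq) hB
    rw [e3, e4, ← hlaw a, e5]
    exact h1
  have hhm : Measurable fun ω => h (p ω, q ω) := hh.comp (hp.prodMk hq)
  have hlaw' : P.map (fun ω => h (p ω, q ω)) = ν := by
    ext B hB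
    have := key univ B .univ hB
    rw [Measure.map_apply hhm hB]
    simpa using this
  refine ⟨?_, hlaw'⟩
  rw [indepFun_iff_measure_inter_preimage_eq_mul]
  intro A B hA hB
  rw [key A B hA hB, ← hlaw', Measure.map_apply hhm hB]

end Independence

/-! ### Poisson processes: uniqueness of the law and weak Markov property -/

section Poisson

variable {Ω : Type*} [mΩ : MeasurableSpace Ω] {P : Measure Ω}
  {X Y : ℝ≥0 → Ω → ℕ} {r : ℝ≥0}

/-- Along a grid that starts at `0`, values of the path are sums of independent increments; this
reduces finite-dimensional questions to increments. -/
lemma exists_monotone_grid (I : Finset ℝ≥0) :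
    ∃ t : ℕ → ℝ≥0, Monotone t ∧ t 0 = 0 ∧ ∀ a ∈ I, ∃ k, t k = a := by
  classical
  set J := insert 0 I with hJ
  have hpos : 0 < J.card := Finset.card_pos.2 (Finset.insert_nonempty _ _)
  have hex : ∀ a ∈ J, ∃ i : Fin J.card, J.orderEmbOfFin rfl i = a := by
    intro a ha
    have : a ∈ Set.range (J.orderEmbOfFin rfl) := by
      rw [Finset.range_orderEmbOfFin]; exact ha
    exact this
  -- The finite set together with `0` is enumerated increasingly, and the sequence stays at its last
  -- point.
  refine ⟨fun k => J.orderEmbOfFin rfl ⟨min k (J.card - 1), by omega⟩, ?_, ?_, ?_⟩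
  · intro k l hkl
    refine (J.orderEmbOfFin rfl).monotone ?_
    simp only [Fin.mk_le_mk]
    omega
  · obtain ⟨i, hi⟩ := hex 0 (Finset.mem_insert_self _ _)
    refine le_antisymm ?_ zero_le
    rw [← hi]
    refine (J.orderEmbOfFin rfl).monotone ?_
    simp [Fin.le_def]
  · intro a ha
    obtain ⟨i, hi⟩ := hex a (Finset.mem_insert_of_mem ha)
    refine ⟨i, ?_⟩
    rw [← hi]
    have h' := i.2
    exact congrArg (J.orderEmbOfFin rfl) (Fin.ext (show min (i : ℕ) (J.card - 1) = i by omega))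

lemma IsPoissonProcess.sum_increments (h : IsPoissonProcess X r P) {t : ℕ → ℝ≥0}
    (ht : Monotone t) {m k : ℕ} (hmk : m ≤ k) (ω : Ω) :
    ∑ i ∈ Finset.Ico m k, (X (t (i + 1)) ω - X (t i) ω) = X (t k) ω - X (t m) ω := by
  have hm : Monotone fun i => X (t i) ω := (h.mono ω).comp ht
  induction k, hmk using Nat.le_induction with
  | base => simp
  | succ k hk ih =>
    rw [Finset.sum_Ico_succ_top hk, ih]
    have h1 : X (t m) ω ≤ X (t k) ω := hm hk
    have h2 : X (t k) ω ≤ X (t (k + 1)) ω := hm (Nat.le_succ k)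
    omega

lemma IsPoissonProcess.measurable_increment (h : IsPoissonProcess X r P) (s t : ℝ≥0) :
    Measurable fun ω => X t ω - X s ω :=
  (measurable_of_countable (fun p : ℕ × ℕ => p.1 - p.2)).comp
    ((h.measurable t).prodMk (h.measurable s))

lemma IsPoissonProcess.map_increments [IsProbabilityMeasure P] (h : IsPoissonProcess X r P) (h' : IsPoissonProcess Y r P)
    {t : ℕ → ℝ≥0} (ht : Monotone t) :
    P.map (fun ω i => X (t (i + 1)) ω - X (t i) ω) =
      P.map (fun ω i => Y (t (i + 1)) ω - Y (t i) ω) := by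
  rw [(h.indepIncrements.nat ht).map_fun_eq_infinitePi_map
      (fun i => h.measurable_increment _ _),
    (h'.indepIncrements.nat ht).map_fun_eq_infinitePi_map
      (fun i => h'.measurable_increment _ _)]
  congr 1
  ext1 i
  rw [(h.law _ _ (ht i.le_succ)).map_eq, (h'.law _ _ (ht i.le_succ)).map_eq]

/-- The law of a Poisson process is determined by its rate. -/
lemma IsPoissonProcess.map_eq [IsProbabilityMeasure P] (h : IsPoissonProcess X r P) (h' : IsPoissonProcess Y r P) :
    P.map (fun ω t => X t ω) = P.map (fun ω t => Y t ω) := by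
  have hX : Measurable fun ω t => X t ω := measurable_pi_lambda _ h.measurable
  have hY : Measurable fun ω t => Y t ω := measurable_pi_lambda _ h'.measurable
  rw [map_eq_iff_forall_finset_map_restrict_eq hX.aemeasurable hY.aemeasurable]
  intro I
  obtain ⟨t, ht, ht0, hI⟩ := exists_monotone_grid I
  choose! k hk using hI
  -- `G` recovers the values at the times of `I` from the increments, since the path and the grid
  -- both start at `0`.
  set G : (ℕ → ℕ) → (I → ℕ) := fun δ a => ∑ i ∈ Finset.Ico 0 (k a), δ i with hG
  have hGm : Measurable G := by
    refine measurable_pi_lambda _ fun a => Finset.measurable_sum _ fun i _ => measurable_pi_apply i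
  have key : ∀ {Z : ℝ≥0 → Ω → ℕ}, IsPoissonProcess Z r P →
      P.map (fun ω => I.restrict (Z · ω)) = (P.map fun ω i => Z (t (i + 1)) ω - Z (t i) ω).map G := by
    intro Z hZ
    rw [Measure.map_map hGm (measurable_pi_lambda _ fun i => hZ.measurable_increment _ _)]
    congr 1
    ext ω a
    simp only [hG, Function.comp, hZ.sum_increments ht (Nat.zero_le _), ht0, hZ.zero, hk a a.2,
      Finset.restrict, Nat.sub_zero]
  rw [key h, key h', h.map_increments h' ht]

lemma IsPoissonProcess.shift (h : IsPoissonProcess X r P) (u : ℝ≥0) :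
    IsPoissonProcess (fun v ω => X (u + v) ω - X u ω) r P where
  measurable v := h.measurable_increment _ _
  zero ω := by simp
  mono ω s t hst := Nat.sub_le_sub_right (h.mono ω (by gcongr)) _
  rightCont ω t := by
    have h1 : ContinuousWithinAt (fun v => X (u + v) ω) (Ici t) t := by
      refine (h.rightCont ω (u + t)).comp (t := Ici (u + t)) (f := fun v => u + v) ?_ ?_
      · fun_prop
      · intro v hv; exact add_le_add_right (mem_Ici.1 hv) u
    exact (continuous_of_discreteTopology
      (f := fun n : ℕ => n - X u ω)).continuousAt.comp_continuousWithinAt h1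
  indepIncrements := by
    intro n t ht
    have := h.indepIncrements n (fun i => u + t i) (fun i j hij => add_le_add_right (ht hij) u)
    refine this.congr fun i => ae_of_all _ fun ω => ?_
    have h1 : X u ω ≤ X (u + t i.castSucc) ω := h.mono ω (by simp)
    simp only
    omega
  law s t hst := by
    have := h.law (u + s) (u + t) (by gcongr)
    rw [add_tsub_add_eq_tsub_left] at this
    refine this.congr (ae_of_all _ fun ω => ?_)
    have h1 : X u ω ≤ X (u + s) ω := h.mono ω (by simp)
    simp only
    omega

/-- The weak Markov property of a Poisson process. -/
lemma IsPoissonProcess.indepFun_stop_shift [IsProbabilityMeasure P] (h : IsPoissonProcess X r P) (u : ℝ≥0) :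
    IndepFun (fun ω v => X (min v u) ω) (fun ω v => X (u + v) ω - X u ω) P := by
  classical
  refine IndepFun.process_indepFun_process (fun v => h.measurable _)
    (fun v => h.measurable_increment _ _) fun I J => ?_
  obtain ⟨t, ht, ht0, hk⟩ := exists_monotone_grid
    (insert u (I.image (fun v => min v u) ∪ J.image (fun v => u + v)))
  obtain ⟨m, hm⟩ := hk u (by simp)
  have hI : ∀ v ∈ I, ∃ k, t k = min v u := fun v hv => hk _ (by
    simp only [Finset.mem_insert, Finset.mem_union, Finset.mem_image]
    exact Or.inr (Or.inl ⟨v, hv, rfl⟩))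
  have hJ : ∀ v ∈ J, ∃ k, t k = u + v := fun v hv => hk _ (by
    simp only [Finset.mem_insert, Finset.mem_union, Finset.mem_image]
    exact Or.inr (Or.inr ⟨v, hv, rfl⟩))
  choose! k hk using hI
  choose! l hl using hJ
  -- The grid may repeat a value, so `k v` could exceed `m`; cutting the index at `m` keeps the grid
  -- point and leaves only increments before `u`. Similarly for `l v` below.
  have hk' : ∀ v ∈ I, t (min (k v) m) = min v u := fun v hv => by
    rw [ht.map_min, hk v hv, hm]; simp
  have hl' : ∀ v ∈ J, t (max (l v) m) = u + v := fun v hv => by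
    rw [ht.map_max, hl v hv, hm]; simp
  have hind := iIndepFun.indepFun_subtype (h.indepIncrements.nat ht)
    (fun i => h.measurable_increment _ _) (S := Iio m) (T := Ici m)
    (Set.disjoint_left.2 fun i hi hi' => (mem_Iio.1 hi).not_ge hi')
  let φ : (Iio m → ℕ) → I → ℕ := fun δ v => ∑ i ∈ Finset.Ico 0 (min (k v) m),
    if hi : i < m then δ ⟨i, hi⟩ else 0
  let ψ : (Ici m → ℕ) → J → ℕ := fun δ v => ∑ i ∈ Finset.Ico m (max (l v) m),
    if hi : m ≤ i then δ ⟨i, hi⟩ else 0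
  have hφ : Measurable φ := by
    refine measurable_pi_lambda _ fun v => Finset.measurable_sum _ fun i _ => ?_
    split_ifs <;> fun_prop
  have hψ : Measurable ψ := by
    refine measurable_pi_lambda _ fun v => Finset.measurable_sum _ fun i _ => ?_
    split_ifs <;> fun_prop
  have := hind.comp hφ hψ
  convert! this using 1
  · ext ω v
    have e : ∀ i ∈ Finset.Ico 0 (min (k v) m), (if hi : i < m then
        X (t (i + 1)) ω - X (t i) ω else 0) = X (t (i + 1)) ω - X (t i) ω := by
      intro i hi
      rw [dif_pos]
      simp only [Finset.mem_Ico] at hi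
      omega
    simp only [Function.comp, φ]
    rw [Finset.sum_congr rfl e, h.sum_increments ht (Nat.zero_le _), ht0, h.zero, hk' v v.2]
    simp
  · ext ω v
    have e : ∀ i ∈ Finset.Ico m (max (l v) m), (if hi : m ≤ i then
        X (t (i + 1)) ω - X (t i) ω else 0) = X (t (i + 1)) ω - X (t i) ω := by
      intro i hi
      rw [dif_pos]
      simp only [Finset.mem_Ico] at hi
      omega
    simp only [Function.comp, ψ]
    rw [Finset.sum_congr rfl e, h.sum_increments ht (le_max_right _ _), hl' v v.2, hm]

end Poisson

/-! ### Past and future of the data at a fixed index -/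

/-- The data used up to time `u`. -/
def pastData {Ω : Type*} (N : ℕ+ → ℝ≥0 → Ω → ℕ) (T : Option (ℕ+ × ℕ) → Ω → ℝ) (u : ℝ≥0) (ω : Ω) :
    (ℕ+ → ℝ≥0 → ℕ) × (Option (ℕ+ × ℕ) → ℝ) :=
  (fun x v => stopN N u x v ω, fun a => stopT N T u a ω)

/-- The data not used up to time `τ`. -/
def futureData {Ω : Type*} (N : ℕ+ → ℝ≥0 → Ω → ℕ) (T : Option (ℕ+ × ℕ) → Ω → ℝ) (τ : Ω → ℝ≥0)
    (ω : Ω) : DataIndex → ℝ :=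
  flatData (fun x v => shiftN N τ x v ω) (fun i => T (some (i.1, N i.1 (τ ω) ω + i.2)) ω)

/-- All the data but the variable `T none`. -/
def fullData {Ω : Type*} (N : ℕ+ → ℝ≥0 → Ω → ℕ) (T : Option (ℕ+ × ℕ) → Ω → ℝ)
    (ω : Ω) : DataIndex → ℝ :=
  flatData (fun x v => N x v ω) (fun i => T (some i) ω)

section

variable {Ω : Type*} [mΩ : MeasurableSpace Ω] {P : Measure Ω}

lemma IndepFun.iIndepFun_bool [IsProbabilityMeasure P] {β : Type*} [MeasurableSpace β]
    {f : Bool → Ω → β} (h : IndepFun (f true) (f false) P) : iIndepFun f P := by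
  rw [iIndepFun_iff_measure_inter_preimage_eq_mul]
  intro S sets hs
  have hS : ∀ S : Finset Bool, S = ∅ ∨ S = {true} ∨ S = {false} ∨ S = Finset.univ := by decide
  have hu : (Finset.univ : Finset Bool) = {true, false} := rfl
  rcases hS S with rfl | rfl | rfl | rfl
  · simp
  · simp
  · simp
  · rw [hu] at hs ⊢
    rw [Finset.prod_pair (by simp), ← h.measure_inter_preimage_eq_mul _ _ (hs true (by simp))
      (hs false (by simp))]
    congr 1
    ext ω
    simp [and_comm]

variable {N : ℕ+ → ℝ≥0 → Ω → ℕ} {T : Option (ℕ+ × ℕ) → Ω → ℝ}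

lemma measurable_futureData (hN : ∀ ω, CountingPaths N ω) (hm : ∀ x t, Measurable (N x t))
    (hT : ∀ a, Measurable (T a)) {τ : Ω → ℝ≥0} (hτ : Measurable τ) :
    Measurable (futureData N T τ) := by
  have h1 : ∀ x, Measurable fun ω => N x (τ ω) ω := fun x => measurable_apply_time hN hm hτ x
  refine measurable_flatData.comp (Measurable.prodMk ?_ ?_)
  · refine measurable_pi_lambda _ fun x => measurable_pi_lambda _ fun v => ?_
    exact (measurable_of_countable (fun p : ℕ × ℕ => p.1 - p.2)).comp
      ((measurable_apply_time hN hm (hτ.add_const v) x).prodMk (h1 x))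
  · refine measurable_pi_lambda _ fun i => ?_
    exact Measurable.apply_nat (f := fun k ω => T (some (i.1, k + i.2)) ω)
      (fun k => hT _) (h1 i.1)

namespace IsKData

lemma countingPaths (h : IsKData P N T) (ω : Ω) : CountingPaths N ω :=
  ⟨fun x => (h.poisson x).mono ω, fun x => (h.poisson x).rightCont ω⟩

lemma measurable_N (h : IsKData P N T) (x : ℕ+) (t : ℝ≥0) : Measurable (N x t) :=
  (h.poisson x).measurable t

lemma measurable_allN (h : IsKData P N T) : Measurable fun ω x t => N x t ω :=
  measurable_pi_lambda _ fun x => measurable_pi_lambda _ fun t => h.measurable_N x t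

lemma measurable_allT (h : IsKData P N T) : Measurable fun ω a => T a ω :=
  measurable_pi_lambda _ h.measurable_exp

lemma measurable_shift (u : ℝ≥0) :
    Measurable fun (n : ℝ≥0 → ℕ) (v : ℝ≥0) => n (u + v) - n u :=
  measurable_pi_lambda _ fun v =>
    have : Measurable fun n : ℝ≥0 → ℕ => (n (u + v), n u) := by fun_prop
    (measurable_of_countable (fun p : ℕ × ℕ => p.1 - p.2)).comp this

lemma measurable_stop (u : ℝ≥0) :
    Measurable fun (n : ℝ≥0 → ℕ) (v : ℝ≥0) => n (min v u) :=
  measurable_pi_lambda _ fun v => measurable_pi_apply (min v u)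

variable [IsProbabilityMeasure P]

lemma map_shiftN (h : IsKData P N T) (u : ℝ≥0) :
    P.map (fun ω x v => shiftN N (fun _ => u) x v ω) = P.map (fun ω x v => N x v ω) := by
  have h1 := h.indep_poisson.map_fun_eq_infinitePi_map
    (fun x => measurable_pi_lambda _ fun t => h.measurable_N x t)
  have h2 := (h.indep_poisson.comp _ (fun _ => measurable_shift u)).map_fun_eq_infinitePi_map
    (fun x => (measurable_shift u).comp (measurable_pi_lambda _ fun t => h.measurable_N x t))
  rw [h1]
  refine h2.trans ?_
  congr 1
  ext1 x
  exact ((h.poisson x).shift u).map_eq (h.poisson x)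

/-- The weak Markov property splits each path into two independent pieces. With the independence of
the sites, all the pieces, indexed by site and `Bool`, are independent and can be regrouped by the
`Bool` coordinate. -/
lemma indepFun_stopN_shiftN (h : IsKData P N T) (u : ℝ≥0) :
    IndepFun (fun ω x v => stopN N u x v ω) (fun ω x v => shiftN N (fun _ => u) x v ω) P := by
  let Z : ℕ+ → Bool → Ω → ℝ≥0 → ℕ := fun x b ω =>
    if b then fun v => N x (min v u) ω else fun v => N x (u + v) ω - N x u ω
  have hNm : ∀ x, Measurable fun ω t => N x t ω :=
    fun x => measurable_pi_lambda _ fun t => h.measurable_N x t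
  have hZm : ∀ x b, Measurable (Z x b) := by
    intro x b
    cases b
    · exact (measurable_shift u).comp (hNm x)
    · exact (measurable_stop u).comp (hNm x)
  have h1 : iIndepFun (fun x ω => (Z x · ω)) P := by
    refine h.indep_poisson.comp (fun (_ : ℕ+) (n : ℝ≥0 → ℕ) (b : Bool) =>
      if b then fun v => n (min v u) else fun v => n (u + v) - n u) fun _ => ?_
    refine measurable_pi_lambda _ fun b => ?_
    cases b
    · exact measurable_shift u
    · exact measurable_stop u
  have h2 : ∀ x, iIndepFun (Z x) P := fun x =>
    IndepFun.iIndepFun_bool ((h.poisson x).indepFun_stop_shift u)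
  have h3 := iIndepFun.indepFun_subtype (iIndepFun_uncurry' hZm h1 h2) (fun p => hZm p.1 p.2)
    (S := {p | p.2 = true}) (T := {p | p.2 = false})
    (Set.disjoint_left.2 fun p hp hp' => by simp_all)
  let φ : ({p : ℕ+ × Bool | p.2 = true} → ℝ≥0 → ℕ) → ℕ+ → ℝ≥0 → ℕ := fun f x => f ⟨(x, true), rfl⟩
  let ψ : ({p : ℕ+ × Bool | p.2 = false} → ℝ≥0 → ℕ) → ℕ+ → ℝ≥0 → ℕ :=
    fun f x => f ⟨(x, false), rfl⟩
  have hφ : Measurable φ := measurable_pi_lambda _ fun x => measurable_pi_apply _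
  have hψ : Measurable ψ := measurable_pi_lambda _ fun x => measurable_pi_apply _
  exact h3.comp hφ hψ

lemma measurable_truncT (k : ℕ+ → ℕ) : Measurable (truncT k) := by
  refine measurable_pi_lambda _ fun a => ?_
  cases a with
  | none => exact measurable_pi_apply none
  | some p =>
    by_cases hp : p.2 < k p.1
    · simpa [truncT, hp] using measurable_pi_apply (some p)
    · simp [truncT, hp]

omit [IsProbabilityMeasure P] in
-- The two families read disjoint sets of indices; the zeros that pad the truncated family are
-- constants.
lemma indepFun_truncT (h : IsKData P N T) (k : ℕ+ → ℕ) :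
    IndepFun (fun ω (p : ℕ+ × ℕ) => T (some (p.1, k p.1 + p.2)) ω)
      (fun ω => truncT k (fun a => T a ω)) P := by
  let U : Set (Option (ℕ+ × ℕ)) := {a | ∃ p : ℕ+ × ℕ, a = some (p.1, k p.1 + p.2)}
  have h3 := iIndepFun.indepFun_subtype h.indep_exp h.measurable_exp (S := U) (T := Uᶜ)
    disjoint_compl_right
  let φ : (U → ℝ) → ℕ+ × ℕ → ℝ := fun f p => f ⟨some (p.1, k p.1 + p.2), p, rfl⟩
  have hnone : none ∈ Uᶜ := by rintro ⟨p, hp⟩; cases hp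
  have hsome : ∀ p : ℕ+ × ℕ, p.2 < k p.1 → some p ∈ Uᶜ := by
    rintro p hp ⟨q, hq⟩
    obtain rfl := Option.some_injective _ hq
    simp at hp
  let ψ : ((Uᶜ : Set _) → ℝ) → Option (ℕ+ × ℕ) → ℝ := fun f a => match a with
    | none => f ⟨none, hnone⟩
    | some p => if hp : p.2 < k p.1 then f ⟨some p, hsome p hp⟩ else 0
  have hφ : Measurable φ := measurable_pi_lambda _ fun x => measurable_pi_apply _
  have hψ : Measurable ψ := by
    refine measurable_pi_lambda _ fun a => ?_
    cases a with
    | none => exact measurable_pi_apply (⟨none, hnone⟩ : (Uᶜ : Set _))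
    | some p =>
      by_cases hp : p.2 < k p.1
      · simpa [ψ, hp] using measurable_pi_apply (⟨some p, hsome p hp⟩ : (Uᶜ : Set _))
      · simp [ψ, hp]
  convert! h3.comp hφ hψ using 1

omit [IsProbabilityMeasure P] in
lemma map_shiftT (h : IsKData P N T) (k : ℕ+ → ℕ) :
    P.map (fun ω (p : ℕ+ × ℕ) => T (some (p.1, k p.1 + p.2)) ω) =
      P.map (fun ω p => T (some p) ω) := by
  have hinj : Function.Injective fun p : ℕ+ × ℕ => some (p.1, k p.1 + p.2) := by
    intro p q hpq
    have h1 : (p.1, k p.1 + p.2) = (q.1, k q.1 + q.2) := Option.some_injective _ hpq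
    obtain ⟨h2, h3⟩ := Prod.mk.inj h1
    rw [h2] at h3
    exact Prod.ext h2 (by omega)
  have h1 := (h.indep_exp.precomp hinj).map_fun_eq_infinitePi_map
    (fun p => h.measurable_exp _)
  have h2 := (h.indep_exp.precomp (Option.some_injective (ℕ+ × ℕ))).map_fun_eq_infinitePi_map
    (fun p => h.measurable_exp _)
  refine h1.trans (Eq.trans ?_ h2.symm)
  congr 1
  ext1 p
  exact (h.exp _).map_eq.trans (h.exp _).map_eq.symm

/-- The numbers of used exponential variables are random, but they are functions of the stopped
paths. With the stopped paths frozen these numbers are constants `k`, for which used and unused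
variables are independent and the unused ones are again i.i.d. exponential, with a law that does not
depend on `k`. -/
lemma indepFun_past_future_aux (h : IsKData P N T) (u : ℝ≥0) :
    IndepFun (pastData N T u)
      (fun ω => (fun x v => shiftN N (fun _ => u) x v ω,
        fun i : ℕ+ × ℕ => T (some (i.1, N i.1 u ω + i.2)) ω)) P ∧
    P.map (fun ω => (fun x v => shiftN N (fun _ => u) x v ω,
        fun i : ℕ+ × ℕ => T (some (i.1, N i.1 u ω + i.2)) ω)) =
      P.map (fun ω => (fun x v => N x v ω, fun i => T (some i) ω)) := by
  let stopped : (ℕ+ → ℝ≥0 → ℕ) → ℕ+ → ℝ≥0 → ℕ := fun n x v => n x (min v u)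
  let shift : (ℕ+ → ℝ≥0 → ℕ) → ℕ+ → ℝ≥0 → ℕ := fun n x v => n x (u + v) - n x u
  have hst : Measurable stopped :=
    measurable_pi_lambda _ fun x => (measurable_stop u).comp (measurable_pi_apply x)
  have hshift : Measurable shift :=
    measurable_pi_lambda _ fun x => (measurable_shift u).comp (measurable_pi_apply x)
  have hN := h.measurable_allN
  have hT := h.measurable_allT
  have hTs : Measurable fun ω (i : ℕ+ × ℕ) => T (some i) ω :=
    measurable_pi_lambda _ fun i => h.measurable_exp _
  -- the stopped paths are independent of the shifted paths and the exponential variables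
  have hA : IndepFun (fun ω => stopped (fun x v => N x v ω))
      (fun ω => (shift (fun x v => N x v ω), fun a => T a ω)) P := by
    have := (indepFun_of_frozen hT hN h.indep.symm (g := fun r => shift r.2)
      (h := fun r => stopped r.2) (hshift.comp measurable_snd) (hst.comp measurable_snd)
      (ν := P.map fun ω => stopped (fun x v => N x v ω))
      (fun _ => (h.indepFun_stopN_shiftN u).symm) (fun _ => rfl)).1
    exact (this.comp measurable_swap measurable_id).symm
  -- for frozen numbers of used variables
  have hB : ∀ k : ℕ+ → ℕ, IndepFun (fun ω => truncT k (fun a => T a ω))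
      (fun ω => (shift (fun x v => N x v ω),
        fun i : ℕ+ × ℕ => T (some (i.1, k i.1 + i.2)) ω)) P := by
    intro k
    have hidx : Measurable fun (t : Option (ℕ+ × ℕ) → ℝ) (i : ℕ+ × ℕ) =>
        t (some (i.1, k i.1 + i.2)) := measurable_pi_lambda _ fun i => measurable_pi_apply _
    exact (indepFun_of_frozen (hshift.comp hN) hT
      (h.indep.comp hshift measurable_id)
      (g := fun r (i : ℕ+ × ℕ) => r.2 (some (i.1, k i.1 + i.2)))
      (h := fun r => truncT k r.2) (hidx.comp measurable_snd)
      ((measurable_truncT k).comp measurable_snd) (ν := P.map fun ω => truncT k fun a => T a ω)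
      (fun _ => h.indepFun_truncT k) (fun _ => rfl)).1.symm
  have hC : ∀ k : ℕ+ → ℕ, P.map (fun ω => (shift (fun x v => N x v ω),
        fun i : ℕ+ × ℕ => T (some (i.1, k i.1 + i.2)) ω)) =
      P.map (fun ω => (fun x v => N x v ω, fun i => T (some i) ω)) := by
    intro k
    have hidx : ∀ l : ℕ+ → ℕ, Measurable fun (t : Option (ℕ+ × ℕ) → ℝ) (i : ℕ+ × ℕ) =>
        t (some (i.1, l i.1 + i.2)) := fun l => measurable_pi_lambda _ fun i => measurable_pi_apply _
    have hsome : Measurable fun (t : Option (ℕ+ × ℕ) → ℝ) (i : ℕ+ × ℕ) => t (some i) :=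
      measurable_pi_lambda _ fun i => measurable_pi_apply _
    have e1 : P.map (fun ω => (shift (fun x v => N x v ω),
        fun i : ℕ+ × ℕ => T (some (i.1, k i.1 + i.2)) ω)) = _ :=
      (indepFun_iff_map_prod_eq_prod_map_map (hshift.comp hN).aemeasurable
        ((hidx k).comp hT).aemeasurable).1 (h.indep.comp hshift (hidx k))
    have e2 : P.map (fun ω => (fun x v => N x v ω, fun i => T (some i) ω)) = _ :=
      (indepFun_iff_map_prod_eq_prod_map_map hN.aemeasurable
        (hsome.comp hT).aemeasurable).1 (h.indep.comp measurable_id hsome)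
    rw [e1, e2]
    congr 1
    · exact h.map_shiftN u
    · exact h.map_shiftT k
  have hg : Measurable fun r : (ℕ+ → ℝ≥0 → ℕ) × ((ℕ+ → ℝ≥0 → ℕ) × (Option (ℕ+ × ℕ) → ℝ)) =>
      truncT (fun x => r.1 x u) r.2.2 := by
    refine measurable_pi_lambda _ fun a => ?_
    cases a with
    | none => simp only [truncT]; fun_prop
    | some p =>
      simp only [truncT]
      refine Measurable.ite (measurableSet_lt measurable_const ?_) ?_ measurable_const <;> fun_prop
  have hh : Measurable fun r : (ℕ+ → ℝ≥0 → ℕ) × ((ℕ+ → ℝ≥0 → ℕ) × (Option (ℕ+ × ℕ) → ℝ)) =>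
      (r.2.1, fun i : ℕ+ × ℕ => r.2.2 (some (i.1, r.1 i.1 u + i.2))) := by
    refine (measurable_fst.comp measurable_snd).prodMk (measurable_pi_lambda _ fun i => ?_)
    exact Measurable.apply_nat (f := fun k (r : (ℕ+ → ℝ≥0 → ℕ) ×
      ((ℕ+ → ℝ≥0 → ℕ) × (Option (ℕ+ × ℕ) → ℝ))) => r.2.2 (some (i.1, k + i.2)))
      (fun k => by fun_prop) (by fun_prop)
  -- The frozen variable `a` is the family of stopped paths, whose values at `u` are the numbers of
  -- used variables.
  have key := indepFun_of_frozen (hst.comp hN) ((hshift.comp hN).prodMk hT) hA hg hh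
    (fun a => hB (fun x => a x u)) (fun a => hC (fun x => a x u))
  simp only [stopped, shift, Function.comp_def, min_self] at key
  exact key

lemma indepFun_past_future (h : IsKData P N T) (u : ℝ≥0) :
    IndepFun (pastData N T u) (futureData N T fun _ => u) P :=
  (h.indepFun_past_future_aux u).1.comp measurable_id measurable_flatData

omit [IsProbabilityMeasure P] in
lemma measurable_futureData (h : IsKData P N T) {τ : Ω → ℝ≥0} (hτ : Measurable τ) :
    Measurable (futureData N T τ) :=
  _root_.measurable_futureData h.countingPaths h.measurable_N h.measurable_exp hτ

omit [IsProbabilityMeasure P] in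
lemma measurable_fullData (h : IsKData P N T) : Measurable (fullData N T) :=
  measurable_flatData.comp (h.measurable_allN.prodMk
    (measurable_pi_lambda _ fun _ => h.measurable_exp _))

lemma map_futureData (h : IsKData P N T) (u : ℝ≥0) :
    P.map (futureData N T fun _ => u) = P.map (fullData N T) := by
  have hS : Measurable fun ω x v => shiftN N (fun _ => u) x v ω :=
    measurable_pi_lambda _ fun x => (measurable_shift u).comp
      (measurable_pi_lambda _ fun t => h.measurable_N x t)
  have hT : Measurable fun ω (i : ℕ+ × ℕ) => T (some (i.1, N i.1 u ω + i.2)) ω :=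
    measurable_pi_lambda _ fun i => Measurable.apply_nat
      (f := fun k ω => T (some (i.1, k + i.2)) ω) (fun k => h.measurable_exp _)
      (h.measurable_N i.1 u)
  have e1 := congrArg (Measure.map fun p => flatData p.1 p.2) (h.indepFun_past_future_aux u).2
  rw [Measure.map_map measurable_flatData (h.measurable_allN.prodMk
    (measurable_pi_lambda _ fun i => h.measurable_exp _)),
    Measure.map_map measurable_flatData (hS.prodMk hT)] at e1
  exact e1

end IsKData

end

/-! ### Strong Markov property of the data -/

section

variable {Ω : Type*} [mΩ : MeasurableSpace Ω] {P : Measure Ω}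
  {N : ℕ+ → ℝ≥0 → Ω → ℕ} {T : Option (ℕ+ × ℕ) → Ω → ℝ}

/-- The σ-algebra of the data used up to time `u`. -/
abbrev dataSigma (N : ℕ+ → ℝ≥0 → Ω → ℕ) (T : Option (ℕ+ × ℕ) → Ω → ℝ) (u : ℝ≥0) :
    MeasurableSpace Ω := MeasurableSpace.comap (pastData N T u) inferInstance

/-- Stop the data at time `u`. -/
def restop (u : ℝ≥0) (d : (ℕ+ → ℝ≥0 → ℕ) × (Option (ℕ+ × ℕ) → ℝ)) :
    (ℕ+ → ℝ≥0 → ℕ) × (Option (ℕ+ × ℕ) → ℝ) :=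
  (fun x v => d.1 x (min v u), truncT (fun x => d.1 x u) d.2)

lemma measurable_restop (u : ℝ≥0) : Measurable (restop u) := by
  refine Measurable.prodMk (measurable_pi_lambda _ fun x => measurable_pi_lambda _ fun v => ?_) ?_
  · fun_prop
  refine measurable_pi_lambda _ fun a => ?_
  cases a with
  | none => simp only [truncT]; fun_prop
  | some p =>
    simp only [truncT]
    refine Measurable.ite (measurableSet_lt measurable_const ?_) ?_ measurable_const <;> fun_prop

/-- An approximation of `τ` from above with values in a lattice. -/
def upperGrid (τ : Ω → ℝ≥0) (n : ℕ) (ω : Ω) : ℝ≥0 := (⌊τ ω * (n + 1)⌋₊ + 1) / (n + 1)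

omit mΩ in
lemma lt_upperGrid (τ : Ω → ℝ≥0) (n : ℕ) (ω : Ω) : τ ω < upperGrid τ n ω := by
  rw [upperGrid, lt_div_iff₀ (by positivity)]
  exact Nat.lt_floor_add_one _

omit mΩ in
lemma tendsto_upperGrid (τ : Ω → ℝ≥0) (ω : Ω) :
    Tendsto (fun n => upperGrid τ n ω) atTop (𝓝 (τ ω)) := by
  have hlim : Tendsto (fun n : ℕ => τ ω + 1 / ((n : ℝ≥0) + 1)) atTop (𝓝 (τ ω + 0)) :=
    tendsto_const_nhds.add tendsto_one_div_add_atTop_nhds_zero_nat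
  rw [add_zero] at hlim
  refine tendsto_of_tendsto_of_tendsto_of_le_of_le tendsto_const_nhds hlim
    (fun n => (lt_upperGrid τ n ω).le) fun n => ?_
  simp only [upperGrid]
  rw [div_le_iff₀ (by positivity), add_mul, one_div, inv_mul_cancel₀ (by positivity)]
  gcongr
  exact Nat.floor_le zero_le

omit mΩ in
-- The grid values decrease to `τ` closely enough for right-continuity: integer-valued paths are
-- constant just after any time, so each coordinate is eventually equal to its limit.
lemma CountingPaths.eventually_futureData_eq {ω : Ω} (hN : CountingPaths N ω) (τ : Ω → ℝ≥0)
    (i : DataIndex) :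
    ∀ᶠ n in atTop, futureData N T (upperGrid τ n) ω i = futureData N T τ ω i := by
  have key : ∀ x v, ∀ᶠ n in atTop, N x (upperGrid τ n ω + v) ω = N x (τ ω + v) ω := by
    intro x v
    obtain ⟨u, hu, hs⟩ := exists_eq_on_Ico (hN.rightCont x (τ ω + v))
    have hlim := (tendsto_upperGrid τ ω).add_const v
    filter_upwards [hlim.eventually (gt_mem_nhds hu)] with n hn
    refine hs _ ⟨?_, hn⟩
    gcongr
    exact (lt_upperGrid τ n ω).le
  have key0 : ∀ x, ∀ᶠ n in atTop, N x (upperGrid τ n ω) ω = N x (τ ω) ω := fun x => by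
    simpa using key x 0
  cases i with
  | inl i =>
    filter_upwards [key i.1 i.2, key0 i.1] with n h1 h2
    simp [futureData, flatData, shiftN, h1, h2]
  | inr i =>
    filter_upwards [key0 i.1] with n h2
    simp [futureData, flatData, h2]

namespace IsKData

lemma measurable_pastData (h : IsKData P N T) (u : ℝ≥0) : Measurable (pastData N T u) :=
  (measurable_restop u).comp (h.measurable_allN.prodMk h.measurable_allT)

/-- Stopping at `u` can be performed on the data already stopped at a later `v`. -/
lemma dataSigma_mono (h : IsKData P N T) : Monotone (dataSigma N T) := by
  intro u v huv
  have : pastData N T u = restop u ∘ pastData N T v := by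
    ext ω a
    · simp [pastData, restop, stopN, huv]
    · cases a with
      | none => simp [pastData, restop, stopT, truncT]
      | some p =>
        have := (h.countingPaths ω).mono p.1 huv
        simp only [pastData, restop, stopT, truncT, stopN, huv, min_eq_left, Function.comp]
        split_ifs with h1 h2
        · rfl
        · exact absurd (h1.trans_le this) h2
        · rfl
  simp only [dataSigma]
  rw [this, ← MeasurableSpace.comap_comp]
  exact MeasurableSpace.comap_mono (measurable_restop u).comap_le

lemma measurableSet_of_forall_lt (h : IsKData P N T) {F : Set Ω} {τ : Ω → ℝ≥0}
    (hF : ∀ u, MeasurableSet[dataSigma N T u] (F ∩ {ω | τ ω < u})) : MeasurableSet F := by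
  have : F = ⋃ k : ℕ, F ∩ {ω | τ ω < k} := by
    ext ω
    simp only [mem_iUnion, mem_inter_iff, mem_ofPred_eq, exists_and_left]
    exact ⟨fun hω => ⟨hω, exists_nat_gt _⟩, fun hω => hω.1⟩
  rw [this]
  exact .iUnion fun k => (h.measurable_pastData k).comap_le _ (hF k)

variable [IsProbabilityMeasure P]

/-- On the piece of `F` where the grid approximation takes a given value, the future data are those
after a fixed index, and the piece belongs to the past at that index. The independence at fixed
indices is then summed over the pieces. -/
lemma measure_inter_futureData_upperGrid (h : IsKData P N T) {F : Set Ω} {τ : Ω → ℝ≥0}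
    (hF : ∀ u, MeasurableSet[dataSigma N T u] (F ∩ {ω | τ ω < u})) (n : ℕ)
    {B : Set (DataIndex → ℝ)} (hB : MeasurableSet B) :
    P (F ∩ futureData N T (upperGrid τ n) ⁻¹' B) = P F * P (fullData N T ⁻¹' B) := by
  let A : ℕ → Set Ω := fun k => F ∩ {ω | ⌊τ ω * (n + 1)⌋₊ = k}
  let u : ℕ → ℝ≥0 := fun k => (k + 1) / (n + 1)
  have hAs : ∀ k, MeasurableSet[dataSigma N T (u k)] (A k) := by
    intro k
    have hle : (k : ℝ≥0) / (n + 1) ≤ u k := by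
      simp only [u]; gcongr; simp
    -- Only events of the form `F ∩ {τ < v}` are known to belong to the past, so the piece is
    -- written as a difference of two of them.
    have : A k = (F ∩ {ω | τ ω < u k}) \ (F ∩ {ω | τ ω < (k : ℝ≥0) / (n + 1)}) := by
      ext ω
      simp only [A, u, mem_inter_iff, mem_ofPred_eq, Set.mem_sdiff, not_and, not_lt]
      rw [Nat.floor_eq_iff zero_le, lt_div_iff₀ (by positivity), div_le_iff₀ (by positivity)]
      tauto
    rw [this]
    exact @MeasurableSet.diff _ (_) _ _ (hF _) (h.dataSigma_mono hle _ (hF _))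
  have hAm : ∀ k, MeasurableSet (A k) := fun k => (h.measurable_pastData _).comap_le _ (hAs k)
  have hAd : Pairwise (Function.onFun Disjoint A) := by
    intro k l hkl
    refine Set.disjoint_left.2 ?_
    rintro ω ⟨-, hk⟩ ⟨-, hl⟩
    exact hkl (hk.symm.trans hl)
  have hAu : F = ⋃ k, A k := by
    ext ω; simp [A]
  have hfm : ∀ k, Measurable (futureData N T fun _ => u k) :=
    fun k => h.measurable_futureData measurable_const
  have hind : ∀ k, P (A k ∩ (futureData N T fun _ => u k) ⁻¹' B) =
      P (A k) * P (fullData N T ⁻¹' B) := by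
    intro k
    obtain ⟨S, hS, hSA⟩ := hAs k
    rw [← hSA, (h.indepFun_past_future (u k)).measure_inter_preimage_eq_mul _ _ hS hB]
    congr 1
    rw [← Measure.map_apply (hfm k) hB, h.map_futureData,
      Measure.map_apply h.measurable_fullData hB]
  have hsplit : F ∩ futureData N T (upperGrid τ n) ⁻¹' B =
      ⋃ k, A k ∩ (futureData N T fun _ => u k) ⁻¹' B := by
    ext ω
    have hu : ∀ k, ⌊τ ω * (n + 1)⌋₊ = k →
        futureData N T (upperGrid τ n) ω = futureData N T (fun _ => u k) ω := by
      rintro k rfl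
      simp [futureData, upperGrid, shiftN, u]
    simp only [mem_inter_iff, mem_preimage, mem_iUnion, A, mem_ofPred_eq]
    constructor
    · rintro ⟨hω, hB⟩
      exact ⟨_, ⟨hω, rfl⟩, (hu _ rfl) ▸ hB⟩
    · rintro ⟨k, ⟨hω, hk⟩, hB⟩
      exact ⟨hω, (hu k hk) ▸ hB⟩
  rw [hsplit, measure_iUnion]
  · simp_rw [hind]
    rw [ENNReal.tsum_mul_right]
    congr 1
    conv_rhs => rw [hAu]
    rw [measure_iUnion hAd hAm]
  · exact fun k l hkl => (hAd hkl).mono inter_subset_left inter_subset_left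
  · exact fun k => (hAm k).inter (hfm k hB)

lemma measurable_upperGrid {τ : Ω → ℝ≥0} (hτ : Measurable τ) (n : ℕ) :
    Measurable (upperGrid τ n) := by
  unfold upperGrid
  have h1 : Measurable fun ω => ⌊τ ω * ((n : ℝ≥0) + 1)⌋₊ :=
    Nat.measurable_floor.comp (hτ.mul_const _)
  exact (((measurable_of_countable (fun n : ℕ => (n : ℝ≥0))).comp h1).add_const _).div_const _

/-- The strong Markov property of the data. -/
theorem measure_inter_futureData (h : IsKData P N T) {F : Set Ω} {τ : Ω → ℝ≥0}
    (hτ : Measurable τ) (hF : ∀ u, MeasurableSet[dataSigma N T u] (F ∩ {ω | τ ω < u}))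
    {B : Set (DataIndex → ℝ)} (hB : MeasurableSet B) :
    P (F ∩ futureData N T τ ⁻¹' B) = P F * P (fullData N T ⁻¹' B) := by
  have hFm := h.measurableSet_of_forall_lt hF
  have hfut := h.measurable_futureData hτ
  have hfull := h.measurable_fullData
  -- Both sides are finite measures, so cylinders suffice. A cylinder looks at finitely many
  -- coordinates, hence its indicator along the grid approximations is eventually constant and the
  -- identity passes to the limit.
  have key : (P.restrict F).map (futureData N T τ) = P F • P.map (fullData N T) := by
    refine ext_of_generate_finite _ generateFrom_measurableCylinders.symm
      isPiSystem_measurableCylinders ?_ ?_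
    · intro B hB
      have hBm := MeasurableSet.of_mem_measurableCylinders hB
      obtain ⟨s, S, hS, rfl⟩ := (mem_measurableCylinders B).1 hB
      rw [Measure.map_apply hfut hBm, Measure.restrict_apply (hfut hBm), inter_comm,
        Measure.smul_apply, Measure.map_apply hfull hBm, smul_eq_mul]
      have hlim : Tendsto (fun n => P (F ∩ futureData N T (upperGrid τ n) ⁻¹' cylinder s S)) atTop
          (𝓝 (P (F ∩ futureData N T τ ⁻¹' cylinder s S))) := by
        refine tendsto_measure_of_ae_tendsto_indicator_of_isFiniteMeasure _
          (hFm.inter (hfut hBm))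
          (fun n => hFm.inter (h.measurable_futureData (measurable_upperGrid hτ n) hBm)) ?_
        refine ae_of_all _ fun ω => ?_
        have := (eventually_all_finset s).2
          fun i _ => (h.countingPaths ω).eventually_futureData_eq (T := T) τ i
        filter_upwards [this] with n hn
        have : s.restrict (futureData N T (upperGrid τ n) ω) =
            s.restrict (futureData N T τ ω) := funext fun i => hn i i.2
        simp only [mem_inter_iff, mem_preimage, mem_cylinder, this]
      refine tendsto_nhds_unique hlim (tendsto_const_nhds.congr fun n => ?_)
      exact (h.measure_inter_futureData_upperGrid hF n hBm).symm
    · rw [Measure.map_apply hfut .univ, Measure.smul_apply, Measure.map_apply hfull .univ]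
      simp
  have := congrArg (fun μ => μ B) key
  simp only [Measure.map_apply hfut hB, Measure.smul_apply, Measure.map_apply hfull hB,
    smul_eq_mul, Measure.restrict_apply (hfut hB)] at this
  rwa [inter_comm] at this

end IsKData

end

/-! ### The exponential law -/

lemma expMeasure_one_Iic (x : ℝ) :
    expMeasure 1 (Iic x) = ENNReal.ofReal (if 0 ≤ x then 1 - Real.exp (-x) else 0) := by
  have := isProbabilityMeasure_expMeasure zero_lt_one
  rw [← ofReal_cdf, cdf_expMeasure_eq zero_lt_one]
  simp

lemma expMeasure_one_Ioi {x : ℝ} (hx : 0 ≤ x) :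
    expMeasure 1 (Ioi x) = ENNReal.ofReal (Real.exp (-x)) := by
  have := isProbabilityMeasure_expMeasure zero_lt_one
  rw [← compl_Iic, prob_compl_eq_one_sub measurableSet_Iic, expMeasure_one_Iic, if_pos hx,
    ← ENNReal.ofReal_one, ← ENNReal.ofReal_sub _ (by simpa using hx)]
  simp

/-- The exponential law has no memory. -/
lemma expMeasure_memoryless {v : ℝ} (hv : 0 ≤ v) {B : Set ℝ} (hB : MeasurableSet B) :
    expMeasure 1 {t | v < t ∧ t - v ∈ B} = expMeasure 1 (Ioi v) * expMeasure 1 B := by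
  have := isProbabilityMeasure_expMeasure zero_lt_one
  have hm : Measurable fun t : ℝ => t - v := measurable_id.sub_const v
  have key : ((expMeasure 1).restrict (Ioi v)).map (fun t => t - v) =
      expMeasure 1 (Ioi v) • expMeasure 1 := by
    refine Measure.ext_of_Iic _ _ fun a => ?_
    rw [Measure.map_apply hm measurableSet_Iic, Measure.restrict_apply (hm measurableSet_Iic),
      Measure.smul_apply, expMeasure_one_Iic, expMeasure_one_Ioi hv, smul_eq_mul]
    have hset : (fun t : ℝ => t - v) ⁻¹' Iic a ∩ Ioi v = Iic (v + a) \ Iic v := by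
      ext t; simp [and_comm, add_comm]
    rw [hset]
    split_ifs with ha
    · rw [measure_sdiff (Iic_subset_Iic.2 (by linarith)) measurableSet_Iic.nullMeasurableSet
        (measure_ne_top _ _), expMeasure_one_Iic, expMeasure_one_Iic, if_pos hv,
        if_pos (by linarith), ← ENNReal.ofReal_sub _ (by simpa using hv),
        ← ENNReal.ofReal_mul (Real.exp_nonneg _)]
      congr 1
      rw [neg_add, Real.exp_add]
      ring
    · rw [Set.sdiff_eq_empty.2 (Iic_subset_Iic.2 (by linarith))]
      simp
  have := congrArg (fun μ => μ B) key
  simp only [Measure.map_apply hm hB, Measure.restrict_apply (hm hB), Measure.smul_apply,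
    smul_eq_mul] at this
  rw [← this]
  congr 1
  ext t
  simp [and_comm]

lemma lintegral_ofReal_expMeasure_ne_top : ∫⁻ t, ENNReal.ofReal t ∂expMeasure 1 ≠ ∞ := by
  -- `t` is at most the number of naturals below it, which bounds the mean by the geometric series
  -- of the tails.
  have hle : ∀ t : ℝ, ENNReal.ofReal t ≤ ∑' n : ℕ, (Ioi (n : ℝ)).indicator 1 t := by
    intro t
    calc ENNReal.ofReal t ≤ ENNReal.ofReal ⌈t⌉₊ := ENNReal.ofReal_le_ofReal (Nat.le_ceil t)
      _ = ∑ n ∈ Finset.range ⌈t⌉₊, (1 : ℝ≥0∞) := by simp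
      _ = ∑ n ∈ Finset.range ⌈t⌉₊, (Ioi (n : ℝ)).indicator (1 : ℝ → ℝ≥0∞) t := by
        refine Finset.sum_congr rfl fun n hn => ?_
        rw [indicator_of_mem]
        · rfl
        · exact Nat.lt_ceil.1 (Finset.mem_range.1 hn)
      _ ≤ _ := ENNReal.sum_le_tsum _
  refine ne_top_of_le_ne_top ?_ (lintegral_mono hle)
  rw [lintegral_tsum fun n => (measurable_one.indicator measurableSet_Ioi).aemeasurable]
  simp_rw [lintegral_indicator_one measurableSet_Ioi, expMeasure_one_Ioi (Nat.cast_nonneg _)]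
  exact Real.summable_exp_neg_nat.tsum_ofReal_ne_top

/-! ### The Poisson law -/

lemma lintegral_natCast_poissonMeasure_ne_top (r : ℝ≥0) :
    ∫⁻ n, (n : ℝ≥0∞) ∂poissonMeasure r ≠ ∞ := by
  have h : Integrable (fun n : ℕ => (n : ℝ)) (poissonMeasure r) := by
    rw [integrable_poissonMeasure_iff, ← summable_nat_add_iff 1]
    refine ((Real.summable_pow_div_factorial r).mul_left (Real.exp (-r) * r)).congr fun n => ?_
    rw [Nat.factorial_succ]
    push_cast
    rw [Real.norm_of_nonneg (by positivity)]
    field_simp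
    ring
  have := h.2.ne
  simpa [HasFiniteIntegral, enorm_eq_nnnorm] using this

lemma poissonMeasure_Ici_one_pos {r : ℝ≥0} (hr : 0 < r) : poissonMeasure r (Ici 1) ≠ 0 := by
  have h1 : 0 < (poissonMeasure r).real {1} := poissonMeasure_real_singleton_pos 1 hr
  intro h0
  have : poissonMeasure r {1} = 0 := measure_mono_null (by simp) h0
  simp [measureReal_def, this] at h1

lemma poissonMeasure_Ici_one_le (r : ℝ≥0) : poissonMeasure r (Ici 1) ≤ ENNReal.ofReal r := by
  have h : (Ici 1 : Set ℕ) = {0}ᶜ := by ext n; simp; omega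
  rw [h, ← ofReal_measureReal, probReal_compl_eq_one_sub (measurableSet_singleton _),
    poissonMeasure_real_singleton]
  refine ENNReal.ofReal_le_ofReal ?_
  have := Real.add_one_le_exp (-(r : ℝ))
  simp
  linarith

/-- The probability is `1 - (1 + r) exp (-r)`, and `exp (-r) ≥ 1 - r` turns this into at most `1 -
(1 + r) (1 - r) = r ^ 2`. -/
lemma poissonMeasure_Ici_two_le (r : ℝ≥0) :
    poissonMeasure r (Ici 2) ≤ ENNReal.ofReal ((r : ℝ) ^ 2) := by
  have h : (Ici 2 : Set ℕ) = ({0} ∪ {1})ᶜ := by ext n; simp; omega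
  rw [h, ← ofReal_measureReal, probReal_compl_eq_one_sub (by measurability),
    measureReal_union (by simp) (by measurability),
    poissonMeasure_real_singleton, poissonMeasure_real_singleton]
  refine ENNReal.ofReal_le_ofReal ?_
  have h1 := Real.add_one_le_exp (-(r : ℝ))
  have h2 : (0 : ℝ) ≤ r := r.2
  simp
  nlinarith

/-! ### Almost sure properties of the data and of the clock -/

section

variable {Ω : Type*} [mΩ : MeasurableSpace Ω] {P : Measure Ω}

/-- Second Borel–Cantelli lemma: the probabilities are a nonzero constant, so their sum is infinite.
-/
lemma ae_frequently_mem_of_iIndepFun {β : Type*} [MeasurableSpace β]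
    {f : ℕ → Ω → β} (hf : iIndepFun f P) (hm : ∀ n, Measurable (f n)) {A : Set β}
    (hA : MeasurableSet A) {p : ℝ≥0∞} (hp : p ≠ 0) (hfA : ∀ n, P (f n ⁻¹' A) = p) :
    ∀ᵐ ω ∂P, ∃ᶠ n in atTop, f n ω ∈ A := by
  have := hf.isProbabilityMeasure
  have hms : ∀ n, MeasurableSet (f n ⁻¹' A) := fun n => hm n hA
  have hind : iIndepSet (fun n => f n ⁻¹' A) P := by
    rw [iIndepSet_iff_meas_biInter hms]
    intro s
    exact hf.measure_inter_preimage_eq_mul s (sets := fun _ => A) fun _ _ => hA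
  have h1 := measure_limsup_eq_one hms hind (by simp_rw [hfA]; exact ENNReal.tsum_const_eq_top_of_ne_zero hp)
  have h2 : ∀ᵐ ω ∂P, ω ∈ limsup (fun n => f n ⁻¹' A) atTop := by
    rw [← prob_compl_eq_zero_iff (MeasurableSet.measurableSet_limsup hms)] at h1
    exact h1
  filter_upwards [h2] with ω hω
  simpa [mem_limsup_iff_frequently_mem] using hω

/-- A failure in `(0, M]` falls in one of `M (n + 1)` cells of length `1 / (n + 1)`, each of
probability at most `1 / (n + 1) ^ 2`. The union bound is `M / (n + 1)`, and `n` is arbitrary. -/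
lemma ae_forall_pos_of_grid {Q : Ω → ℝ≥0 → Prop} {A : ℕ → ℕ → Set Ω}
    (hA : ∀ n k, P (A n k) ≤ ENNReal.ofReal ((1 / ((n : ℝ) + 1)) ^ 2))
    (hQ : ∀ (ω : Ω) (n k : ℕ) (u : ℝ≥0), (k : ℝ≥0) / (n + 1) < u → u ≤ (k + 1 : ℝ≥0) / (n + 1) →
      ¬ Q ω u → ω ∈ A n k) : ∀ᵐ ω ∂P, ∀ u, 0 < u → Q ω u := by
  have key : ∀ M : ℕ, P {ω | ∃ u : ℝ≥0, 0 < u ∧ u ≤ (M : ℝ≥0) ∧ ¬ Q ω u} = 0 := by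
    intro M
    have hbound : ∀ n : ℕ, P {ω | ∃ u : ℝ≥0, 0 < u ∧ u ≤ (M : ℝ≥0) ∧ ¬ Q ω u} ≤
        ENNReal.ofReal (M * (1 / ((n : ℝ) + 1))) := by
      intro n
      have hsub : {ω | ∃ u : ℝ≥0, 0 < u ∧ u ≤ (M : ℝ≥0) ∧ ¬ Q ω u} ⊆
          ⋃ k ∈ Finset.range (M * (n + 1)), A n k := by
        rintro ω ⟨u, hu, huM, hq⟩
        have hpos : 0 < ⌈u * (n + 1)⌉₊ := Nat.ceil_pos.2 (by positivity)
        obtain ⟨k, hk⟩ := Nat.exists_eq_add_of_lt hpos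
        rw [zero_add] at hk
        have hlt : (k : ℝ≥0) < u * (n + 1) := Nat.lt_ceil.1 (by omega)
        have hle : u * (n + 1) ≤ (k + 1 : ℝ≥0) := by
          have := Nat.le_ceil (u * ((n : ℝ≥0) + 1))
          rw [hk] at this
          exact_mod_cast this
        simp only [mem_iUnion, Finset.mem_range]
        refine ⟨k, ?_, hQ ω n k u ?_ ?_ hq⟩
        · have : (k : ℝ≥0) < M * (n + 1) := hlt.trans_le (by gcongr)
          exact_mod_cast this
        · rwa [div_lt_iff₀ (by positivity)]
        · rwa [le_div_iff₀ (by positivity)]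
      refine (measure_mono hsub).trans ((measure_biUnion_finset_le _ _).trans ?_)
      refine (Finset.sum_le_sum fun k _ => hA n k).trans ?_
      rw [Finset.sum_const, Finset.card_range, nsmul_eq_mul, ← ENNReal.ofReal_natCast,
        ← ENNReal.ofReal_mul (by positivity)]
      refine ENNReal.ofReal_le_ofReal (le_of_eq ?_)
      push_cast
      field_simp
    have hlim : Tendsto (fun n : ℕ => ENNReal.ofReal (M * (1 / ((n : ℝ) + 1)))) atTop (𝓝 0) := by
      have := (tendsto_one_div_add_atTop_nhds_zero_nat (𝕜 := ℝ)).const_mul (M : ℝ)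
      simpa using ENNReal.tendsto_ofReal this
    exact le_antisymm (ge_of_tendsto' hlim hbound) zero_le
  have h2 : ∀ᵐ ω ∂P, ∀ M : ℕ, ¬ ∃ u : ℝ≥0, 0 < u ∧ u ≤ (M : ℝ≥0) ∧ ¬ Q ω u := by
    rw [ae_all_iff]
    intro M
    rw [ae_iff]
    simpa using key M
  filter_upwards [h2] with ω hω u hu
  obtain ⟨M, hM⟩ := exists_nat_ge u
  by_contra hq
  exact hω M ⟨u, hu, hM, hq⟩

variable {N : ℕ+ → ℝ≥0 → Ω → ℕ} {T : Option (ℕ+ × ℕ) → Ω → ℝ} {γ : ℕ+ → ℝ} {c : ℝ≥0} {y : KState}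

lemma IsPoissonProcess.measure_increment {X : ℝ≥0 → Ω → ℕ} (h : IsPoissonProcess X 1 P)
    {s t : ℝ≥0} (hst : s ≤ t) (A : Set ℕ) :
    P {ω | X t ω - X s ω ∈ A} = poissonMeasure (t - s) A := by
  have h1 := (h.law s t hst).map_eq
  rw [one_mul] at h1
  rw [← h1, Measure.map_apply (h.measurable_increment s t) (Set.to_countable A).measurableSet]
  rfl

namespace IsKData

lemma ae_exp_pos (h : IsKData P N T) : ∀ᵐ ω ∂P, ∀ a, 0 < T a ω := by
  rw [ae_all_iff]
  intro a
  refine ((h.exp a).ae_iff (p := fun t => 0 < t) measurableSet_Ioi.mem).2 ?_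
  rw [ae_iff]
  have : {t : ℝ | ¬ 0 < t} = Iic 0 := by ext t; simp
  rw [this, expMeasure_one_Iic]
  simp

/-- Almost surely, all jumps are of unit size and no two paths jump at once. -/
lemma ae_simpleJumps (h : IsKData P N T) : ∀ᵐ ω ∂P, SimpleJumps N ω := by
  have hstep : ∀ n k : ℕ, (k : ℝ≥0) / ((n : ℝ≥0) + 1) ≤ (k + 1) / (n + 1) := fun n k => by
    gcongr; simp
  have hsub : ∀ n k : ℕ, ((k + 1 : ℝ≥0) / ((n : ℝ≥0) + 1) - k / (n + 1)) = 1 / (n + 1) := by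
    intro n k
    rw [add_div]; simp
  have h1 : ∀ x, ∀ᵐ ω ∂P, ∀ u, 0 < u → ∃ v < u, N x u ω ≤ N x v ω + 1 := by
    intro x
    refine ae_forall_pos_of_grid (A := fun n k => {ω | N x ((k + 1) / (n + 1)) ω -
      N x (k / (n + 1)) ω ∈ Ici 2}) (fun n k => ?_) fun ω n k u hlt hle hq => ?_
    · rw [(h.poisson x).measure_increment (hstep n k), hsub]
      refine (poissonMeasure_Ici_two_le _).trans (le_of_eq ?_)
      push_cast; rfl
    · push Not at hq
      have h1 := hq _ hlt
      have h2 := (h.poisson x).mono ω hle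
      simp only [mem_ofPred_eq, mem_Ici] at h2 ⊢
      omega
  have h2 : ∀ x x', x ≠ x' → ∀ᵐ ω ∂P, ∀ u, 0 < u →
      ∃ v < u, N x v ω = N x u ω ∨ N x' v ω = N x' u ω := by
    intro x x' hne
    refine ae_forall_pos_of_grid (A := fun n k => {ω | N x ((k + 1) / (n + 1)) ω -
      N x (k / (n + 1)) ω ∈ Ici 1} ∩ {ω | N x' ((k + 1) / (n + 1)) ω -
      N x' (k / (n + 1)) ω ∈ Ici 1}) (fun n k => ?_) fun ω n k u hlt hle hq => ?_
    · have hind := (h.indep_poisson.indepFun hne).comp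
        (φ := fun n' : ℝ≥0 → ℕ => n' ((k + 1) / (n + 1)) - n' (k / (n + 1)))
        (ψ := fun n' : ℝ≥0 → ℕ => n' ((k + 1) / (n + 1)) - n' (k / (n + 1)))
        (by fun_prop) (by fun_prop)
      have := hind.measure_inter_preimage_eq_mul (Ici 1) (Ici 1) measurableSet_Ici measurableSet_Ici
      refine this.trans_le ?_
      have e : ∀ x, P {ω | N x ((k + 1) / (n + 1)) ω - N x (k / (n + 1)) ω ∈ Ici 1} ≤
          ENNReal.ofReal (1 / ((n : ℝ) + 1)) := by
        intro x
        rw [(h.poisson x).measure_increment (hstep n k), hsub]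
        refine (poissonMeasure_Ici_one_le _).trans (le_of_eq ?_)
        push_cast; rfl
      refine (mul_le_mul' (e x) (e x')).trans (le_of_eq ?_)
      rw [← ENNReal.ofReal_mul (by positivity), sq]
    · push Not at hq
      have h1 := hq _ hlt
      have h2 := (h.poisson x).mono ω hle
      have h3 := (h.poisson x').mono ω hle
      have h4 := (h.poisson x).mono ω hlt.le
      have h5 := (h.poisson x').mono ω hlt.le
      simp only [mem_ofPred_eq, mem_Ici, mem_inter_iff] at h2 h3 h4 h5 ⊢
      omega
  have h1' := ae_all_iff.2 h1
  have h2' := ae_all_iff.2 fun x => ae_all_iff.2 fun x' => eventually_imp_distrib_left.2 (h2 x x')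
  filter_upwards [h1', h2'] with ω hω1 hω2
  exact ⟨hω1, hω2⟩

/-- By independence, the mean contribution of a site up to `u` is `γ x` times the mean number of
events and the mean of an exponential variable, so summability of `γ` gives a finite mean for the
series. Integer times suffice, by monotonicity. -/
lemma ae_kClock_ne_top (h : IsKData P N T) (hsum : Summable γ) :
    ∀ᵐ ω ∂P, ∀ y u, kClock γ c N T y ω u ≠ ∞ := by
  let m₁ := ∫⁻ t, ENNReal.ofReal t ∂expMeasure 1
  let m₂ : ℝ≥0 → ℝ≥0∞ := fun u => ∫⁻ n, (n : ℝ≥0∞) ∂poissonMeasure u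
  have hmean : ∀ x (u : ℝ≥0), ∫⁻ ω, siteClock γ N T x ω u ∂P = ENNReal.ofReal (γ x) * (m₂ u * m₁) := by
    intro x u
    have hNi : ∀ i, Measurable fun ω => (Ioi i).indicator (1 : ℕ → ℝ≥0∞) (N x u ω) := fun i =>
      (measurable_of_countable ((Ioi i).indicator (1 : ℕ → ℝ≥0∞))).comp (h.measurable_N x u)
    have hTi : ∀ i, Measurable fun ω => ENNReal.ofReal (T (some (x, i)) ω) :=
      fun i => (h.measurable_exp _).ennreal_ofReal
    -- The random number of terms is moved into indicators, so that each term becomes a product of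
    -- independent factors.
    have hsum : ∀ ω, ∑ i ∈ Finset.range (N x u ω), ENNReal.ofReal (T (some (x, i)) ω) =
        ∑' i, (Ioi i).indicator (1 : ℕ → ℝ≥0∞) (N x u ω) * ENNReal.ofReal (T (some (x, i)) ω) := by
      intro ω
      rw [tsum_eq_sum (s := Finset.range (N x u ω))]
      · refine Finset.sum_congr rfl fun i hi => ?_
        rw [indicator_of_mem (show N x u ω ∈ Ioi i from Finset.mem_range.1 hi)]
        simp
      · intro i hi
        rw [indicator_of_notMem (show N x u ω ∉ Ioi i from fun h' => hi (Finset.mem_range.2 h'))]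
        simp
    have hprod : ∀ i, ∫⁻ ω, (Ioi i).indicator (1 : ℕ → ℝ≥0∞) (N x u ω) *
        ENNReal.ofReal (T (some (x, i)) ω) ∂P =
        (∫⁻ ω, (Ioi i).indicator (1 : ℕ → ℝ≥0∞) (N x u ω) ∂P) * m₁ := by
      intro i
      have hind := h.indep.comp
        (φ := fun n : ℕ+ → ℝ≥0 → ℕ => (Ioi i).indicator (1 : ℕ → ℝ≥0∞) (n x u))
        (ψ := fun t : Option (ℕ+ × ℕ) → ℝ => ENNReal.ofReal (t (some (x, i))))
        ((measurable_of_countable ((Ioi i).indicator (1 : ℕ → ℝ≥0∞))).comp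
          (by fun_prop : Measurable fun n : ℕ+ → ℝ≥0 → ℕ => n x u)) (by fun_prop)
      refine (lintegral_mul_eq_lintegral_mul_lintegral_of_indepFun (hNi i) (hTi i) hind).trans ?_
      congr 1
      exact (h.exp (some (x, i))).lintegral_comp (by fun_prop)
    simp only [siteClock]
    rw [lintegral_const_mul _ (by simp_rw [hsum]; exact Measurable.tsum fun i => (hNi i).mul (hTi i))]
    simp_rw [hsum]
    rw [lintegral_tsum (f := fun i ω => (Ioi i).indicator (1 : ℕ → ℝ≥0∞) (N x u ω) *
      ENNReal.ofReal (T (some (x, i)) ω)) fun i => ((hNi i).mul (hTi i)).aemeasurable]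
    simp_rw [hprod]
    rw [ENNReal.tsum_mul_right, ← lintegral_tsum fun i => (hNi i).aemeasurable]
    congr 2
    have hcard : ∀ n : ℕ, ∑' i, (Ioi i).indicator (1 : ℕ → ℝ≥0∞) n = n := by
      intro n
      rw [tsum_eq_sum (s := Finset.range n)]
      · rw [Finset.sum_congr rfl fun i hi => indicator_of_mem (show n ∈ Ioi i from
          Finset.mem_range.1 hi) _]
        simp
      · intro i hi
        exact indicator_of_notMem (show n ∉ Ioi i from fun h' => hi (Finset.mem_range.2 h')) _
    simp_rw [hcard]
    have hl : HasLaw (N x u) (poissonMeasure u) P := by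
      have := (h.poisson x).law 0 u zero_le
      simpa [(h.poisson x).zero] using this
    exact hl.lintegral_comp (f := fun n => (n : ℝ≥0∞)) (measurable_of_countable _).aemeasurable
  have hfin : ∀ u : ℝ≥0, ∀ᵐ ω ∂P, ∑' x, siteClock γ N T x ω u ≠ ∞ := by
    intro u
    have hm : ∀ x, Measurable fun ω => siteClock γ N T x ω u := fun x =>
      measurable_const.mul (Measurable.apply_nat
        (f := fun k ω => ∑ i ∈ Finset.range k, ENNReal.ofReal (T (some (x, i)) ω))
        (fun k => Finset.measurable_sum _ fun i _ => (h.measurable_exp _).ennreal_ofReal)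
        (h.measurable_N x u))
    have hint : ∫⁻ ω, ∑' x, siteClock γ N T x ω u ∂P ≠ ∞ := by
      rw [lintegral_tsum fun x => (hm x).aemeasurable]
      simp_rw [hmean]
      rw [ENNReal.tsum_mul_right]
      exact ENNReal.mul_ne_top hsum.tsum_ofReal_ne_top (ENNReal.mul_ne_top
        (lintegral_natCast_poissonMeasure_ne_top u) lintegral_ofReal_expMeasure_ne_top)
    filter_upwards [ae_lt_top (Measurable.tsum hm) hint] with ω hω using hω.ne
  filter_upwards [ae_all_iff.2 fun k : ℕ => hfin k] with ω hω y u
  obtain ⟨k, hk⟩ := exists_nat_ge u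
  refine ne_top_of_le_ne_top ?_ (kClock_mono (h.countingPaths ω).mono hk)
  rw [kClock_eq]
  exact ENNReal.add_ne_top.2 ⟨ENNReal.add_ne_top.2 ⟨ENNReal.ofReal_ne_top, hω k⟩,
    ENNReal.mul_ne_top ENNReal.coe_ne_top ENNReal.coe_ne_top⟩

/-- One site is enough: it has infinitely many events, and infinitely many of its exponential
variables exceed `1`. -/
lemma ae_kClock_unbounded (h : IsKData P N T) (hγ : ∀ x, 0 < γ x) :
    ∀ᵐ ω ∂P, ∀ y (M : ℝ≥0), ∃ u, (M : ℝ≥0∞) < kClock γ c N T y ω u := by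
  have hNfreq : ∀ᵐ ω ∂P, ∃ᶠ n : ℕ in atTop, N 1 ((n + 1 : ℕ) : ℝ≥0) ω - N 1 (n : ℝ≥0) ω ∈ Ici 1 := by
    refine ae_frequently_mem_of_iIndepFun
      ((h.poisson 1).indepIncrements.nat (t := fun n : ℕ => (n : ℝ≥0)) Nat.mono_cast)
      (fun n => (h.poisson 1).measurable_increment _ _) measurableSet_Ici
      (poissonMeasure_Ici_one_pos zero_lt_one) fun n => ?_
    have := (h.poisson 1).measure_increment (s := (n : ℝ≥0)) (t := ((n + 1 : ℕ) : ℝ≥0))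
      (by simp) (Ici 1)
    refine this.trans ?_
    congr 2
    simp
  have hTfreq : ∀ᵐ ω ∂P, ∃ᶠ n : ℕ in atTop, T (some (1, n)) ω ∈ Ioi 1 := by
    refine ae_frequently_mem_of_iIndepFun (p := expMeasure 1 (Ioi 1))
      (h.indep_exp.precomp (g := fun n : ℕ => some ((1 : ℕ+), n)) ?_)
      (fun n => h.measurable_exp _) measurableSet_Ioi ?_ fun n => ?_
    · intro n m hnm
      exact congrArg Prod.snd (Option.some_injective _ hnm)
    · rw [expMeasure_one_Ioi zero_le_one]
      simp [Real.exp_pos]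
    · rw [← (h.exp (some (1, n))).map_eq, Measure.map_apply (h.measurable_exp _) measurableSet_Ioi]
  filter_upwards [hNfreq, hTfreq] with ω hN hT y M
  have hNub : ∀ j, ∃ n : ℕ, j ≤ N 1 n ω := by
    intro j
    induction j with
    | zero => exact ⟨0, Nat.zero_le _⟩
    | succ j ih =>
      obtain ⟨n, hn⟩ := ih
      obtain ⟨k, hk, hk'⟩ := (frequently_atTop.1 hN) n
      have h1 : N 1 n ω ≤ N 1 k ω := (h.poisson 1).mono ω (by exact_mod_cast hk)
      refine ⟨k + 1, ?_⟩
      simp only [mem_Ici] at hk'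
      omega
  have htop : ∑' n, ENNReal.ofReal (T (some (1, n)) ω) = ∞ := by
    by_contra hne
    have hfin := ENNReal.finite_const_le_of_tsum_ne_top hne one_ne_zero
    have hinf := Nat.frequently_atTop_iff_infinite.1 hT
    refine hinf (hfin.subset fun n hn => ?_)
    simp only [mem_ofPred_eq, mem_Ioi] at hn ⊢
    rw [← ENNReal.ofReal_one]
    exact ENNReal.ofReal_le_ofReal hn.le
  have hγ1 : ENNReal.ofReal (γ 1) ≠ 0 := by simpa using hγ 1
  have hlt : (M : ℝ≥0∞) / ENNReal.ofReal (γ 1) < ∑' n, ENNReal.ofReal (T (some (1, n)) ω) := by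
    rw [htop]
    exact ENNReal.div_lt_top ENNReal.coe_ne_top hγ1
  rw [ENNReal.tsum_eq_iSup_nat, lt_iSup_iff] at hlt
  obtain ⟨j, hj⟩ := hlt
  obtain ⟨n, hn⟩ := hNub j
  refine ⟨n, lt_of_lt_of_le ?_ (siteClock_le_kClock 1 _)⟩
  rw [ENNReal.div_lt_iff (Or.inl hγ1) (Or.inl ENNReal.ofReal_ne_top), mul_comm] at hj
  refine hj.trans_le ?_
  unfold siteClock
  gcongr

/-- On an interval `[0, 1 / (k + 1)]` each site has an event with the same positive probability, so
by independence some site has one. This is what makes the process started at `∞` be at `∞` at time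
`0`, even when `c = 0`. -/
lemma ae_kClock_pos (h : IsKData P N T) (hγ : ∀ x, 0 < γ x) :
    ∀ᵐ ω ∂P, ∀ y u, 0 < u → 0 < kClock γ c N T y ω u := by
  have hfreq : ∀ k : ℕ, ∀ᵐ ω ∂P, ∃ᶠ n : ℕ in atTop,
      N n.succPNat (1 / ((k : ℝ≥0) + 1)) ω ∈ Ici 1 := by
    intro k
    have hinj : Function.Injective Nat.succPNat := Nat.succPNat_injective
    have hind := (h.indep_poisson.precomp hinj).comp
      (fun _ (n : ℝ≥0 → ℕ) => n (1 / ((k : ℝ≥0) + 1))) (fun _ => measurable_pi_apply _)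
    refine ae_frequently_mem_of_iIndepFun hind (fun n => h.measurable_N _ _) measurableSet_Ici
      (poissonMeasure_Ici_one_pos (r := 1 / ((k : ℝ≥0) + 1)) (by positivity)) fun n => ?_
    have := (h.poisson n.succPNat).measure_increment (s := 0) (t := 1 / ((k : ℝ≥0) + 1))
      zero_le (Ici 1)
    simp only [(h.poisson n.succPNat).zero, tsub_zero] at this
    exact this
  filter_upwards [ae_all_iff.2 hfreq, h.ae_exp_pos] with ω hω hT y u hu
  obtain ⟨k, hk⟩ := exists_nat_gt (1 / u)
  have hku : 1 / ((k : ℝ≥0) + 1) ≤ u := by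
    rw [div_lt_iff₀ hu] at hk
    rw [div_le_iff₀ (by positivity), mul_comm]
    exact hk.le.trans (by gcongr; simp)
  obtain ⟨n, hn⟩ := (hω k).exists
  refine lt_of_lt_of_le ?_ ((siteClock_le_kClock n.succPNat _).trans
    (kClock_mono (h.countingPaths ω).mono hku))
  unfold siteClock
  refine ENNReal.mul_pos (by simpa using hγ _) (ne_of_gt ?_)
  refine lt_of_lt_of_le (ENNReal.ofReal_pos.2 (hT (some (n.succPNat, 0)))) ?_
  exact Finset.single_le_sum (f := fun i => ENNReal.ofReal (T (some (n.succPNat, i)) ω))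
    (fun _ _ => zero_le) (Finset.mem_range.2 hn)

end IsKData

end

/-! ### Residual lives and the restart principle -/

section

variable {Ω : Type*} [mΩ : MeasurableSpace Ω] {P : Measure Ω}

/-- The residual life of an exponential variable beyond an independent age is again exponential,
and independent of the events that do not involve this variable. -/
lemma measure_residual {α : Type*} [MeasurableSpace α] [IsProbabilityMeasure P] {q : Ω → α}
    (hq : Measurable q) {S : Ω → ℝ} (hS : Measurable S) (hlaw : P.map S = expMeasure 1)
    (hind : IndepFun S q P) {C : Set α} (hC : MeasurableSet C) {V : α → ℝ} (hV : Measurable V)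
    (hV0 : ∀ a ∈ C, 0 ≤ V a) {B : Set ℝ} (hB : MeasurableSet B) :
    P {ω | q ω ∈ C ∧ V (q ω) < S ω ∧ S ω - V (q ω) ∈ B} =
      P {ω | q ω ∈ C ∧ V (q ω) < S ω} * expMeasure 1 B := by
  have := isProbabilityMeasure_expMeasure zero_lt_one
  have hqm : IsProbabilityMeasure (P.map q) := Measure.isProbabilityMeasure_map hq.aemeasurable
  have hprod := (indepFun_iff_map_prod_eq_prod_map_map hq.aemeasurable hS.aemeasurable).1 hind.symm
  rw [hlaw] at hprod
  -- For a frozen value of `q` the age is a constant and `expMeasure_memoryless` applies; Fubini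
  -- integrates this.
  have key : ∀ B : Set ℝ, MeasurableSet B →
      P {ω | q ω ∈ C ∧ V (q ω) < S ω ∧ S ω - V (q ω) ∈ B} =
        (∫⁻ a in C, expMeasure 1 (Ioi (V a)) ∂P.map q) * expMeasure 1 B := by
    intro B hB
    have hVm : Measurable fun r : α × ℝ => V r.1 := hV.comp measurable_fst
    have hD : MeasurableSet {r : α × ℝ | r.1 ∈ C ∧ V r.1 < r.2 ∧ r.2 - V r.1 ∈ B} :=
      (measurable_fst hC).inter ((measurableSet_lt hVm measurable_snd).inter
        ((measurable_snd.sub hVm) hB))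
    have hm : Measurable fun a => expMeasure 1 (Ioi (V a)) :=
      measurable_measure_prodMk_left (measurableSet_lt hVm measurable_snd)
    have e : P {ω | q ω ∈ C ∧ V (q ω) < S ω ∧ S ω - V (q ω) ∈ B} =
        P.map (fun ω => (q ω, S ω)) {r : α × ℝ | r.1 ∈ C ∧ V r.1 < r.2 ∧ r.2 - V r.1 ∈ B} :=
      (Measure.map_apply (hq.prodMk hS) hD).symm
    rw [e, hprod, Measure.prod_apply hD, ← lintegral_mul_const _ hm, ← lintegral_indicator hC]
    refine lintegral_congr fun a => ?_
    by_cases ha : a ∈ C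
    · rw [indicator_of_mem ha, ← expMeasure_memoryless (hV0 a ha) hB]
      simp [preimage, ha]
    · rw [indicator_of_notMem ha]
      simp [preimage, ha]
  have h1 := key univ .univ
  simp only [mem_univ, and_true, measure_univ, mul_one] at h1
  rw [key B hB, h1]

/-- Past events become conditions on the path up to `s`, a form that can be carried over to the
stopped data and to the data with one variable replaced. -/
lemma exists_preimage_of_measurableSet_pastSigma {Ω : Type*} {X : ℝ≥0 → Ω → KState} {s : ℝ≥0}
    {F : Set Ω} (hF : MeasurableSet[pastSigma X s] F) :
    ∃ S : Set (Iic s → KState), MeasurableSet S ∧ F = {ω | (fun r : Iic s => X r ω) ∈ S} := by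
  have hle : pastSigma X s ≤
      MeasurableSpace.comap (fun ω (r : Iic s) => X r ω) inferInstance := by
    refine iSup₂_le fun r hr => ?_
    rw [← measurable_iff_comap_le]
    exact Measurable.comp (g := fun f : Iic s → KState => f ⟨r, hr⟩) (measurable_pi_apply _)
      (comap_measurable _)
  obtain ⟨S, hS, rfl⟩ := hle _ hF
  exact ⟨S, hS, rfl⟩

variable {N : ℕ+ → ℝ≥0 → Ω → ℕ} {T : Option (ℕ+ × ℕ) → Ω → ℝ} {γ : ℕ+ → ℝ} {c : ℝ≥0} {y z : KState}

/-- The σ-algebra of all data but `T a`. -/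
abbrev otherSigma (N : ℕ+ → ℝ≥0 → Ω → ℕ) (T : Option (ℕ+ × ℕ) → Ω → ℝ) (a : Option (ℕ+ × ℕ)) :
    MeasurableSpace Ω :=
  MeasurableSpace.comap
    (fun ω => ((fun x t => N x t ω), fun b : ({a}ᶜ : Set (Option (ℕ+ × ℕ))) => T b ω)) inferInstance

omit mΩ in
lemma measurable_otherSigma_N (a : Option (ℕ+ × ℕ)) (x : ℕ+) (t : ℝ≥0) :
    Measurable[otherSigma N T a] (N x t) :=
  Measurable.comp (g := fun r : (ℕ+ → ℝ≥0 → ℕ) × (({a}ᶜ : Set (Option (ℕ+ × ℕ))) → ℝ) => r.1 x t)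
    (by fun_prop) (comap_measurable _)

omit mΩ in
lemma measurable_otherSigma_T {a b : Option (ℕ+ × ℕ)} (hb : b ≠ a) :
    Measurable[otherSigma N T a] (T b) :=
  Measurable.comp (g := fun r : (ℕ+ → ℝ≥0 → ℕ) × (({a}ᶜ : Set (Option (ℕ+ × ℕ))) → ℝ) =>
    r.2 ⟨b, hb⟩) (by fun_prop) (comap_measurable _)

omit mΩ in
-- During the residual sojourn the restarted process sits at `z` by definition, and `ht` supplies
-- the same for the original one; afterwards the shift lemma applies.
lemma CountingPaths.kProc_shift_eq_canon {ω : Ω} (hN : CountingPaths N ω) {s t : ℝ≥0}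
    {τ : Ω → ℝ≥0} {R : Ω → ℝ}
    (hs : kClock γ c N T y ω (τ ω) = s + ENNReal.ofReal (gammaExt γ z * R ω))
    (ht : (t : ℝ) < gammaExt γ z * R ω → kProc γ c N T y (s + t) ω = z) :
    kProc γ c N T y (s + t) ω =
      kProc γ c canonN canonT z t (R ω, futureData N T τ ω) := by
  by_cases h : (t : ℝ) < gammaExt γ z * R ω
  · rw [ht h]
    exact (kProc_eq_self h).symm
  · rw [hN.kProc_shift hs h, (hN.shift τ).kProc_eq_canon]
    rfl

/-- Started at `∞`, the initial variable only enters multiplied by `γ(∞) = 0`. -/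
lemma kProc_canon_infty (t : ℝ≥0) (r r' : ℝ) (d : DataIndex → ℝ) :
    kProc γ c canonN canonT OnePoint.infty t (r, d) =
      kProc γ c canonN canonT OnePoint.infty t (r', d) := by
  have h3 : kClock γ c canonN canonT OnePoint.infty (r, d) =
      kClock γ c canonN canonT OnePoint.infty (r', d) := by
    ext u
    simp only [kClock, gammaExt, OnePoint.elim_infty, zero_mul]
    rfl
  refine kProc_congr (by simp [gammaExt]) (fun _ => rfl) fun _ x => ?_
  simp only [SitsAt, h3]
  rfl

namespace IsKData

lemma kProc_eq_canon (h : IsKData P N T) (t : ℝ≥0) (ω : Ω) :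
    kProc γ c N T z t ω = kProc γ c canonN canonT z t (T none ω, fullData N T ω) :=
  (h.countingPaths ω).kProc_eq_canon t

lemma otherSigma_le (h : IsKData P N T) (a : Option (ℕ+ × ℕ)) : otherSigma N T a ≤ mΩ :=
  Measurable.comap_le (h.measurable_allN.prodMk (measurable_pi_lambda _ fun b => h.measurable_exp b))

variable [IsProbabilityMeasure P]

lemma indepFun_other (h : IsKData P N T) (a : Option (ℕ+ × ℕ)) :
    IndepFun (T a) (fun ω => ((fun x t => N x t ω),
      fun b : ({a}ᶜ : Set (Option (ℕ+ × ℕ))) => T b ω)) P := by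
  have hT := (iIndepFun.indepFun_subtype h.indep_exp h.measurable_exp (S := ({a}ᶜ : Set _))
    (T := {a}) disjoint_compl_left).comp measurable_id
    (measurable_pi_apply (⟨a, rfl⟩ : ({a} : Set _)))
  have hg : Measurable fun r : (ℕ+ → ℝ≥0 → ℕ) × (Option (ℕ+ × ℕ) → ℝ) =>
      fun b : ({a}ᶜ : Set (Option (ℕ+ × ℕ))) => r.2 b := by fun_prop
  have hh : Measurable fun r : (ℕ+ → ℝ≥0 → ℕ) × (Option (ℕ+ × ℕ) → ℝ) => r.2 a := by fun_prop
  exact (indepFun_of_frozen h.measurable_allN h.measurable_allT h.indep hg hh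
    (ν := P.map (T a)) (fun _ => hT) (fun _ => rfl)).1.symm

/-- The residual life of `T a` beyond an age determined by the other data. -/
lemma measure_residual (h : IsKData P N T) (a : Option (ℕ+ × ℕ)) {C : Set Ω}
    (hC : MeasurableSet[otherSigma N T a] C) {V : Ω → ℝ} (hV : Measurable[otherSigma N T a] V)
    (hV0 : ∀ ω ∈ C, 0 ≤ V ω) {B : Set ℝ} (hB : MeasurableSet B) :
    P {ω | ω ∈ C ∧ V ω < T a ω ∧ T a ω - V ω ∈ B} =
      P {ω | ω ∈ C ∧ V ω < T a ω} * expMeasure 1 B := by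
  -- The general statement is used with `q` the identity, from `Ω` to `Ω` with the coarser σ-algebra
  -- of the other data.
  have hind : @IndepFun Ω ℝ Ω mΩ _ (otherSigma N T a) (T a) id P := by
    have := (IndepFun_iff_Indep _ _ _).1 (h.indepFun_other a)
    refine (@IndepFun_iff_Indep Ω ℝ Ω mΩ _ (otherSigma N T a) _ _ _).2 ?_
    rwa [MeasurableSpace.comap_id]
  exact @_root_.measure_residual Ω mΩ P Ω (otherSigma N T a) _ id
    (measurable_id'' (h.otherSigma_le a)) _ (h.measurable_exp a) (h.exp a).map_eq hind _ hC _ hV hV0 _ hB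

lemma map_initial_fullData (h : IsKData P N T) :
    P.map (fun ω => (T none ω, fullData N T ω)) = (expMeasure 1).prod (P.map (fullData N T)) := by
  have hφ : Measurable fun r : (ℕ+ → ℝ≥0 → ℕ) × (({none}ᶜ : Set (Option (ℕ+ × ℕ))) → ℝ) =>
      flatData r.1 fun i => r.2 ⟨some i, by simp⟩ :=
    measurable_flatData.comp (measurable_fst.prodMk (by fun_prop))
  have hind : IndepFun (T none) (fullData N T) P := (h.indepFun_other none).comp measurable_id hφ
  rw [(indepFun_iff_map_prod_eq_prod_map_map (h.measurable_exp none).aemeasurable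
    h.measurable_fullData.aemeasurable).1 hind, (h.exp none).map_eq]

/-- If, on the event `G`, the clock is restarted at time `τ` with an initial variable and future
data which have the right joint law and are independent of `G`, then, on `G`, the process is
restarted at `z`. -/
lemma measure_inter_of_restart (h : IsKData P N T) {s t : ℝ≥0} {G : Set Ω}
    {τ : Ω → ℝ≥0} (hτ : Measurable τ) {R : Ω → ℝ} (hR : Measurable R)
    (hrect : ∀ (B₀ : Set ℝ) (B : Set (DataIndex → ℝ)), MeasurableSet B₀ → MeasurableSet B →
      P (G ∩ (R ⁻¹' B₀ ∩ futureData N T τ ⁻¹' B)) =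
        P G * (expMeasure 1 B₀ * P (fullData N T ⁻¹' B)))
    (hs : ∀ᵐ ω ∂P, ω ∈ G → kClock γ c N T y ω (τ ω) = s + ENNReal.ofReal (gammaExt γ z * R ω) ∧
      ((t : ℝ) < gammaExt γ z * R ω → kProc γ c N T y (s + t) ω = z))
    {A : Set KState} (hA : MeasurableSet A) :
    P (G ∩ kProc γ c N T y (s + t) ⁻¹' A) = P G * P (kProc γ c N T z t ⁻¹' A) := by
  have := isProbabilityMeasure_expMeasure zero_lt_one
  have hfull := h.measurable_fullData
  have hfut := h.measurable_futureData hτ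
  have hfm : IsProbabilityMeasure (P.map (fullData N T)) :=
    Measure.isProbabilityMeasure_map hfull.aemeasurable
  have : IsFiniteMeasure (P G • expMeasure 1) := Measure.smul_finite _ (measure_ne_top _ _)
  have hpair := hR.prodMk hfut
  -- The product formula on rectangles, `hrect`, determines the joint law on `G`.
  have key : (P.restrict G).map (fun ω => (R ω, futureData N T τ ω)) =
      (P G • expMeasure 1).prod (P.map (fullData N T)) := by
    refine (Measure.prod_eq fun B₀ B hB₀ hB => ?_).symm
    rw [Measure.map_apply hpair (hB₀.prod hB), Measure.restrict_apply (hpair (hB₀.prod hB)),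
      inter_comm, Measure.smul_apply, Measure.map_apply hfull hB, smul_eq_mul, mul_assoc,
      ← hrect B₀ B hB₀ hB]
    rfl
  set D : Set (ℝ × (DataIndex → ℝ)) := kProc γ c canonN canonT z t ⁻¹' A with hD
  have hDm : MeasurableSet D := measurable_canonProc t hA
  have e1 : P (G ∩ kProc γ c N T y (s + t) ⁻¹' A) =
      P (G ∩ (fun ω => (R ω, futureData N T τ ω)) ⁻¹' D) := by
    refine measure_congr ?_
    filter_upwards [hs] with ω hω
    refine propext (and_congr_right fun hG => ?_)
    simp only [hD, mem_preimage]
    rw [(h.countingPaths ω).kProc_shift_eq_canon (hω hG).1 (hω hG).2]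
  have e2 : P (kProc γ c N T z t ⁻¹' A) = P.map (fun ω => (T none ω, fullData N T ω)) D := by
    rw [Measure.map_apply ((h.measurable_exp none).prodMk hfull) hDm]
    congr 1
    ext ω
    simp only [hD, mem_preimage, h.kProc_eq_canon]
  rw [e1, e2, h.map_initial_fullData, inter_comm, ← Measure.restrict_apply (hpair hDm),
    ← Measure.map_apply hpair hDm, key, Measure.prod_smul_left, Measure.smul_apply, smul_eq_mul]

end IsKData

end

section

variable {Ω : Type*} [mΩ : MeasurableSpace Ω] {P : Measure Ω} {N : ℕ+ → ℝ≥0 → Ω → ℕ}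
  {T : Option (ℕ+ × ℕ) → Ω → ℝ} {γ : ℕ+ → ℝ} {c : ℝ≥0} {y : KState}

/-- The path of a process up to time `s`. -/
def pathUpTo {Ω : Type*} (X : ℝ≥0 → Ω → KState) (s : ℝ≥0) (ω : Ω) (r : Iic s) : KState := X r ω

lemma measurable_pathUpTo {X : ℝ≥0 → Ω → KState} (hX : ∀ r, Measurable (X r)) (s : ℝ≥0) :
    Measurable (pathUpTo X s) := measurable_pi_lambda _ fun r => hX r

omit mΩ in
lemma measurable_dataSigma_stopN (u : ℝ≥0) (x : ℕ+) (v : ℝ≥0) :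
    Measurable[dataSigma N T u] (stopN N u x v) :=
  Measurable.comp (g := fun r : (ℕ+ → ℝ≥0 → ℕ) × (Option (ℕ+ × ℕ) → ℝ) => r.1 x v)
    (by fun_prop) (comap_measurable _)

omit mΩ in
lemma measurable_dataSigma_stopT (u : ℝ≥0) (a : Option (ℕ+ × ℕ)) :
    Measurable[dataSigma N T u] (stopT N T u a) :=
  Measurable.comp (g := fun r : (ℕ+ → ℝ≥0 → ℕ) × (Option (ℕ+ × ℕ) → ℝ) => r.2 a)
    (by fun_prop) (comap_measurable _)

omit mΩ in
lemma CountingPaths.pathUpTo_stop {ω : Ω} (hN : CountingPaths N ω) {s u : ℝ≥0}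
    (h : (s : ℝ≥0∞) < kClock γ c N T y ω u) :
    pathUpTo (kProc γ c (stopN N u) (stopT N T u) y) s ω = pathUpTo (kProc γ c N T y) s ω :=
  funext fun r => hN.kProc_stop (lt_of_le_of_lt (by exact_mod_cast r.2) h)

omit mΩ in
lemma measurableSet_pathUpTo_stop (hN : ∀ ω, CountingPaths N ω) (u s : ℝ≥0)
    {S : Set (Iic s → KState)} (hS : MeasurableSet S) :
    MeasurableSet[dataSigma N T u]
      {ω | pathUpTo (kProc γ c (stopN N u) (stopT N T u) y) s ω ∈ S} :=
  measurable_pathUpTo (mΩ := dataSigma N T u) (fun r => measurable_kProc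
    (mΩ := dataSigma N T u) (fun ω => (hN ω).stopped u) (measurable_dataSigma_stopN u)
    (measurable_dataSigma_stopT u) r) s hS

/-! ### Restart from `∞` -/

/-- The time at which the clock passes `s`. -/
def passTime (γ : ℕ+ → ℝ) (c : ℝ≥0) (N : ℕ+ → ℝ≥0 → Ω → ℕ) (T : Option (ℕ+ × ℕ) → Ω → ℝ)
    (y : KState) (s : ℝ≥0) (ω : Ω) : ℝ≥0 := sInf {u | (s : ℝ≥0∞) < kClock γ c N T y ω u}

omit mΩ in
-- Since the clock is monotone, rational indices are enough to detect a passage before `u`, which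
-- turns the event into a countable union.
lemma passTime_lt_iff {ω : Ω} (hN : CountingPaths N ω) {s u : ℝ≥0}
    (h : ∃ v, (s : ℝ≥0∞) < kClock γ c N T y ω v) :
    passTime γ c N T y s ω < u ↔
      ∃ q : ℚ, Real.toNNReal q < u ∧ (s : ℝ≥0∞) < kClock γ c N T y ω (Real.toNNReal q) := by
  constructor
  · intro hu
    obtain ⟨v, hv, hvu⟩ := exists_lt_of_csInf_lt h hu
    obtain ⟨q, hq, hqu⟩ := exists_rat_toNNReal_btwn hvu
    exact ⟨q, hqu, lt_of_lt_of_le hv (kClock_mono hN.mono hq.le)⟩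
  · rintro ⟨q, hq, hs⟩
    exact lt_of_le_of_lt (csInf_le (OrderBot.bddBelow _)
      (show Real.toNNReal q ∈ {u | (s : ℝ≥0∞) < kClock γ c N T y ω u} from hs)) hq

lemma measurable_passTime (hN : ∀ ω, CountingPaths N ω) (hm : ∀ x t, Measurable (N x t))
    (hT : ∀ a, Measurable (T a)) (s : ℝ≥0) : Measurable (passTime γ c N T y s) := by
  refine measurable_of_Iio fun u => ?_
  let H : ℝ≥0 → Set Ω := fun v => {ω | (s : ℝ≥0∞) < kClock γ c N T y ω v}
  have hH : ∀ v, MeasurableSet (H v) := fun v =>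
    measurableSet_lt measurable_const (measurable_kClock hN hm hT measurable_const)
  have : passTime γ c N T y s ⁻¹' Iio u =
      (⋃ q : ℚ, {_ω | Real.toNNReal q < u} ∩ H (Real.toNNReal q)) ∪
        ((⋃ k : ℕ, H k)ᶜ ∩ {_ω | 0 < u}) := by
    ext ω
    have hex : (∃ v, (s : ℝ≥0∞) < kClock γ c N T y ω v) ↔ ω ∈ ⋃ k : ℕ, H k := by
      simp only [H, mem_iUnion, mem_ofPred_eq]
      constructor
      · rintro ⟨v, hv⟩
        obtain ⟨k, hk⟩ := exists_nat_ge v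
        exact ⟨k, hv.trans_le (kClock_mono (hN ω).mono hk)⟩
      · rintro ⟨k, hk⟩
        exact ⟨k, hk⟩
    by_cases h : ∃ v, (s : ℝ≥0∞) < kClock γ c N T y ω v
    · rw [mem_preimage, mem_Iio, passTime_lt_iff (hN ω) h]
      rw [hex] at h
      constructor
      · rintro ⟨q, hq⟩
        exact Or.inl (mem_iUnion.2 ⟨q, hq⟩)
      · rintro (h' | h')
        · exact mem_iUnion.1 h'
        · exact absurd h h'.1
    · have hempty : {u | (s : ℝ≥0∞) < kClock γ c N T y ω u} = ∅ := by
        ext v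
        simpa using not_exists.1 h v
      have h' : ∀ v, ω ∉ H v := not_exists.1 h
      simp [passTime, hempty, h']
  rw [this]
  exact (MeasurableSet.iUnion fun q => (MeasurableSet.const _).inter (hH _)).union
    ((MeasurableSet.iUnion fun k => hH _).compl.inter (.const _))

variable [IsProbabilityMeasure P]

/-- At `∞` the clock passes `s` without overshoot, so nothing is left of a sojourn and the strong
Markov property at `passTime` restarts the process. -/
lemma IsKData.measure_inter_restart_infty (h : IsKData P N T) (hγ : ∀ x, 0 < γ x)
    (hsum : Summable γ) {s : ℝ≥0} {S : Set (Iic s → KState)} (hS : MeasurableSet S) (t : ℝ≥0)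
    {A : Set KState} (hA : MeasurableSet A) :
    P ({ω | pathUpTo (kProc γ c N T y) s ω ∈ S} ∩ {ω | kProc γ c N T y s ω = OnePoint.infty} ∩
        kProc γ c N T y (s + t) ⁻¹' A) =
      P ({ω | pathUpTo (kProc γ c N T y) s ω ∈ S} ∩ {ω | kProc γ c N T y s ω = OnePoint.infty}) *
        P (kProc γ c N T OnePoint.infty t ⁻¹' A) := by
  set τ := passTime γ c N T y s with hτ
  have hτm : Measurable τ := measurable_passTime h.countingPaths h.measurable_N h.measurable_exp s
  set E : Set Ω := {ω | pathUpTo (kProc γ c N T y) s ω ∈ S} ∩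
    {ω | kProc γ c N T y s ω = OnePoint.infty} with hE
  -- If the clock never passes `s`, the infimum defining `τ` is `0` by convention; this null event
  -- is removed so that `{τ < u}` means an actual passage before `u`.
  set G : Set Ω := E ∩ {ω | ∃ v, (s : ℝ≥0∞) < kClock γ c N T y ω v} with hG
  -- On this event the clock exceeds `s` at `u`, so the path up to `s` and the passage itself can be
  -- read off the data stopped at `u`.
  have hGu : ∀ u, MeasurableSet[dataSigma N T u] (G ∩ {ω | τ ω < u}) := by
    intro u
    have hst := fun ω => (h.countingPaths ω).stopped u
    have hmN := measurable_dataSigma_stopN (N := N) (T := T) u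
    have hmT := measurable_dataSigma_stopT (N := N) (T := T) u
    have : G ∩ {ω | τ ω < u} =
        ({ω | pathUpTo (kProc γ c (stopN N u) (stopT N T u) y) s ω ∈ S} ∩
          kProc γ c (stopN N u) (stopT N T u) y s ⁻¹' {OnePoint.infty}) ∩
        ⋃ q : ℚ, {_ω | Real.toNNReal q < u} ∩
          {ω | (s : ℝ≥0∞) < kClock γ c (stopN N u) (stopT N T u) y ω (Real.toNNReal q)} := by
      ext ω
      have hN := h.countingPaths ω
      have hq : (∃ q : ℚ, Real.toNNReal q < u ∧
          (s : ℝ≥0∞) < kClock γ c N T y ω (Real.toNNReal q)) ↔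
          ω ∈ ⋃ q : ℚ, {_ω | Real.toNNReal q < u} ∩
          {ω | (s : ℝ≥0∞) < kClock γ c (stopN N u) (stopT N T u) y ω (Real.toNNReal q)} := by
        simp only [mem_iUnion, mem_inter_iff, mem_ofPred_eq]
        refine exists_congr fun q => and_congr_right fun hq => ?_
        rw [kClock_stop hN.mono hq.le]
      rw [mem_inter_iff, mem_inter_iff, mem_inter_iff _ _ (⋃ _, _), ← hq]
      have hcongr : (∃ q : ℚ, Real.toNNReal q < u ∧
          (s : ℝ≥0∞) < kClock γ c N T y ω (Real.toNNReal q)) →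
          (ω ∈ E ↔ ω ∈ {ω | pathUpTo (kProc γ c (stopN N u) (stopT N T u) y) s ω ∈ S} ∩
          kProc γ c (stopN N u) (stopT N T u) y s ⁻¹' {OnePoint.infty}) := by
        rintro ⟨q, hq, hs⟩
        have hsu := hs.trans_le (kClock_mono hN.mono hq.le)
        simp only [hE, mem_inter_iff, mem_ofPred_eq, mem_preimage, mem_singleton_iff,
          hN.pathUpTo_stop hsu, hN.kProc_stop hsu]
      constructor
      · rintro ⟨⟨h1, h2⟩, h3⟩
        have h4 := (passTime_lt_iff hN h2).1 h3
        exact ⟨(hcongr h4).1 h1, h4⟩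
      · rintro ⟨h1, h4⟩
        have h2 : ∃ v, (s : ℝ≥0∞) < kClock γ c N T y ω v := h4.imp' _ fun q hq => hq.2
        exact ⟨⟨(hcongr h4).2 h1, h2⟩, (passTime_lt_iff hN h2).2 h4⟩
    rw [this]
    refine @MeasurableSet.inter _ (_) _ _ (@MeasurableSet.inter _ (_) _ _
      (measurableSet_pathUpTo_stop h.countingPaths u s hS) ?_) ?_
    · exact measurable_kProc (mΩ := dataSigma N T u) hst hmN hmT s (measurableSet_singleton _)
    · refine @MeasurableSet.iUnion _ _ (_) _ _ fun q => @MeasurableSet.inter _ (_) _ _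
        (@MeasurableSet.const _ (_) _) ?_
      exact measurable_kClock (mΩ := dataSigma N T u) hst hmN hmT
        (@measurable_const _ _ _ (_) _) measurableSet_Ioi
  have hGE : G =ᵐ[P] E := by
    filter_upwards [h.ae_kClock_unbounded (c := c) hγ] with ω hω
    exact propext ⟨fun h' => h'.1, fun h' => ⟨h', hω y s⟩⟩
  -- The initial variable is set to `0`; its value is immaterial from `∞`.
  set D : Set (DataIndex → ℝ) := {d | kProc γ c canonN canonT OnePoint.infty t (0, d) ∈ A} with hD
  have hDm : MeasurableSet D :=
    ((measurable_canonProc t).comp (measurable_const.prodMk measurable_id)) hA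
  have e1 : (E ∩ kProc γ c N T y (s + t) ⁻¹' A : Set Ω) =ᵐ[P] (G ∩ futureData N T τ ⁻¹' D : Set Ω) := by
    filter_upwards [hGE, h.ae_kClock_unbounded (c := c) hγ,
      h.ae_kClock_ne_top (c := c) hsum] with ω hω hub hfin
    have hiff : ω ∈ G ↔ ω ∈ E := iff_of_eq hω
    refine propext ?_
    change (ω ∈ E ∧ _) ↔ (ω ∈ G ∧ _)
    rw [hiff]
    refine and_congr_right fun hωE => ?_
    have hN := h.countingPaths ω
    have h1 := hN.kClock_sInf_of_infty (fun x => (h.poisson x).zero ω) hωE.2 (hfin y) (hub y s)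
    have h2 := hN.kProc_shift_eq_canon (s := s) (t := t) (z := OnePoint.infty) (τ := τ) (R := fun _ => 0)
      (h1.trans (by simp [gammaExt])) (by simp [gammaExt])
    simp only [mem_preimage, hD, mem_ofPred_eq, h2]
  have e2 : kProc γ c N T OnePoint.infty t ⁻¹' A = fullData N T ⁻¹' D := by
    ext ω
    simp only [mem_preimage, hD, mem_ofPred_eq, h.kProc_eq_canon,
      kProc_canon_infty t (T none ω) 0]
  rw [measure_congr e1, h.measure_inter_futureData hτm hGu hDm, e2, measure_congr hGE]

end

/-! ### Restart in a sojourn at a site -/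

section

variable {Ω : Type*} {N : ℕ+ → ℝ≥0 → Ω → ℕ} {T : Option (ℕ+ × ℕ) → Ω → ℝ} {γ : ℕ+ → ℝ} {c : ℝ≥0}
  {y : KState} {ω : Ω} {p : ℕ+ × ℕ} {K : ℝ}

lemma leftLim_congr {f g : ℝ≥0 → ℝ≥0∞} (hf : Monotone f) (hg : Monotone g) {u : ℝ≥0} (hu : 0 < u)
    (h : ∀ v < u, f v = g v) : Function.leftLim f u = Function.leftLim g u := by
  refine eq_of_forall_ge_iff fun a => ?_
  rw [leftLim_le_iff hf hu, leftLim_le_iff hg hu]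
  exact forall₂_congr fun v hv => by rw [h v hv]

lemma eventTime_stop {x : ℕ+} {j : ℕ} {u : ℝ≥0}
    (hj : j ≤ N x u ω) : eventTime (stopN N u x) j ω = eventTime (N x) j ω := by
  refine le_antisymm (le_csInf ⟨u, hj⟩ fun t ht => ?_)
    (le_csInf ⟨u, by simpa [stopN] using hj⟩ fun t ht => ?_)
  · rcases le_total t u with h | h
    · exact eventTime_le (by simpa [stopN, h] using ht)
    · exact (eventTime_le (t := u) (by simpa [stopN] using hj)).trans h
  · exact (eventTime_le (show j ≤ N x (min t u) ω from ht)).trans (min_le_left _ _)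

lemma CountingPaths.inSojourn_stop (hN : CountingPaths N ω) {s u : ℝ≥0}
    (hj : p.2 + 1 ≤ N p.1 u ω) (hu : eventTime (N p.1) (p.2 + 1) ω ≤ u) :
    InSojourn γ c (stopN N u) (stopT N T u) y s ω p ↔ InSojourn γ c N T y s ω p := by
  have hst : ∀ v ≤ u, kClock γ c (stopN N u) (stopT N T u) y ω v = kClock γ c N T y ω v :=
    fun v hv => kClock_stop hN.mono hv
  unfold InSojourn
  rw [eventTime_stop hj, hst _ hu]
  rcases (zero_le (a := eventTime (N p.1) (p.2 + 1) ω)).eq_or_lt with h0 | hpos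
  · rw [← h0, leftLim_zero, leftLim_zero, hst 0 zero_le]
  · rw [leftLim_congr (kClock_mono (hN.stopped u).mono) (kClock_mono hN.mono) hpos
      fun v hv => hst v (hv.le.trans hu)]

/-- At index `τ` the variable `p` has already been used, so it is not among the future data. -/
lemma futureData_replaceT {τ : Ω → ℝ≥0} (h : p.2 + 1 ≤ N p.1 (τ ω) ω) :
    futureData N (replaceT T p K) τ ω = futureData N T τ ω := by
  have : ∀ i : ℕ+ × ℕ, replaceT T p K (some (i.1, N i.1 (τ ω) ω + i.2)) ω =
      T (some (i.1, N i.1 (τ ω) ω + i.2)) ω := by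
    intro i
    rw [replaceT, if_neg]
    intro hi
    obtain rfl := Option.some_injective _ hi
    simp at h
  simp only [futureData, this]

/-- The time already spent at time `s` in the sojourn opened by the event `p`, divided by
`γ p.1`; it does not involve `T (some p)`. -/
def sojournAge (γ : ℕ+ → ℝ) (c : ℝ≥0) (N : ℕ+ → ℝ≥0 → Ω → ℕ) (T : Option (ℕ+ × ℕ) → Ω → ℝ)
    (y : KState) (s : ℝ≥0) (p : ℕ+ × ℕ) (K : ℝ) (ω : Ω) : ℝ :=
  (s - (Function.leftLim (kClock γ c N (replaceT T p K) y ω)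
    (eventTime (N p.1) (p.2 + 1) ω)).toReal) / γ p.1

/-- The sojourn opened by the event `p` has begun at time `s`. -/
def SojournBegun (γ : ℕ+ → ℝ) (c : ℝ≥0) (N : ℕ+ → ℝ≥0 → Ω → ℕ) (T : Option (ℕ+ × ℕ) → Ω → ℝ)
    (y : KState) (s : ℝ≥0) (p : ℕ+ × ℕ) (K : ℝ) (ω : Ω) : Prop :=
  (0 < eventTime (N p.1) (p.2 + 1) ω ∧ p.2 + 1 ≤ N p.1 (eventTime (N p.1) (p.2 + 1) ω) ω) ∧
    Function.leftLim (kClock γ c N (replaceT T p K) y ω) (eventTime (N p.1) (p.2 + 1) ω) ≤ s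

lemma SojournBegun.age_nonneg {s : ℝ≥0} (hγ : 0 < γ p.1)
    (h : SojournBegun γ c N T y s p K ω) : 0 ≤ sojournAge γ c N T y s p K ω := by
  have := ENNReal.toReal_mono ENNReal.coe_ne_top h.2
  simp only [ENNReal.coe_toReal] at this
  exact div_nonneg (by linarith) hγ.le

/-- The jump formula with the left limit expressed through the age. That limit is at most `s`, hence
finite, which allows real arithmetic. The residual life `T (some p) - sojournAge` is thus the
variable `R` of the restart. -/
lemma SojournBegun.kClock_eventTime (hN : CountingPaths N ω) (hS : SimpleJumps N ω) {s : ℝ≥0}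
    (hγ : 0 < γ p.1) (hT : 0 < T (some p) ω) (h : SojournBegun γ c N T y s p K ω) :
    kClock γ c N T y ω (eventTime (N p.1) (p.2 + 1) ω) =
      ENNReal.ofReal (s + γ p.1 * (T (some p) ω - sojournAge γ c N T y s p K ω)) := by
  rw [_root_.kClock_eventTime (K := K) hN hS h.1.1 h.1.2, ← ENNReal.ofReal_mul hγ.le,
    ← ENNReal.ofReal_toReal (ne_top_of_le_ne_top ENNReal.coe_ne_top h.2),
    ← ENNReal.ofReal_add ENNReal.toReal_nonneg (by positivity)]
  congr 1
  rw [sojournAge, mul_sub, mul_div_cancel₀ _ hγ.ne']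
  ring

/-- The sojourn event is separated into a condition on the other data and the comparison of `T (some
p)` with an age that is a function of them, which is the form required by the absence of memory. -/
lemma inSojourn_iff (hN : CountingPaths N ω) (hS : SimpleJumps N ω) {s : ℝ≥0}
    (hγ : 0 < γ p.1) (hT : 0 < T (some p) ω) :
    InSojourn γ c N T y s ω p ↔
      SojournBegun γ c N T y s p K ω ∧ sojournAge γ c N T y s p K ω < T (some p) ω := by
  have hleft : 0 < eventTime (N p.1) (p.2 + 1) ω →
      Function.leftLim (kClock γ c N (replaceT T p K) y ω) (eventTime (N p.1) (p.2 + 1) ω) =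
        Function.leftLim (kClock γ c N T y ω) (eventTime (N p.1) (p.2 + 1) ω) := fun hpos =>
    leftLim_congr (kClock_mono hN.mono) (kClock_mono hN.mono) hpos fun v hv => kClock_replaceT hv
  have hiff : SojournBegun γ c N T y s p K ω →
      ((s : ℝ≥0∞) < kClock γ c N T y ω (eventTime (N p.1) (p.2 + 1) ω) ↔
        sojournAge γ c N T y s p K ω < T (some p) ω) := by
    intro h
    rw [h.kClock_eventTime hN hS hγ hT, coe_lt_ofReal_iff, lt_add_iff_pos_right,
      mul_pos_iff_of_pos_left hγ, sub_pos]
  constructor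
  · intro h
    obtain ⟨hpos, hle⟩ := hN.eventTime_pos_and_le h.1 h.2
    have hb : SojournBegun γ c N T y s p K ω := ⟨⟨hpos, hle⟩, (hleft hpos).trans_le h.1⟩
    exact ⟨hb, (hiff hb).1 h.2⟩
  · rintro ⟨hb, hlt⟩
    exact ⟨(hleft hb.1.1).symm.trans_le hb.2, (hiff hb).2 hlt⟩

lemma measurable_otherSigma_replaceT (p : ℕ+ × ℕ) (K : ℝ) (a : Option (ℕ+ × ℕ)) :
    Measurable[otherSigma N T (some p)] (replaceT T p K a) := by
  by_cases ha : a = some p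
  · have : replaceT T p K a = fun _ => K := funext fun ω => if_pos ha
    rw [this]
    exact @measurable_const _ _ _ (_) _
  · have : replaceT T p K a = T a := funext fun ω => if_neg ha
    rw [this]
    exact measurable_otherSigma_T ha

end

section

variable {Ω : Type*} [mΩ : MeasurableSpace Ω] {N : ℕ+ → ℝ≥0 → Ω → ℕ}
  {T : Option (ℕ+ × ℕ) → Ω → ℝ} {γ : ℕ+ → ℝ} {c : ℝ≥0} {y : KState} {p : ℕ+ × ℕ} {K : ℝ}

lemma measurable_sojournAge (hN : ∀ ω, CountingPaths N ω) (hm : ∀ x t, Measurable (N x t))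
    (hT : ∀ a, Measurable (replaceT T p K a)) (s : ℝ≥0) :
    Measurable (sojournAge γ c N T y s p K) :=
  (((measurable_leftLim_kClock hN hm hT
    (measurable_eventTime hN hm _ _)).ennreal_toReal).const_sub _).div_const _

lemma measurableSet_sojournBegun (hN : ∀ ω, CountingPaths N ω) (hm : ∀ x t, Measurable (N x t))
    (hT : ∀ a, Measurable (replaceT T p K a)) (s : ℝ≥0) :
    MeasurableSet {ω | SojournBegun γ c N T y s p K ω} := by
  have hσ := measurable_eventTime hN hm p.1 (p.2 + 1)
  exact ((measurableSet_lt measurable_const hσ).inter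
    (measurableSet_le measurable_const (measurable_apply_time hN hm hσ p.1))).inter
    (measurableSet_le (measurable_leftLim_kClock hN hm hT hσ) measurable_const)

variable {P : Measure Ω}

namespace IsKData

/-- This is the hypothesis of the strong Markov property at the event time: the sojourn contains
`s`, so the clock exceeds `s` at any `u` after the event, and the stopped data determine the path up
to `s`. -/
lemma measurableSet_sojourn_inter_lt (h : IsKData P N T) {s : ℝ≥0}
    {S : Set (Iic s → KState)} (hS : MeasurableSet S) (p : ℕ+ × ℕ) (u : ℝ≥0) :
    MeasurableSet[dataSigma N T u] ({ω | pathUpTo (kProc γ c N T y) s ω ∈ S} ∩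
      {ω | InSojourn γ c N T y s ω p} ∩ {ω | eventTime (N p.1) (p.2 + 1) ω < u}) := by
  have hst := fun ω => (h.countingPaths ω).stopped u
  have hmN := measurable_dataSigma_stopN (N := N) (T := T) u
  have hmT := measurable_dataSigma_stopT (N := N) (T := T) u
  -- A stopped path that does not reach `p.2 + 1` has event time `0` by convention; the condition on
  -- its value at `u` excludes this.
  have : {ω | pathUpTo (kProc γ c N T y) s ω ∈ S} ∩
      {ω | InSojourn γ c N T y s ω p} ∩ {ω | eventTime (N p.1) (p.2 + 1) ω < u} =
      {ω | pathUpTo (kProc γ c (stopN N u) (stopT N T u) y) s ω ∈ S} ∩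
      {ω | InSojourn γ c (stopN N u) (stopT N T u) y s ω p} ∩
      (stopN N u p.1 u ⁻¹' Ici (p.2 + 1) ∩ eventTime (stopN N u p.1) (p.2 + 1) ⁻¹' Iio u) := by
    ext ω
    have hN := h.countingPaths ω
    have hcongr : p.2 + 1 ≤ N p.1 u ω → eventTime (N p.1) (p.2 + 1) ω < u →
        (ω ∈ {ω | pathUpTo (kProc γ c N T y) s ω ∈ S} ∩ {ω | InSojourn γ c N T y s ω p} ↔
        ω ∈ {ω | pathUpTo (kProc γ c (stopN N u) (stopT N T u) y) s ω ∈ S} ∩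
          {ω | InSojourn γ c (stopN N u) (stopT N T u) y s ω p}) := by
      intro hj hu
      simp only [mem_inter_iff, mem_ofPred_eq, hN.inSojourn_stop hj hu.le]
      refine and_congr_left fun hin => ?_
      rw [hN.pathUpTo_stop (hin.2.trans_le (kClock_mono hN.mono hu.le))]
    have hval : stopN N u p.1 u ω = N p.1 u ω := stopN_apply le_rfl _
    constructor
    · rintro ⟨h1, hu⟩
      have hj : p.2 + 1 ≤ N p.1 u ω :=
        (hN.eventTime_pos_and_le h1.2.1 h1.2.2).2.trans (hN.mono p.1 (le_of_lt hu))
      refine ⟨(hcongr hj hu).1 h1, ?_, ?_⟩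
      · rw [mem_preimage, hval]; exact hj
      · rw [mem_preimage, eventTime_stop hj]; exact hu
    · rintro ⟨h1, hj, hu⟩
      rw [mem_preimage, hval] at hj
      rw [mem_preimage, eventTime_stop hj] at hu
      exact ⟨(hcongr hj hu).2 h1, hu⟩
  rw [this]
  refine @MeasurableSet.inter _ (_) _ _ (@MeasurableSet.inter _ (_) _ _
    (measurableSet_pathUpTo_stop h.countingPaths u s hS) ?_) (@MeasurableSet.inter _ (_) _ _ ?_ ?_)
  · exact measurableSet_inSojourn (mΩ := dataSigma N T u) hst hmN hmT s p
  · exact hmN p.1 u measurableSet_Ici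
  · exact measurable_eventTime (mΩ := dataSigma N T u) hst hmN _ _ measurableSet_Iio

variable [IsProbabilityMeasure P]

/-- The restart takes place at the event time `σ`, with the residual life of `T (some p)` as initial
variable. This life is exponential given everything determined by the other data, and the event `G`
is expressed through these together with the comparison of `T (some p)` with its age. -/
lemma measure_inter_restart_sojourn (h : IsKData P N T) (hγ : ∀ x, 0 < γ x)
    {s : ℝ≥0} {S : Set (Iic s → KState)} (hS : MeasurableSet S)
    (p : ℕ+ × ℕ) (t : ℝ≥0) {A : Set KState} (hA : MeasurableSet A) :
    P ({ω | pathUpTo (kProc γ c N T y) s ω ∈ S} ∩ {ω | InSojourn γ c N T y s ω p} ∩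
        kProc γ c N T y (s + t) ⁻¹' A) =
      P ({ω | pathUpTo (kProc γ c N T y) s ω ∈ S} ∩ {ω | InSojourn γ c N T y s ω p}) *
        P (kProc γ c N T p.1 t ⁻¹' A) := by
  set σ := eventTime (N p.1) (p.2 + 1) with hσ
  -- Any value with `γ p.1 * K > s` would do: it keeps the altered process in this sojourn at time
  -- `s`.
  let K : ℝ := (s + 1) / γ p.1
  have hK : (s : ℝ≥0∞) < ENNReal.ofReal (γ p.1) * ENNReal.ofReal K := by
    rw [← ENNReal.ofReal_mul (hγ _).le, coe_lt_ofReal_iff, mul_div_cancel₀ _ (hγ _).ne']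
    linarith
  have hN := h.countingPaths
  have hσm : Measurable σ := measurable_eventTime hN h.measurable_N _ _
  have hmN := measurable_otherSigma_N (N := N) (T := T) (some p)
  have hmT := measurable_otherSigma_replaceT (N := N) (T := T) p K
  set G : Set Ω := {ω | pathUpTo (kProc γ c N T y) s ω ∈ S} ∩
    {ω | InSojourn γ c N T y s ω p} with hG
  set V := sojournAge γ c N T y s p K with hV
  have hVm' : Measurable[otherSigma N T (some p)] V := measurable_sojournAge (mΩ := otherSigma N T (some p)) hN hmN hmT s
  have hVm : Measurable V := hVm'.mono (h.otherSigma_le _) le_rfl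
  -- All three conditions are stated with the replaced variable, so `C B` does not involve `T (some
  -- p)`.
  let C : Set (DataIndex → ℝ) → Set Ω := fun B =>
    {ω | pathUpTo (kProc γ c N (replaceT T p K) y) s ω ∈ S} ∩
      {ω | SojournBegun γ c N T y s p K ω} ∩ futureData N (replaceT T p K) σ ⁻¹' B
  have hC : ∀ B, MeasurableSet B → MeasurableSet[otherSigma N T (some p)] (C B) := by
    intro B hB
    refine @MeasurableSet.inter _ (_) _ _ (@MeasurableSet.inter _ (_) _ _ ?_ ?_) ?_
    · exact measurable_pathUpTo (mΩ := otherSigma N T (some p))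
        (fun r => measurable_kProc (mΩ := otherSigma N T (some p)) hN hmN hmT r) s hS
    · exact measurableSet_sojournBegun (mΩ := otherSigma N T (some p)) hN hmN hmT s
    · exact _root_.measurable_futureData (mΩ := otherSigma N T (some p)) hN hmN hmT
        (measurable_eventTime (mΩ := otherSigma N T (some p)) hN hmN _ _) hB
  -- On the sojourn the replacement changes neither the path up to `s` nor the data after `σ`.
  have hGC : ∀ B, ∀ᵐ ω ∂P, (ω ∈ G ∧ futureData N T σ ω ∈ B) ↔
      (ω ∈ C B ∧ V ω < T (some p) ω) := by
    intro B
    filter_upwards [h.ae_simpleJumps, h.ae_exp_pos] with ω hω hT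
    have hiff := inSojourn_iff (c := c) (y := y) (s := s) (K := K) (hN ω) hω (hγ p.1) (hT (some p))
    have hpath : InSojourn γ c N T y s ω p →
        pathUpTo (kProc γ c N (replaceT T p K) y) s ω = pathUpTo (kProc γ c N T y) s ω :=
      fun hin => funext fun r => hin.kProc_replaceT (hN ω) hK r.2
    have hfut : SojournBegun γ c N T y s p K ω →
        futureData N (replaceT T p K) σ ω = futureData N T σ ω :=
      fun hb => futureData_replaceT hb.1.2
    simp only [hG, C, mem_inter_iff, mem_ofPred_eq, mem_preimage]
    constructor
    · rintro ⟨⟨h1, h2⟩, h3⟩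
      obtain ⟨h4, h5⟩ := hiff.1 h2
      rw [hpath h2, hfut h4]
      exact ⟨⟨⟨h1, h4⟩, h3⟩, h5⟩
    · rintro ⟨⟨⟨h1, h4⟩, h3⟩, h5⟩
      have h2 := hiff.2 ⟨h4, h5⟩
      rw [hpath h2] at h1
      rw [hfut h4] at h3
      exact ⟨⟨h1, h2⟩, h3⟩
  refine h.measure_inter_of_restart (τ := σ) (R := fun ω => T (some p) ω - V ω) hσm
    ((h.measurable_exp _).sub hVm) (fun B₀ B hB₀ hB => ?_) ?_ hA
  · have e1 : P (G ∩ ((fun ω => T (some p) ω - V ω) ⁻¹' B₀ ∩ futureData N T σ ⁻¹' B)) =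
        P {ω | ω ∈ C B ∧ V ω < T (some p) ω ∧ T (some p) ω - V ω ∈ B₀} := by
      refine measure_congr ?_
      filter_upwards [hGC B] with ω hω
      refine propext ?_
      change (ω ∈ G ∧ T (some p) ω - V ω ∈ B₀ ∧ futureData N T σ ω ∈ B) ↔
        (ω ∈ C B ∧ V ω < T (some p) ω ∧ T (some p) ω - V ω ∈ B₀)
      tauto
    have e2 : P (G ∩ futureData N T σ ⁻¹' B) = P {ω | ω ∈ C B ∧ V ω < T (some p) ω} := by
      refine measure_congr ?_
      filter_upwards [hGC B] with ω hω
      exact propext hω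
    -- The absence of memory splits off the factor of `B₀`, then the strong Markov property at `σ`
    -- that of `B`.
    rw [e1, h.measure_residual (some p) (hC B hB) hVm'
      (fun ω hω => SojournBegun.age_nonneg (hγ _) hω.1.2) hB₀, ← e2,
      h.measure_inter_futureData hσm (fun u => h.measurableSet_sojourn_inter_lt hS p u) hB]
    ring
  · filter_upwards [h.ae_simpleJumps, h.ae_exp_pos] with ω hω hT hωG
    have hin : InSojourn γ c N T y s ω p := hωG.2
    obtain ⟨hb, hlt⟩ := (inSojourn_iff (K := K) (hN ω) hω (hγ p.1) (hT (some p))).1 hin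
    have hclock : kClock γ c N T y ω (σ ω) =
        s + ENNReal.ofReal (γ p.1 * (T (some p) ω - V ω)) := by
      rw [hσ, hb.kClock_eventTime (hN ω) hω (hγ p.1) (hT (some p)), ENNReal.ofReal_add (NNReal.coe_nonneg s),
        ENNReal.ofReal_coe_nnreal]
      exact mul_nonneg (hγ _).le (sub_pos.2 hlt).le
    -- Until the residual life is used up, `s + t` lies in the same sojourn.
    refine ⟨hclock, fun ht => ?_⟩
    have hin' : InSojourn γ c N T y (s + t) ω p := by
      refine ⟨hin.1.trans (by simp), ?_⟩
      change _ < kClock γ c N T y ω (σ ω)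
      rw [hclock, ENNReal.coe_add]
      exact ENNReal.add_lt_add_left ENNReal.coe_ne_top (coe_lt_ofReal_iff.2 ht)
    exact hin'.kProc_eq (hN ω) hω

end IsKData

end

/-! ### Restart in the initial sojourn and the Markov property -/

section

variable {Ω : Type*} [mΩ : MeasurableSpace Ω] {P : Measure Ω} {N : ℕ+ → ℝ≥0 → Ω → ℕ}
  {T : Option (ℕ+ × ℕ) → Ω → ℝ} {γ : ℕ+ → ℝ} {c : ℝ≥0} {y : KState}

namespace IsKData

lemma futureData_zero (h : IsKData P N T) : futureData N T (fun _ => 0) = fullData N T := by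
  ext ω i
  simp [futureData, fullData, shiftN, (h.poisson _).zero]

omit mΩ in
lemma measurable_otherSigma_fullData :
    Measurable[otherSigma N T none] (fullData N T) :=
  measurable_flatData.comp (@Measurable.prodMk _ _ _ _ _ (_) _ _
    (@measurable_pi_lambda _ _ _ (_) _ _ fun x => @measurable_pi_lambda _ _ _ (_) _ _ fun t =>
      measurable_otherSigma_N none x t)
    (@measurable_pi_lambda _ _ _ (_) _ _ fun i => measurable_otherSigma_T (by simp)))

/-- From a site, the initial sojourn has positive length. From `∞`, a sojourn containing `0` would
open at some `u > 0` with the clock vanishing before `u`, whereas the clock is positive at all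
positive indices. -/
lemma ae_kProc_zero (h : IsKData P N T) (hγ : ∀ x, 0 < γ x) (y : KState) :
    ∀ᵐ ω ∂P, kProc γ c N T y 0 ω = y := by
  filter_upwards [h.ae_exp_pos, h.ae_kClock_pos (c := c) hγ] with ω hT hpos
  have hN := h.countingPaths ω
  induction y using OnePoint.rec with
  | infty =>
    by_contra hne
    obtain ⟨x, hx⟩ := OnePoint.ne_infty_iff_exists.1 hne
    rcases exists_sitsAt_of_kProc hx.symm with ⟨-, h'⟩ | ⟨-, h'⟩
    · exact OnePoint.infty_ne_coe x h'
    · obtain ⟨u, hu, -, hle, -⟩ := hN.sitsAt_iff.1 h'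
      have h1 := hle (u / 2) (NNReal.half_lt_self hu.ne')
      have h2 := hpos OnePoint.infty (u / 2) (half_pos hu)
      exact h1.not_gt (by simpa using h2)
  | coe x =>
    refine kProc_eq_self ?_
    simpa [gammaExt] using mul_pos (hγ x) (hT none)

variable [IsProbabilityMeasure P]

/-- In the initial sojourn the path up to `s` is constant, so an event of the past is trivial there.
The restart is at index `0`, and the initial variable loses the age `s / γ x`. -/
lemma measure_inter_restart_initial (h : IsKData P N T) (hγ : ∀ x, 0 < γ x)
    {s : ℝ≥0} {S : Set (Iic s → KState)} (t : ℝ≥0) {A : Set KState} (hA : MeasurableSet A) :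
    P ({ω | pathUpTo (kProc γ c N T y) s ω ∈ S} ∩ {ω | (s : ℝ) < gammaExt γ y * T none ω} ∩
        kProc γ c N T y (s + t) ⁻¹' A) =
      P ({ω | pathUpTo (kProc γ c N T y) s ω ∈ S} ∩ {ω | (s : ℝ) < gammaExt γ y * T none ω}) *
        P (kProc γ c N T y t ⁻¹' A) := by
  set E : Set Ω := {ω | (s : ℝ) < gammaExt γ y * T none ω} with hE
  have hpath : ∀ ω ∈ E, pathUpTo (kProc γ c N T y) s ω = fun _ => y := fun ω hω =>
    funext fun r => kProc_eq_self (lt_of_le_of_lt (NNReal.coe_le_coe.2 r.2) hω)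
  have hG : {ω | pathUpTo (kProc γ c N T y) s ω ∈ S} ∩ E = E ∩ {_ω | (fun _ => y) ∈ S} := by
    ext ω
    rw [inter_comm]
    exact and_congr_right fun hω => by simp only [mem_ofPred_eq, hpath ω hω]
  rw [hG]
  by_cases hc : (fun _ => y) ∈ S
  swap
  · simp [hc]
  simp only [hc, ofPred_true, inter_univ]
  induction y using OnePoint.rec with
  | infty =>
    have : E = ∅ := by
      ext ω
      simp [hE, gammaExt]
    simp [this]
  | coe x =>
    have hγx : gammaExt γ (x : KState) = γ x := rfl
    have hiff : ∀ ω, ω ∈ E ↔ s / γ x < T none ω := fun ω => by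
      rw [div_lt_iff₀' (hγ x)]; rfl
    refine h.measure_inter_of_restart (τ := fun _ => 0) (R := fun ω => T none ω - s / γ x)
      measurable_const ((h.measurable_exp none).sub_const _) (fun B₀ B hB₀ hB => ?_) ?_ hA
    · have hF : ∀ u, MeasurableSet[dataSigma N T u] (E ∩ {ω | (fun _ : Ω => (0 : ℝ≥0)) ω < u}) := by
        intro u
        refine @MeasurableSet.inter _ (_) _ _ ?_ (@MeasurableSet.const _ (_) _)
        have : E = stopT N T u none ⁻¹' Ioi (s / γ x) := Set.ext hiff
        rw [this]
        exact measurable_dataSigma_stopT u none measurableSet_Ioi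
      have e1 : E ∩ ((fun ω => T none ω - s / γ x) ⁻¹' B₀ ∩ futureData N T (fun _ => 0) ⁻¹' B) =
          {ω | ω ∈ fullData N T ⁻¹' B ∧ s / γ x < T none ω ∧ T none ω - s / γ x ∈ B₀} := by
        ext ω
        simp only [mem_inter_iff, hiff, mem_preimage, h.futureData_zero, mem_ofPred_eq]
        tauto
      have e2 : {ω | ω ∈ fullData N T ⁻¹' B ∧ s / γ x < T none ω} =
          E ∩ futureData N T (fun _ => 0) ⁻¹' B := by
        ext ω
        simp only [mem_inter_iff, hiff, mem_preimage, h.futureData_zero, mem_ofPred_eq]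
        tauto
      rw [e1, h.measure_residual none (measurable_otherSigma_fullData hB)
        (V := fun _ => s / γ x) (@measurable_const _ _ _ (_) _)
        (fun _ _ => div_nonneg s.2 (hγ x).le) hB₀, e2,
        h.measure_inter_futureData measurable_const hF hB]
      ring
    · refine ae_of_all _ fun ω hω => ?_
      have hR : gammaExt γ (x : KState) * (T none ω - s / γ x) =
          gammaExt γ (x : KState) * T none ω - s := by
        rw [hγx, mul_sub, mul_div_cancel₀ _ (hγ x).ne']
      have hω' : (s : ℝ) < gammaExt γ (x : KState) * T none ω := hω
      rw [hR]
      refine ⟨?_, fun ht => kProc_eq_self ?_⟩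
      · have : kClock γ c N T (x : KState) ω 0 =
            ENNReal.ofReal (gammaExt γ (x : KState) * T none ω) := by
          simp [kClock, (h.poisson _).zero]
        rw [this, ← ENNReal.ofReal_coe_nnreal (p := s),
          ← ENNReal.ofReal_add (NNReal.coe_nonneg s) (sub_pos.2 hω').le]
        congr 1
        ring
      · push_cast
        linarith

/-- The simple Markov property, in terms of events of the past. -/
lemma measure_pathUpTo_inter (h : IsKData P N T) (hγ : ∀ x, 0 < γ x) (hsum : Summable γ)
    {s : ℝ≥0} {S : Set (Iic s → KState)} (hS : MeasurableSet S) (t : ℝ≥0) {A : Set KState}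
    (hA : MeasurableSet A) :
    P ({ω | pathUpTo (kProc γ c N T y) s ω ∈ S} ∩ kProc γ c N T y (s + t) ⁻¹' A) =
      ∫⁻ ω in {ω | pathUpTo (kProc γ c N T y) s ω ∈ S},
        P (kProc γ c N T (kProc γ c N T y s ω) t ⁻¹' A) ∂P := by
  have hN := h.countingPaths
  have hm : ∀ r, Measurable (kProc γ c N T y r) := fun r =>
    measurable_kProc hN h.measurable_N h.measurable_exp r
  set F : Set Ω := {ω | pathUpTo (kProc γ c N T y) s ω ∈ S} with hF
  have hFm : MeasurableSet F := measurable_pathUpTo hm s hS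
  -- The three kinds of situation at time `s`, each with its own restart; `z` below is the state at
  -- time `s`.
  let E : Option (Option (ℕ+ × ℕ)) → Set Ω := fun a => match a with
    | none => {ω | (s : ℝ) < gammaExt γ y * T none ω}
    | some none => {ω | kProc γ c N T y s ω = OnePoint.infty}
    | some (some p) => {ω | InSojourn γ c N T y s ω p}
  let z : Option (Option (ℕ+ × ℕ)) → KState := fun a => match a with
    | none => y
    | some none => OnePoint.infty
    | some (some p) => p.1
  have hEm : ∀ a, MeasurableSet (E a) := by
    rintro (_ | _ | p)
    · exact measurableSet_lt measurable_const (measurable_const.mul (h.measurable_exp none))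
    · exact hm s (measurableSet_singleton _)
    · exact measurableSet_inSojourn hN h.measurable_N h.measurable_exp s p
  have hcov : ∀ ω, ∃ a, ω ∈ E a := by
    intro ω
    by_cases h0 : (s : ℝ) < gammaExt γ y * T none ω
    · exact ⟨none, h0⟩
    by_cases h1 : kProc γ c N T y s ω = OnePoint.infty
    · exact ⟨some none, h1⟩
    obtain ⟨x, hx⟩ := OnePoint.ne_infty_iff_exists.1 h1
    rcases exists_sitsAt_of_kProc hx.symm with ⟨h', -⟩ | ⟨-, h'⟩
    · exact absurd h' h0
    · obtain ⟨i, hi⟩ := sitsAt_iff_inSojourn.1 h'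
      exact ⟨some (some (x, i)), hi⟩
  have hz : ∀ a, ∀ᵐ ω ∂P, ω ∈ E a → kProc γ c N T y s ω = z a := by
    rintro (_ | _ | p)
    · exact ae_of_all _ fun ω hω => kProc_eq_self hω
    · exact ae_of_all _ fun ω hω => hω
    · filter_upwards [h.ae_simpleJumps] with ω hS hω using InSojourn.kProc_eq (hN ω) hS hω
  -- The cases exclude each other only when jumps are simple, hence the almost everywhere versions
  -- of countable additivity below.
  have hdisj : ∀ᵐ ω ∂P, ∀ a b, ω ∈ E a → ω ∈ E b → a = b := by
    filter_upwards [h.ae_simpleJumps] with ω hS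
    have h01 : ω ∈ E none → ω ∉ E (some none) := fun h0 h1 => (kProc_eq_infty h1).1 h0
    have h0p : ∀ p, ω ∈ E none → ω ∉ E (some (some p)) := fun p h0 hp =>
      InSojourn.not_lt_initial (hN ω) hp h0
    have h1p : ∀ p, ω ∈ E (some none) → ω ∉ E (some (some p)) := fun p h1 hp =>
      OnePoint.infty_ne_coe p.1 (h1.symm.trans (InSojourn.kProc_eq (hN ω) hS hp))
    rintro (_ | _ | p) (_ | _ | q) ha hb
    · rfl
    · exact absurd hb (h01 ha)
    · exact absurd hb (h0p q ha)
    · exact absurd ha (h01 hb)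
    · rfl
    · exact absurd hb (h1p q ha)
    · exact absurd ha (h0p p hb)
    · exact absurd ha (h1p p hb)
    · rw [InSojourn.unique (hN ω) hS ha hb]
  have hpiece : ∀ a, P (F ∩ E a ∩ kProc γ c N T y (s + t) ⁻¹' A) =
      P (F ∩ E a) * P (kProc γ c N T (z a) t ⁻¹' A) := by
    rintro (_ | _ | p)
    · exact h.measure_inter_restart_initial hγ t hA
    · exact h.measure_inter_restart_infty hγ hsum hS t hA
    · exact h.measure_inter_restart_sojourn hγ hS p t hA
  have hpair : ∀ D : Set Ω, Pairwise (Function.onFun (AEDisjoint P) fun a => F ∩ E a ∩ D) := by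
    intro D a b hab
    refine measure_mono_null (t := {ω | ¬ ∀ a b, ω ∈ E a → ω ∈ E b → a = b}) ?_ (ae_iff.1 hdisj)
    rintro ω ⟨⟨⟨-, ha⟩, -⟩, ⟨-, hb⟩, -⟩ hω
    exact hab (hω a b ha hb)
  have hpair' : Pairwise (Function.onFun (AEDisjoint P) fun a => F ∩ E a) := by
    simpa using hpair univ
  have hunion : ⋃ a, F ∩ E a = F := by
    rw [← inter_iUnion, iUnion_eq_univ_iff.2 hcov, inter_univ]
  have hAm : MeasurableSet (kProc γ c N T y (s + t) ⁻¹' A) := hm _ hA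
  conv_rhs => rw [← hunion]
  rw [lintegral_iUnion₀ (fun a => (hFm.inter (hEm a)).nullMeasurableSet) hpair']
  conv_lhs => rw [← hunion, iUnion_inter]
  rw [measure_iUnion₀ (hpair _) fun a => ((hFm.inter (hEm a)).inter hAm).nullMeasurableSet]
  refine tsum_congr fun a => ?_
  rw [hpiece a]
  have : ∫⁻ ω in F ∩ E a, P (kProc γ c N T (kProc γ c N T y s ω) t ⁻¹' A) ∂P =
      ∫⁻ _ω in F ∩ E a, P (kProc γ c N T (z a) t ⁻¹' A) ∂P := by
    refine setLIntegral_congr_fun_ae (hFm.inter (hEm a)) ?_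
    filter_upwards [hz a] with ω hω hmem
    rw [hω hmem.2]
  rw [this, setLIntegral_const, mul_comm]

lemma isMarkovFamily (h : IsKData P N T) (hγ : ∀ x, 0 < γ x) (hsum : Summable γ) :
    IsMarkovFamily P (kProc γ c N T) := by
  have hm : ∀ y r, Measurable (kProc γ c N T y r) := fun y r =>
    measurable_kProc h.countingPaths h.measurable_N h.measurable_exp r
  refine ⟨hm, h.ae_kProc_zero hγ, fun y s t A hA => ?_⟩
  have hle : pastSigma (kProc γ c N T y) s ≤ mΩ := iSup₂_le fun r _ => (hm y r).comap_le
  have hAm : MeasurableSet (kProc γ c N T y (s + t) ⁻¹' A) := hm _ _ hA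
  have hXs : Measurable[pastSigma (kProc γ c N T y) s] (kProc γ c N T y s) :=
    measurable_iff_comap_le.2 (le_iSup₂ (f := fun r (_ : r ∈ Iic s) =>
      MeasurableSpace.comap (kProc γ c N T y r) KState.instMeasurableSpace) s self_mem_Iic)
  let g : KState → ℝ := fun z => P.real (kProc γ c N T z t ⁻¹' A)
  have hgm : Measurable[pastSigma (kProc γ c N T y) s] fun ω => g (kProc γ c N T y s ω) :=
    (measurable_of_countable g).comp hXs
  have hgm' : Measurable fun ω => g (kProc γ c N T y s ω) := hgm.mono hle le_rfl
  have hgint : Integrable (fun ω => g (kProc γ c N T y s ω)) P := by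
    refine Integrable.of_bound hgm'.aestronglyMeasurable 1 (ae_of_all _ fun ω => ?_)
    rw [Real.norm_of_nonneg measureReal_nonneg]
    exact measureReal_le_one
  -- The conditional expectation is identified by its integrals over past events, which are
  -- conditions on the path up to `s`.
  refine (ae_eq_condExp_of_forall_setIntegral_eq hle ((integrable_const _).indicator hAm)
    (fun F _ _ => hgint.integrableOn) (fun F hF _ => ?_)
    hgm.stronglyMeasurable.aestronglyMeasurable).symm
  obtain ⟨S, hS, rfl⟩ := exists_preimage_of_measurableSet_pastSigma hF
  have key := h.measure_pathUpTo_inter (c := c) (y := y) hγ hsum hS t hA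
  rw [integral_eq_lintegral_of_nonneg_ae (ae_of_all _ fun _ => measureReal_nonneg)
    hgm'.aestronglyMeasurable, integral_indicator_const _ hAm, smul_eq_mul, mul_one,
    measureReal_restrict_apply hAm, measureReal_def, inter_comm]
  congr 1
  refine Eq.trans ?_ key.symm
  refine lintegral_congr fun ω => ?_
  exact ofReal_measureReal

end IsKData

end

end

theorem proposition3p1 {Ω : Type*} [MeasurableSpace Ω] (P : Measure Ω) [IsProbabilityMeasure P]
    (γ : ℕ+ → ℝ) (hγ_pos : ∀ x, 0 < γ x) (hγ_sum : Summable γ) (c : ℝ≥0)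
    (N : ℕ+ → ℝ≥0 → Ω → ℕ) (T : Option (ℕ+ × ℕ) → Ω → ℝ) (hNT : IsKData P N T) :
    (∀ y : KState, ∀ᵐ ω ∂P, IsCadlag (fun t => kProc γ c N T y t ω)) ∧
      IsMarkovFamily P (kProc γ c N T) := by
  refine ⟨fun y => ?_, hNT.isMarkovFamily hγ_pos hγ_sum⟩
  filter_upwards [hNT.ae_kClock_unbounded (c := c) hγ_pos] with ω hω
  exact (hNT.countingPaths ω).isCadlag_kProc (hω y)
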